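/- Let $p$ be a prime, $R$ a commutative $\mathbb F_p$-algebra and $m\ge 0$. For a finitely generated projective $R$-module $P$ with a $p$-linear map $\varphi:P\to P$ (additive, $\varphi(rx)=r^p\varphi(x)$), let $A_{P,\varphi}$ be the commutative affine group $R$-scheme whose points over an $R$-algebra $S$ are the $R$-linear maps $\xi:P\to S$ with $\xi(\varphi(x))=\xi(x)^p$ for all $x\in P$. For commutative group schemes $A_1,\dots,A_m$ over $R$ let $\underline{\mathrm{Poly\text{-}add}}(A_1\times\dots\times A_m,\mathbb G_m)$ be the group functor whose $S$-points are the maps $\prod_i (A_i)_S\to(\mathbb G_m)_S$ over $S$ that are additive in each variable; $H^{(F)}$ denotes the kernel of the relative Frobenius of $H$, and $A^*=\underline{\mathrm{Hom}}(A,\mathbb G_m)$ the Cartier dual. A commutative group $R$-scheme is 1-smooth of rank $r$ ($r$ a function on $\operatorname{Spec}R$) if Zariski-locally on $\operatorname{Spec} R$ it is isomorphic, as a pointed scheme, to $\operatorname{Spec}R[x_1,\dots,x_r]/(x_1^p,\dots,x_r^p)$ (with base point $x=0$); a group $R$-scheme is 1-cosmooth of rank $r$ if it is isomorphic to the Cartier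 dual of a commutative 1-smooth group scheme of rank $r$. (i) Let $(P_1,\varphi_1),\dots,(P_m,\varphi_m)$ be as above and $(P,\varphi)=\bigotimes_i(P_i,\varphi_i)$, i.e. $P=\bigotimes_i P_i$ and $\varphi(x_1\otimes\dots\otimes x_m)=\varphi_1(x_1)\otimes\dots\otimes\varphi_m(x_m)$. The homomorphism $A_{P,\varphi}^*\to\underline{\mathrm{Poly\text{-}add}}(A_{P_1,\varphi_1}\times\dots\times A_{P_m,\varphi_m},\mathbb G_m)$ given by composition with the poly-additive map $\prod_i A_{P_i,\varphi_i}\to A_{P,\varphi}$, $(\xi_i)_i\mapsto\bigl(x_1\otimes\dots\otimes x_m\mapsto\prod_i\xi_i(x_i)\bigr)$, induces an isomorphism $$A_{P,\varphi}^*\xrightarrow{\ \sim\ }\underline{\mathrm{Poly\text{-}add}}(A_{P_1,\varphi_1}\times\dots\times A_{P_m,\varphi_m},\mathbb G_m)^{(F)}.$$ (ii) For any 1-cosmooth group schemes $A_1,\dots,A_m$ over $R$, of ranks $r_1,\dots,r_m$, the group functor $K=\underline{\mathrm{Poly\text{-}add}}(A_1\times\dots\times A_m,\mathbb G_m)^{(F)}$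 is a 1-smooth group scheme of rank $\prod_i r_i$, and there is a canonical isomorphism of restricted Lie $R$-algebras (with zero commutator) $\operatorname{Lie}(K)\xrightarrow{\sim}\bigotimes_i\operatorname{Lie}(A_i^*)$, where the $p$-operation on the right is the tensor product of the $p$-linear $p$-operations. Explicitly, if tangent vectors $D_i\in\operatorname{Lie}(A_i^*)$ correspond to the homomorphisms $1+\varepsilon\xi_i:A_i\to\mathbb G_m$ over $R[\varepsilon]/(\varepsilon^2)$, then $D_1\otimes\dots\otimes D_m$ corresponds to the tangent vector $1+\varepsilon\prod_i\xi_i$ of $K$. -/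

import Mathlib

open CategoryTheory TensorProduct WithConv
open scoped DualNumber

universe u v w

noncomputable section

/-! ### Frobenius in characteristic `p` (the zero ring is allowed) -/

section Frobenius

variable (p : ℕ) [hp : Fact p.Prime]

theorem natCast_p_eq_zero (A : Type*) [Ring A] [Algebra (ZMod p) A] : (p : A) = 0 := by
  have h := map_natCast (algebraMap (ZMod p) A) p
  rw [ZMod.natCast_self, map_zero] at h
  exact h.symm

theorem natCast_p_eq_zero_of_algebra (R : Type*) [CommRing R] [Algebra (ZMod p) R]
    (A : Type*) [Ring A] [Algebra R A] : (p : A) = 0 := by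
  rw [← map_natCast (algebraMap R A), natCast_p_eq_zero, map_zero]

theorem add_pow_p_of_commute {A : Type*} [Ring A] (h0 : (p : A) = 0) {x y : A}
    (h : Commute x y) : (x + y) ^ p = x ^ p + y ^ p := by
  obtain ⟨r, hr⟩ := h.exists_add_pow_prime_eq hp.out
  rw [hr, h0]
  simp

/-- The absolute Frobenius `x ↦ x ^ p` of an `𝔽_p`-algebra. -/
def frob (R : Type*) [CommRing R] [Algebra (ZMod p) R] : R →+* R where
  toFun x := x ^ p
  map_one' := one_pow p
  map_mul' x y := mul_pow x y p
  map_zero' := zero_pow hp.out.ne_zero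
  map_add' x y := add_pow_p_of_commute p (natCast_p_eq_zero p R) (Commute.all x y)

@[simp] theorem frob_apply (R : Type*) [CommRing R] [Algebra (ZMod p) R] (x : R) :
    frob p R x = x ^ p := rfl

end Frobenius

/-! ### Commutative group functors on commutative algebras -/

/-- Functors from commutative `R`-algebras to commutative groups. A commutative affine group
scheme over `R` is such a functor which is represented by a Hopf algebra. -/
abbrev GrpFunctor (R : Type u) [CommRing R] := CommAlgCat.{u} R ⥤ CommGrpCat.{v}

/-- A natural isomorphism of group functors with values in possibly different universes. -/
structure GrpFunctorIso {R : Type u} [CommRing R] (F : GrpFunctor.{u, v} R)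
    (G : GrpFunctor.{u, w} R) where
  equiv : ∀ S : CommAlgCat.{u} R, F.obj S ≃* G.obj S
  naturality : ∀ {S T : CommAlgCat.{u} R} (f : S ⟶ T) (x : F.obj S),
    equiv T ((F.map f).hom x) = (G.map f).hom (equiv S x)

/-- The multiplicative group `𝔾_m` over `R`. -/
def Gm (R : Type u) [CommRing R] : GrpFunctor.{u, u} R where
  obj S := CommGrpCat.of (S : Type u)ˣ
  map f := CommGrpCat.ofHom (Units.map (f.hom : _ →* _))

/-- The group `Spec C (S) = Hom_{R-alg}(C, S)` with the convolution product. -/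
@[reducible] def pointsCommGroup (R : Type u) [CommRing R] (C : Type v) [CommRing C]
    [HopfAlgebra R C] [Coalgebra.IsCocomm R C] (S : Type w) [CommRing S] [Algebra R S] :
    CommGroup (WithConv (C →ₐ[R] S)) :=
  { (inferInstance : CommMonoid (WithConv (C →ₐ[R] S))) with
    inv := fun f => toConv (f.ofConv.comp (HopfAlgebra.antipodeAlgHom R C))
    inv_mul_cancel := fun f => by
      apply WithConv.ofConv_injective
      apply AlgHom.toLinearMap_injective
      have h := LinearMap.algHom_comp_convMul_distrib f.ofConv
        (toConv (HopfAlgebra.antipode R (A := C))) (toConv LinearMap.id)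
      rw [LinearMap.antipode_mul_id] at h
      refine Eq.trans (Eq.symm h) ?_
      ext c
      simp }

/-- The functor of points of the affine group scheme `Spec C`, for a commutative and cocommutative
Hopf algebra `C`. -/
def specGrp (R : Type u) [CommRing R] (C : Type u) [CommRing C] [HopfAlgebra R C]
    [Coalgebra.IsCocomm R C] : GrpFunctor.{u, u} R where
  obj S := @CommGrpCat.of (WithConv (C →ₐ[R] S)) (pointsCommGroup R C S)
  map {S T} f := @CommGrpCat.ofHom _ _ (pointsCommGroup R C S) (pointsCommGroup R C T)
    { toFun := fun x => toConv (f.hom.comp x.ofConv)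
      map_one' := by
        apply WithConv.ofConv_injective
        ext c
        simp
      map_mul' := fun x y => by
        apply WithConv.ofConv_injective
        exact AlgHom.comp_convMul_distrib f.hom x y }

section Hom

variable {R : Type u} [CommRing R]

/-- A homomorphism `A_S → G_S` of group functors over an `R`-algebra `S`. The `S`-algebras are
the objects of `Under S`. -/
@[ext] structure HomOver (A : GrpFunctor.{u, v} R) (G : GrpFunctor.{u, w} R)
    (S : CommAlgCat.{u} R) where
  toFun : ∀ T : Under S, A.obj T.right → G.obj T.right
  naturality : ∀ {T T' : Under S} (f : T ⟶ T') (a : A.obj T.right),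
    toFun T' ((A.map f.right).hom a) = (G.map f.right).hom (toFun T a)
  map_mul : ∀ (T : Under S) (a b : A.obj T.right), toFun T (a * b) = toFun T a * toFun T b

/-- A poly-additive map `∏ (A_i)_S → G_S` of group functors over an `R`-algebra `S`: a natural
transformation that is a homomorphism in each variable separately. -/
@[ext] structure PolyAddOver {ι : Type} [DecidableEq ι] (A : ι → GrpFunctor.{u, v} R)
    (G : GrpFunctor.{u, w} R) (S : CommAlgCat.{u} R) where
  toFun : ∀ T : Under S, (∀ i, (A i).obj T.right) → G.obj T.right
  naturality : ∀ {T T' : Under S} (f : T ⟶ T') (a : ∀ i, (A i).obj T.right),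
    toFun T' (fun i => ((A i).map f.right).hom (a i)) = (G.map f.right).hom (toFun T a)
  map_mul : ∀ (T : Under S) (i : ι) (a : ∀ i, (A i).obj T.right) (x y : (A i).obj T.right),
    toFun T (Function.update a i (x * y)) =
      toFun T (Function.update a i x) * toFun T (Function.update a i y)

namespace HomOver

variable {A : GrpFunctor.{u, v} R} {G : GrpFunctor.{u, w} R} {S : CommAlgCat.{u} R}

instance : One (HomOver A G S) := ⟨⟨fun _ _ => 1, by simp, by simp⟩⟩
instance : Mul (HomOver A G S) :=
  ⟨fun f g => ⟨fun T a => f.toFun T a * g.toFun T a,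
    fun h a => by simp [f.naturality, g.naturality],
    fun T a b => by rw [f.map_mul, g.map_mul, mul_mul_mul_comm]⟩⟩
instance : Inv (HomOver A G S) :=
  ⟨fun f => ⟨fun T a => (f.toFun T a)⁻¹, fun h a => by simp [f.naturality],
    fun T a b => by rw [f.map_mul, mul_inv]⟩⟩

@[simp] theorem one_toFun (T : Under S) (a) : (1 : HomOver A G S).toFun T a = 1 := rfl
@[simp] theorem mul_toFun (f g : HomOver A G S) (T : Under S) (a) :
    (f * g).toFun T a = f.toFun T a * g.toFun T a := rfl
@[simp] theorem inv_toFun (f : HomOver A G S) (T : Under S) (a) :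
    (f⁻¹).toFun T a = (f.toFun T a)⁻¹ := rfl

instance : CommGroup (HomOver A G S) :=
  { mul_assoc := fun f g h => by ext T a; simp [mul_assoc]
    one_mul := fun f => by ext T a; simp
    mul_one := fun f => by ext T a; simp
    inv_mul_cancel := fun f => by ext T a; simp
    mul_comm := fun f g => by ext T a; simp [mul_comm] }

/-- Base change of a homomorphism along `S → S'`. -/
def baseChange {S' : CommAlgCat.{u} R} (f : S ⟶ S') : HomOver A G S →* HomOver A G S' where
  toFun h :=
    { toFun := fun T a => h.toFun ((Under.map f).obj T) a
      naturality := fun g a => h.naturality ((Under.map f).map g) a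
      map_mul := fun T a b => h.map_mul ((Under.map f).obj T) a b }
  map_one' := rfl
  map_mul' _ _ := rfl

end HomOver

namespace PolyAddOver

variable {ι : Type} [DecidableEq ι] {A : ι → GrpFunctor.{u, v} R} {G : GrpFunctor.{u, w} R}
  {S : CommAlgCat.{u} R}

instance : One (PolyAddOver A G S) := ⟨⟨fun _ _ => 1, by simp, by simp⟩⟩
instance : Mul (PolyAddOver A G S) :=
  ⟨fun f g => ⟨fun T a => f.toFun T a * g.toFun T a,
    fun h a => by simp [f.naturality, g.naturality],
    fun T i a x y => by rw [f.map_mul, g.map_mul, mul_mul_mul_comm]⟩⟩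
instance : Inv (PolyAddOver A G S) :=
  ⟨fun f => ⟨fun T a => (f.toFun T a)⁻¹, fun h a => by simp [f.naturality],
    fun T i a x y => by rw [f.map_mul, mul_inv]⟩⟩

@[simp] theorem one_toFun (T : Under S) (a) : (1 : PolyAddOver A G S).toFun T a = 1 := rfl
@[simp] theorem mul_toFun (f g : PolyAddOver A G S) (T : Under S) (a) :
    (f * g).toFun T a = f.toFun T a * g.toFun T a := rfl
@[simp] theorem inv_toFun (f : PolyAddOver A G S) (T : Under S) (a) :
    (f⁻¹).toFun T a = (f.toFun T a)⁻¹ := rfl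

instance : CommGroup (PolyAddOver A G S) :=
  { mul_assoc := fun f g h => by ext T a; simp [mul_assoc]
    one_mul := fun f => by ext T a; simp
    mul_one := fun f => by ext T a; simp
    inv_mul_cancel := fun f => by ext T a; simp
    mul_comm := fun f g => by ext T a; simp [mul_comm] }

/-- Base change of a poly-additive map along `S → S'`. -/
def baseChange {S' : CommAlgCat.{u} R} (f : S ⟶ S') : PolyAddOver A G S →* PolyAddOver A G S' where
  toFun h :=
    { toFun := fun T a => h.toFun ((Under.map f).obj T) a
      naturality := fun g a => h.naturality ((Under.map f).map g) a
      map_mul := fun T i a x y => h.map_mul ((Under.map f).obj T) i a x y }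
  map_one' := rfl
  map_mul' _ _ := rfl

end PolyAddOver

/-- A natural family of maps over `Under S` depends on an `S`-algebra only, not on the way it is
presented as an object of `Under S`. -/
theorem HomOver.toFun_congr {A : GrpFunctor.{u, v} R} {G : GrpFunctor.{u, w} R}
    {S T : CommAlgCat.{u} R} (h : HomOver A G S) {f g : S ⟶ T} (hfg : f = g) (a : A.obj T) :
    h.toFun (Under.mk f) a = h.toFun (Under.mk g) a := by
  subst hfg; rfl

theorem PolyAddOver.toFun_congr {ι : Type} [DecidableEq ι] {A : ι → GrpFunctor.{u, v} R}
    {G : GrpFunctor.{u, w} R} {S T : CommAlgCat.{u} R} (h : PolyAddOver A G S) {f g : S ⟶ T}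
    (hfg : f = g) (a : ∀ i, (A i).obj T) :
    h.toFun (Under.mk f) a = h.toFun (Under.mk g) a := by
  subst hfg; rfl

/-- The group functor `S ↦ Hom(A_S, G_S)` of homomorphisms. -/
def homFunctor (A : GrpFunctor.{u, v} R) (G : GrpFunctor.{u, w} R) :
    GrpFunctor.{u, max (u + 1) v w} R where
  obj S := CommGrpCat.of (HomOver A G S)
  map f := CommGrpCat.ofHom (HomOver.baseChange f)
  map_id S := by
    refine CommGrpCat.hom_ext (MonoidHom.ext fun h => HomOver.ext ?_)
    funext T a
    exact h.toFun_congr (Category.id_comp T.hom) a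
  map_comp f g := by
    refine CommGrpCat.hom_ext (MonoidHom.ext fun h => HomOver.ext ?_)
    funext T a
    exact h.toFun_congr (Category.assoc f g T.hom) a

/-- The group functor of poly-additive maps, `S ↦ PolyAdd(∏ (A_i)_S, G_S)`. -/
def polyAdd {ι : Type} [DecidableEq ι] (A : ι → GrpFunctor.{u, v} R) (G : GrpFunctor.{u, w} R) :
    GrpFunctor.{u, max (u + 1) v w} R where
  obj S := CommGrpCat.of (PolyAddOver A G S)
  map f := CommGrpCat.ofHom (PolyAddOver.baseChange f)
  map_id S := by
    refine CommGrpCat.hom_ext (MonoidHom.ext fun h => PolyAddOver.ext ?_)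
    funext T a
    exact h.toFun_congr (Category.id_comp T.hom) a
  map_comp f g := by
    refine CommGrpCat.hom_ext (MonoidHom.ext fun h => PolyAddOver.ext ?_)
    funext T a
    exact h.toFun_congr (Category.assoc f g T.hom) a

/-- The Cartier dual `A^* = Hom(A, 𝔾_m)`. -/
abbrev cartierDual (A : GrpFunctor.{u, u} R) : GrpFunctor.{u, u + 1} R :=
  homFunctor A (Gm R)

end Hom

/-! ### The Frobenius kernel -/

section FrobeniusKernel

variable (p : ℕ) [hp : Fact p.Prime] {R : Type u} [CommRing R] [Algebra (ZMod p) R]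

/-- The ring `S` with the `R`-algebra structure twisted by the Frobenius of `R`. The points of the
Frobenius twist `Fr^* F` over `S` are the points of `F` over `frobTwist p S`. -/
def frobTwist (S : CommAlgCat.{u} R) : CommAlgCat.{u} R :=
  @CommAlgCat.of R _ S _ ((algebraMap R S).comp (frob p R)).toAlgebra

/-- The Frobenius of `S`, an `R`-algebra map from `S` to its twist. -/
def frobHom (S : CommAlgCat.{u} R) : S ⟶ frobTwist p S :=
  letI : Algebra R S := S.algebra
  @CommAlgCat.ofHom R _ S S _ S.algebra _ ((algebraMap R S).comp (frob p R)).toAlgebra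
    (@AlgHom.mk R S S _ _ _ S.algebra ((algebraMap R S).comp (frob p R)).toAlgebra
      { toFun := fun x => x ^ p
        map_one' := one_pow p
        map_mul' := fun x y => mul_pow x y p
        map_zero' := zero_pow hp.out.ne_zero
        map_add' := fun x y =>
          add_pow_p_of_commute p (natCast_p_eq_zero_of_algebra p R S) (Commute.all x y) }
      (fun r => (map_pow (algebraMap R S) r p).symm))

/-- A map `S → T` of `R`-algebras, as a map of the twisted algebras. -/
def frobTwistMap {S T : CommAlgCat.{u} R} (f : S ⟶ T) : frobTwist p S ⟶ frobTwist p T :=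
  @CommAlgCat.ofHom R _ S T _ ((algebraMap R S).comp (frob p R)).toAlgebra _
    ((algebraMap R T).comp (frob p R)).toAlgebra
    (@AlgHom.mk R S T _ _ _ ((algebraMap R S).comp (frob p R)).toAlgebra
      ((algebraMap R T).comp (frob p R)).toAlgebra (f.hom : S →+* T)
      (fun r => f.hom.commutes (r ^ p)))

theorem frobHom_naturality {S T : CommAlgCat.{u} R} (f : S ⟶ T) :
    f ≫ frobHom p T = frobHom p S ≫ frobTwistMap p f := by
  ext x
  exact (map_pow f.hom x p).symm

/-- The subgroup `Ker(F(S) → (Fr^* F)(S))`. -/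
def frobKernelSubgroup (F : GrpFunctor.{u, v} R) (S : CommAlgCat.{u} R) : Subgroup (F.obj S) :=
  (F.map (frobHom p S)).hom.ker

/-- The kernel of the relative Frobenius `F → Fr^* F` of a group functor. -/
def frobKernel (F : GrpFunctor.{u, v} R) : GrpFunctor.{u, v} R where
  obj S := CommGrpCat.of (frobKernelSubgroup p F S)
  map {S T} f := CommGrpCat.ofHom
    (((F.map f).hom.comp (frobKernelSubgroup p F S).subtype).codRestrict
      (frobKernelSubgroup p F T) (fun x => by
        have hx : (F.map (frobHom p S)).hom x.1 = 1 := x.2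
        change (F.map (frobHom p T)).hom ((F.map f).hom x.1) = 1
        rw [← CommGrpCat.comp_apply, ← F.map_comp, frobHom_naturality, F.map_comp,
          CommGrpCat.comp_apply, hx, map_one]))
  map_id S := by
    refine CommGrpCat.hom_ext (MonoidHom.ext fun x => Subtype.ext ?_)
    change (F.map (𝟙 S)).hom x.1 = x.1
    simp
  map_comp f g := by
    refine CommGrpCat.hom_ext (MonoidHom.ext fun x => Subtype.ext ?_)
    change (F.map (f ≫ g)).hom x.1 = (F.map g).hom ((F.map f).hom x.1)
    simp

/-- The inclusion of the Frobenius kernel. -/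
def frobKernelInclusion (F : GrpFunctor.{u, v} R) : frobKernel p F ⟶ F where
  app S := CommGrpCat.ofHom (frobKernelSubgroup p F S).subtype

end FrobeniusKernel

/-! ### Smooth and cosmooth group schemes -/

section Smooth

variable (p : ℕ) [hp : Fact p.Prime]

/-- `A[x_1, …, x_r] / (x_1^{p^n}, …, x_r^{p^n})`. -/
abbrev TruncPoly (n r : ℕ) (A : Type u) [CommRing A] : Type u :=
  MvPolynomial (Fin r) A ⧸
    Ideal.span (Set.range fun i : Fin r => (MvPolynomial.X i : MvPolynomial (Fin r) A) ^ p ^ n)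

/-- The augmentation `x_i ↦ 0`, i.e. the base point of `Spec A[x]/(x^{p^n})`. -/
def truncAug (n r : ℕ) (A : Type u) [CommRing A] : TruncPoly p n r A →ₐ[A] A :=
  Ideal.Quotient.liftₐ _ (MvPolynomial.aeval fun _ => (0 : A)) (by
    intro a ha
    have hle : Ideal.span (Set.range fun i : Fin r =>
        (MvPolynomial.X i : MvPolynomial (Fin r) A) ^ p ^ n) ≤
        RingHom.ker (MvPolynomial.aeval fun _ : Fin r => (0 : A)) := by
      rw [Ideal.span_le]
      rintro _ ⟨i, rfl⟩
      simp [RingHom.mem_ker, zero_pow (pow_pos hp.out.pos n).ne']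
    exact hle ha)

/-- `Spec C` is `n`-smooth, of rank `r 𝔭` at the point `𝔭` of `Spec R`: Zariski-locally on
`Spec R` there is a pointed isomorphism with `Spec R[x_1, …, x_r]/(x_1^{p^n}, …, x_r^{p^n})`. -/
def IsSmoothOfRank {R : Type u} [CommRing R] (n : ℕ) (C : Type u) [CommRing C] [HopfAlgebra R C]
    (r : PrimeSpectrum R → ℕ) : Prop :=
  ∀ 𝔭 : PrimeSpectrum R, ∃ f : R, f ∉ 𝔭.asIdeal ∧
    ∃ e : (Localization.Away f ⊗[R] C) ≃ₐ[Localization.Away f]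
        TruncPoly p n (r 𝔭) (Localization.Away f),
      ∀ c : C, truncAug p n (r 𝔭) (Localization.Away f) (e (1 ⊗ₜ[R] c)) =
        algebraMap R (Localization.Away f) (Coalgebra.counit (R := R) c)

/-- The commutative group functor `F` is an `n`-smooth group scheme of rank `r`. -/
def IsSmoothGroup {R : Type u} [CommRing R] (n : ℕ) (F : GrpFunctor.{u, v} R)
    (r : PrimeSpectrum R → ℕ) : Prop :=
  ∃ (C : Type u) (_ : CommRing C) (_ : HopfAlgebra R C) (_ : Coalgebra.IsCocomm R C),
    Nonempty (GrpFunctorIso (specGrp R C) F) ∧ IsSmoothOfRank p n C r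

/-- The group functor `A` is an `n`-cosmooth group scheme of rank `r`: it is isomorphic to the
Cartier dual of a commutative `n`-smooth group scheme of rank `r`. -/
def IsCosmoothGroup {R : Type u} [CommRing R] (n : ℕ) (A : GrpFunctor.{u, u} R)
    (r : PrimeSpectrum R → ℕ) : Prop :=
  ∃ (C : Type u) (_ : CommRing C) (_ : HopfAlgebra R C) (_ : Coalgebra.IsCocomm R C),
    IsSmoothOfRank p n C r ∧ Nonempty (GrpFunctorIso A (cartierDual (specGrp R C)))

end Smooth

/-! ### The restricted Lie algebra -/

section Lie

variable (R : Type u) [CommRing R] (C : Type u) [CommRing C] [HopfAlgebra R C]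

/-- The Lie algebra of `Spec C`: the point derivations of `C` at the unit section, inside the
convolution algebra `Hom_R(C, R)`, in which the bracket is the commutator and the `p`-operation
is the `p`-th power. -/
def lieAlg : Submodule R (WithConv (C →ₗ[R] R)) where
  carrier := {D | ∀ a b : C, D (a * b) =
    Coalgebra.counit (R := R) a * D b + D a * Coalgebra.counit (R := R) b}
  zero_mem' a b := by simp
  add_mem' {D E} hD hE a b := by
    have h1 := hD a b
    have h2 := hE a b
    simp only [ofConv_add, LinearMap.add_apply, h1, h2]
    ring
  smul_mem' r D hD a b := by
    have h1 := hD a b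
    simp only [ofConv_smul, LinearMap.smul_apply, h1, smul_eq_mul]
    ring

variable {R C}

theorem mem_lieAlg {D : WithConv (C →ₗ[R] R)} : D ∈ lieAlg R C ↔ ∀ a b : C, D (a * b) =
    Coalgebra.counit (R := R) a * D b + D a * Coalgebra.counit (R := R) b := Iff.rfl

/-- The bracket vanishes when `Spec C` is commutative. -/
theorem lie_eq_zero [Coalgebra.IsCocomm R C] (D E : WithConv (C →ₗ[R] R)) : ⁅D, E⁆ = 0 := by
  rw [Ring.lie_def, mul_comm, sub_self]

/-- The external product of two functionals. -/
def extProd (D E : WithConv (C →ₗ[R] R)) : WithConv (C ⊗[R] C →ₗ[R] R) :=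
  toConv (LinearMap.mul' R R ∘ₗ TensorProduct.map D.ofConv E.ofConv)

theorem extProd_mul (D E D' E' : WithConv (C →ₗ[R] R)) :
    extProd D E * extProd D' E' = extProd (D * D') (E * E') := by
  have h := LinearMap.algHom_comp_convMul_distrib (Algebra.TensorProduct.lmul' R (S := R))
    (toConv (TensorProduct.map D.ofConv E.ofConv)) (toConv (TensorProduct.map D'.ofConv E'.ofConv))
  rw [TensorProduct.map_convMul_map] at h
  exact (congrArg toConv h).symm

theorem extProd_one : extProd (1 : WithConv (C →ₗ[R] R)) 1 = 1 := by
  apply WithConv.ofConv_injective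
  ext a b
  simp [extProd, LinearMap.convOne_def, mul_comm]

theorem extProd_pow (D E : WithConv (C →ₗ[R] R)) (n : ℕ) :
    extProd D E ^ n = extProd (D ^ n) (E ^ n) := by
  induction n with
  | zero => simp [extProd_one]
  | succ n ih => rw [pow_succ, ih, extProd_mul, pow_succ, pow_succ]

/-- The pullback of a functional along the multiplication of `C`. -/
def mulPull (D : WithConv (C →ₗ[R] R)) : WithConv (C ⊗[R] C →ₗ[R] R) :=
  toConv (D.ofConv ∘ₗ LinearMap.mul' R C)

theorem mulPull_mul (D E : WithConv (C →ₗ[R] R)) :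
    mulPull (D * E) = mulPull D * mulPull E :=
  congrArg toConv (LinearMap.convMul_comp_coalgHom_distrib D E (Bialgebra.mulCoalgHom R C))

theorem mulPull_one : mulPull (1 : WithConv (C →ₗ[R] R)) = 1 := by
  apply WithConv.ofConv_injective
  ext a b
  simp [mulPull, LinearMap.convOne_def, mul_comm]

theorem mulPull_pow (D : WithConv (C →ₗ[R] R)) (n : ℕ) : mulPull (D ^ n) = mulPull D ^ n := by
  induction n with
  | zero => simp [mulPull_one]
  | succ n ih => rw [pow_succ, mulPull_mul, ih, pow_succ]

theorem mem_lieAlg_iff_mulPull {D : WithConv (C →ₗ[R] R)} :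
    D ∈ lieAlg R C ↔ mulPull D = extProd 1 D + extProd D 1 := by
  rw [mem_lieAlg]
  constructor
  · intro h
    apply WithConv.ofConv_injective
    ext a b
    exact h a b
  · intro h a b
    exact congrArg (fun F : WithConv (C ⊗[R] C →ₗ[R] R) => F (a ⊗ₜ b)) h

variable (p : ℕ) [hp : Fact p.Prime] [Algebra (ZMod p) R]

theorem pow_p_mem_lieAlg {D : WithConv (C →ₗ[R] R)} (hD : D ∈ lieAlg R C) :
    D ^ p ∈ lieAlg R C := by
  rw [mem_lieAlg_iff_mulPull] at hD ⊢
  have hc : Commute (extProd 1 D) (extProd D 1) := by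
    change extProd 1 D * extProd D 1 = extProd D 1 * extProd 1 D
    rw [extProd_mul, extProd_mul]
    simp
  rw [mulPull_pow, hD, add_pow_p_of_commute p (natCast_p_eq_zero_of_algebra p R _) hc,
    extProd_pow, extProd_pow, one_pow]

variable (R C)

/-- The `p`-operation `D ↦ D^{[p]}` of the (commutative) restricted Lie algebra of a commutative
group scheme `Spec C`; it is `p`-linear. -/
def pOperation [Coalgebra.IsCocomm R C] : lieAlg R C →ₛₗ[frob p R] lieAlg R C where
  toFun D := ⟨D.1 ^ p, pow_p_mem_lieAlg p D.2⟩
  map_add' D E := Subtype.ext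
    (add_pow_p_of_commute p (natCast_p_eq_zero_of_algebra p R _) (mul_comm D.1 E.1))
  map_smul' r D := Subtype.ext (smul_pow r D.1 p)

end Lie

/-! ### Modules with a `p`-linear endomorphism and their tensor products -/

section PLinear

variable {p : ℕ} [hp : Fact p.Prime] {R : Type u} [CommRing R] [Algebra (ZMod p) R]

/-- `M` with scalars acting through the Frobenius of `R`. -/
def FrobPull (_p : ℕ) (M : Type v) : Type v := M

instance (M : Type v) [AddCommMonoid M] : AddCommMonoid (FrobPull p M) :=
  inferInstanceAs (AddCommMonoid M)

instance (M : Type v) [AddCommMonoid M] [Module R M] : Module R (FrobPull p M) :=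
  Module.compHom M (frob p R)

/-- The tensor product `⨂ φ_i` of `p`-linear maps; it sends `⨂ x_i` to `⨂ φ_i(x_i)`. -/
def tensorPLinear {ι : Type} [Fintype ι] {P : ι → Type u} [∀ i, AddCommMonoid (P i)]
    [∀ i, Module R (P i)] (φ : ∀ i, P i →ₛₗ[frob p R] P i) :
    (PiTensorProduct R P) →ₛₗ[frob p R] (PiTensorProduct R P) :=
  let L : PiTensorProduct R P →ₗ[R] FrobPull p (PiTensorProduct R P) :=
    PiTensorProduct.lift
      { toFun := fun x => (PiTensorProduct.tprod R fun i => φ i (x i) : PiTensorProduct R P)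
        map_update_add' := fun x i a b => by
          have h : ∀ c : P i, (fun j => φ j (Function.update x i c j)) =
              Function.update (fun j => φ j (x j)) i (φ i c) := fun c => by
            funext j
            exact Function.apply_update (fun j => φ j) x i c j
          simp only [h, map_add]
          exact (PiTensorProduct.tprod R).map_update_add _ i _ _
        map_update_smul' := fun x i r a => by
          have h : ∀ c : P i, (fun j => φ j (Function.update x i c j)) =
              Function.update (fun j => φ j (x j)) i (φ i c) := fun c => by
            funext j
            exact Function.apply_update (fun j => φ j) x i c j
          simp only [h, LinearMap.map_smulₛₗ]
          exact (PiTensorProduct.tprod R).map_update_smul _ i _ _ }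
  { toFun := fun x => L x
    map_add' := fun x y => L.map_add x y
    map_smul' := fun r x => L.map_smul r x }

theorem tensorPLinear_tprod {ι : Type} [Fintype ι] {P : ι → Type u} [∀ i, AddCommMonoid (P i)]
    [∀ i, Module R (P i)] (φ : ∀ i, P i →ₛₗ[frob p R] P i) (x : ∀ i, P i) :
    tensorPLinear φ (PiTensorProduct.tprod R x) = PiTensorProduct.tprod R fun i => φ i (x i) :=
  PiTensorProduct.lift.tprod (R := R) (E := FrobPull p (PiTensorProduct R P)) x

/-- The group of `R`-linear maps `ξ : P → S` with `ξ(φ(x)) = ξ(x)^p` for all `x`. -/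
def frobLinear {P : Type u} [AddCommMonoid P] [Module R P] (φ : P →ₛₗ[frob p R] P)
    (S : Type u) [CommRing S] [Algebra R S] : AddSubgroup (P →ₗ[R] S) where
  carrier := {ξ | ∀ x, ξ (φ x) = ξ x ^ p}
  zero_mem' x := by simp [zero_pow hp.out.ne_zero]
  add_mem' {ξ η} hξ hη x := by
    rw [LinearMap.add_apply, LinearMap.add_apply, hξ x, hη x,
      add_pow_p_of_commute p (natCast_p_eq_zero_of_algebra p R S) (Commute.all _ _)]
  neg_mem' {ξ} hξ x := by
    have h := add_pow_p_of_commute p (natCast_p_eq_zero_of_algebra p R S)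
      (Commute.all (ξ x) (-ξ x))
    rw [add_neg_cancel, zero_pow hp.out.ne_zero] at h
    rw [LinearMap.neg_apply, LinearMap.neg_apply, hξ x]
    exact neg_eq_of_add_eq_zero_right h.symm

/-- The group scheme `A_{P,φ}`: its points over an `R`-algebra `S` are the `R`-linear maps
`ξ : P → S` with `ξ(φ(x)) = ξ(x)^p` for all `x ∈ P`, under addition. -/
def frobLinearGrp {P : Type u} [AddCommMonoid P] [Module R P] (φ : P →ₛₗ[frob p R] P) :
    GrpFunctor.{u, u} R where
  obj S := CommGrpCat.of (Multiplicative (frobLinear φ S))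
  map {S T} f := CommGrpCat.ofHom
    { toFun := fun ξ => Multiplicative.ofAdd ⟨f.hom.toLinearMap ∘ₗ (Multiplicative.toAdd ξ).1,
        fun x => by
          have h := (Multiplicative.toAdd ξ).2 x
          simp only [LinearMap.comp_apply, AlgHom.toLinearMap_apply]
          rw [← map_pow]
          exact congrArg f.hom h⟩
      map_one' := by
        apply Subtype.ext
        exact LinearMap.comp_zero _
      map_mul' := fun ξ η => by
        apply Subtype.ext
        exact LinearMap.comp_add _ _ _ }

section TensorPoint

variable {ι : Type} [Fintype ι] {P : ι → Type u} [∀ i, AddCommMonoid (P i)] [∀ i, Module R (P i)]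
  (φ : ∀ i, P i →ₛₗ[frob p R] P i)

/-- The linear map `⨂ x_i ↦ ∏ ξ_i(x_i)`. -/
def tensorLinear {S : Type u} [CommRing S] [Algebra R S] (ξ : ∀ i, P i →ₗ[R] S) :
    PiTensorProduct R P →ₗ[R] S :=
  PiTensorProduct.lift ((MultilinearMap.mkPiAlgebra R ι S).compLinearMap ξ)

@[simp] theorem tensorLinear_tprod {S : Type u} [CommRing S] [Algebra R S] (ξ : ∀ i, P i →ₗ[R] S)
    (x : ∀ i, P i) : tensorLinear ξ (PiTensorProduct.tprod R x) = ∏ i, ξ i (x i) := by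
  simp [tensorLinear]

theorem tensorLinear_mem {S : Type u} [CommRing S] [Algebra R S]
    (ξ : ∀ i, frobLinear (φ i) S) :
    tensorLinear (fun i => (ξ i).1) ∈ frobLinear (tensorPLinear φ) S := by
  intro x
  induction x using PiTensorProduct.induction_on with
  | smul_tprod r x =>
    rw [LinearMap.map_smulₛₗ, tensorPLinear_tprod, map_smul, map_smul, tensorLinear_tprod,
      tensorLinear_tprod, frob_apply, smul_pow, ← Finset.prod_pow]
    congr 1
    exact Finset.prod_congr rfl fun i _ => (ξ i).2 (x i)
  | add x y hx hy =>
    rw [map_add, map_add, map_add, hx, hy,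
      add_pow_p_of_commute p (natCast_p_eq_zero_of_algebra p R S) (Commute.all _ _)]

/-- The map `∏ A_{P_i,φ_i}(S) → A_{P,φ}(S)`, `(P, φ) = ⨂ (P_i, φ_i)`, on `S`-points. -/
def tensorPoint (S : CommAlgCat.{u} R) (ξ : ∀ i, (frobLinearGrp (φ i)).obj S) :
    (frobLinearGrp (tensorPLinear φ)).obj S :=
  Multiplicative.ofAdd ⟨tensorLinear fun i => (Multiplicative.toAdd (ξ i)).1,
    tensorLinear_mem φ fun i => Multiplicative.toAdd (ξ i)⟩

theorem tensorPoint_naturality {S T : CommAlgCat.{u} R} (f : S ⟶ T)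
    (ξ : ∀ i, (frobLinearGrp (φ i)).obj S) :
    tensorPoint φ T (fun i => ((frobLinearGrp (φ i)).map f).hom (ξ i)) =
      ((frobLinearGrp (tensorPLinear φ)).map f).hom (tensorPoint φ S ξ) := by
  apply Subtype.ext
  apply PiTensorProduct.ext
  ext x
  change tensorLinear (S := T) _ (PiTensorProduct.tprod R x) =
    f.hom (tensorLinear (S := S) _ (PiTensorProduct.tprod R x))
  rw [tensorLinear_tprod, tensorLinear_tprod, map_prod]
  rfl

variable [DecidableEq ι]

theorem tensorPoint_update_mul (S : CommAlgCat.{u} R) (i : ι)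
    (ξ : ∀ i, (frobLinearGrp (φ i)).obj S) (a b : (frobLinearGrp (φ i)).obj S) :
    tensorPoint φ S (Function.update ξ i (a * b)) =
      tensorPoint φ S (Function.update ξ i a) * tensorPoint φ S (Function.update ξ i b) := by
  apply Subtype.ext
  apply PiTensorProduct.ext
  ext x
  change tensorLinear (S := S) _ (PiTensorProduct.tprod R x) =
    tensorLinear _ (PiTensorProduct.tprod R x) + tensorLinear _ (PiTensorProduct.tprod R x)
  rw [tensorLinear_tprod, tensorLinear_tprod, tensorLinear_tprod]
  have h : ∀ c : (frobLinearGrp (φ i)).obj S,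
      (fun j => (Multiplicative.toAdd (Function.update ξ i c j)).1 (x j)) =
        Function.update (fun j => (Multiplicative.toAdd (ξ j)).1 (x j)) i
          ((Multiplicative.toAdd c).1 (x i)) := fun c => by
    funext j
    exact Function.apply_update
      (fun j (y : (frobLinearGrp (φ j)).obj S) => (Multiplicative.toAdd y).1 (x j)) ξ i c j
  simp only [h]
  exact (MultilinearMap.mkPiAlgebra R ι S).map_update_add _ i _ _

/-- The homomorphism `A_{P,φ}^* → PolyAdd(∏ A_{P_i,φ_i}, 𝔾_m)`, `(P, φ) = ⨂ (P_i, φ_i)`, induced by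
the poly-additive map `(ξ_i) ↦ (⨂ x_i ↦ ∏ ξ_i(x_i))`. -/
def dualToPolyAdd : cartierDual (frobLinearGrp (tensorPLinear φ)) ⟶
    polyAdd (fun i => frobLinearGrp (φ i)) (Gm R) where
  app S := CommGrpCat.ofHom
    { toFun := fun (h : HomOver (frobLinearGrp (tensorPLinear φ)) (Gm R) S) =>
        ({ toFun := fun T ξ => h.toFun T (tensorPoint φ T.right ξ)
           naturality := fun f ξ => by
            rw [tensorPoint_naturality, h.naturality]
           map_mul := fun T i ξ a b => by
            rw [tensorPoint_update_mul, h.map_mul] } :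
          PolyAddOver (fun i => frobLinearGrp (φ i)) (Gm R) S)
      map_one' := rfl
      map_mul' := fun _ _ => rfl }

end TensorPoint

end PLinear

/-! ### Tangent vectors as points over the dual numbers -/

section Tangent

variable {R : Type u} [CommRing R]

/-- The dual numbers `S[ε]` over an `R`-algebra `S`. -/
abbrev dualNumbers (S : CommAlgCat.{u} R) : CommAlgCat.{u} R := CommAlgCat.of R (DualNumber S)

/-- The inclusion `S → S[ε]`. -/
def dualInl (S : CommAlgCat.{u} R) : S ⟶ dualNumbers S :=
  CommAlgCat.ofHom (TrivSqZeroExt.inlAlgHom R S S)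

/-- The `R`-algebra map `R[ε] → S[ε]`, `ε ↦ ε`. -/
def dualStructure (S : CommAlgCat.{u} R) : dualNumbers (CommAlgCat.of R R) ⟶ dualNumbers S :=
  CommAlgCat.ofHom (DualNumber.lift ⟨(Algebra.ofId R (DualNumber S), DualNumber.eps),
    DualNumber.eps_mul_eps, fun _ => Commute.all _ _⟩)

/-- The point `c ↦ counit(c) + ε D(c)` of `Spec C` over `R[ε]` attached to `D` in the Lie
algebra of `Spec C`. -/
def tangentPoint {C : Type u} [CommRing C] [HopfAlgebra R C] [Coalgebra.IsCocomm R C]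
    (D : lieAlg R C) : (specGrp R C).obj (dualNumbers (CommAlgCat.of R R)) :=
  toConv (AlgHom.ofLinearMap
    ((TrivSqZeroExt.inlAlgHom R R R).toLinearMap ∘ₗ Coalgebra.counit (R := R) (A := C) +
      TrivSqZeroExt.inrHom R R ∘ₗ D.1.ofConv)
    (by
      have h := D.2 1 1
      simp only [mul_one, Bialgebra.counit_one, one_mul] at h
      have h0 : D.1 (1 : C) = 0 := by linear_combination -h
      ext <;> simp [h0])
    (fun a b => by
      have h := D.2 a b
      ext <;> simp [h, mul_comm]))

/-- For a homomorphism `u : A → 𝔾_m` over `R[ε]`, the coefficient of `ε` in `u(a) ∈ S[ε]ˣ` for a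
point `a ∈ A(S)`, `S` an `R`-algebra. -/
def homDifferential {A : GrpFunctor.{u, u} R}
    (h : (cartierDual A).obj (dualNumbers (CommAlgCat.of R R)))
    (S : CommAlgCat.{u} R) (a : A.obj S) : S :=
  let v : (DualNumber S)ˣ := HomOver.toFun (A := A) (G := Gm R) h (Under.mk (dualStructure S))
    ((A.map (dualInl S)).hom a)
  TrivSqZeroExt.snd (v : DualNumber S)

/-- For a poly-additive map `u : ∏ A_i → 𝔾_m` over `R[ε]`, the coefficient of `ε` in
`u(a) ∈ S[ε]ˣ` for a point `a ∈ ∏ A_i(S)`, `S` an `R`-algebra. -/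
def polyAddDifferential {ι : Type} [DecidableEq ι] {A : ι → GrpFunctor.{u, u} R}
    (h : (polyAdd A (Gm R)).obj (dualNumbers (CommAlgCat.of R R)))
    (S : CommAlgCat.{u} R) (a : ∀ i, (A i).obj S) : S :=
  let v : (DualNumber S)ˣ := PolyAddOver.toFun (A := A) (G := Gm R) h
    (Under.mk (dualStructure S)) (fun i => ((A i).map (dualInl S)).hom (a i))
  TrivSqZeroExt.snd (v : DualNumber S)

end Tangent

end

/-! Everything rests on one computation in coordinates. If P is free with basis b_j and φ(b_j) = Σ
l_jk b_k, the points of A_{P,φ} are the solutions of x_j ^ p = Σ l_jk x_k under addition. Modulo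
these relations each polynomial has exactly one reduced representative (all exponents less than p),
so by Yoneda a function on ∏ A_i is a reduced polynomial F in blocks of variables, one block for
each i.

Let F represent a poly-additive map f to 𝔾_m. Then f is killed by Frobenius exactly when the
coefficients of F - 1 have vanishing p-th powers, and these coefficients then generate a nilpotent
ideal I. Modulo the square of an ideal on which f is trivial, the multiplicative law for f becomes
an additive law for F - 1. A first-order Taylor expansion shows that a reduced polynomial additive
in every block is multilinear. Successive approximation along the powers of I therefore writes f
uniquely as ∏_j E(y_j ∏_i x_{i, j i}), with E the truncated exponential and y_j ^ p = 0
(`Chart.exists_expPoly_eq`, `Chart.expPoly_injective`).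

Part (i). A homomorphism to 𝔾_m is automatically killed by Frobenius: its polynomial H satisfies ∂_j
H = y_j H, and reducedness forces y_j ^ p = 0 (`Chart.hom_baseChange_frobHom`). For free P_i both
sides are thus parametrised by the same families y, through the tensor basis. A projective (P, φ) is
an equivariant retract of a free one, and the statement passes to retracts.

Part (ii). A 1-cosmooth A, dual to the 1-smooth group Spec C, is A_{P,φ} with P = Lie(Spec C) and φ
its p-operation. The point is that the dual algebra of C is the restricted enveloping algebra of P:
locally, the monomials with exponents less than p in a basis of tangent vectors pair with the
monomials in coordinates through a matrix that is block triangular by degree and has products of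
factorials, times powers of the inverted element, on the diagonal. Characters of Spec C are algebra
maps out of the dual algebra, hence linear maps ξ on P with ξ ∘ φ = ξ ^ p
(`IsSmoothOfRank.dualIso`). The kernel K is representable as a retract of the free case, and local
coordinates on the A_i make it locally a truncated polynomial ring.

Over R[ε] the parameters of a tangent vector of K are y = ε z, so the tangent vectors are the maps 1
+ ε t with t in ⨂ P_i. Evaluation at a point of ∏ A_i is a character of K, hence an algebra map on
the dual algebra of K. It sends D ^ p to the p-th power of the value at D, and this identifies the
p-operation. -/

set_option linter.unusedSectionVars false

/-! ### Reduced polynomials modulo `x_j ^ p - ℓ_j(x)` -/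

namespace FrobRel

open MvPolynomial

variable {σ : Type*} {S : Type*} [CommRing S]

/-- The polynomials of total degree less than `d`. -/
def degreeLT (σ S : Type*) [CommRing S] (d : ℕ) : Submodule S (MvPolynomial σ S) where
  carrier := {F | ∀ e : σ →₀ ℕ, d ≤ e.degree → F.coeff e = 0}
  zero_mem' := by simp
  add_mem' hF hG e he := by rw [coeff_add, hF e he, hG e he, add_zero]
  smul_mem' r F hF e he := by rw [coeff_smul, hF e he, smul_zero]

/-- The polynomials whose exponents are all less than `p`. -/
def reduced (p : ℕ) (σ S : Type*) [CommRing S] : Submodule S (MvPolynomial σ S) where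
  carrier := {F | ∀ (e : σ →₀ ℕ) (i : σ), p ≤ e i → F.coeff e = 0}
  zero_mem' := by simp
  add_mem' hF hG e i he := by rw [coeff_add, hF e i he, hG e i he, add_zero]
  smul_mem' r F hF e i he := by rw [coeff_smul, hF e i he, smul_zero]

theorem degreeLT_mono {d d' : ℕ} (h : d ≤ d') : degreeLT σ S d ≤ degreeLT σ S d' :=
  fun _ hF e he => hF e (h.trans he)

theorem mul_mem_degreeLT {F G : MvPolynomial σ S} {d d' : ℕ} (hF : F ∈ degreeLT σ S d)
    (hG : G ∈ degreeLT σ S (d' + 1)) : F * G ∈ degreeLT σ S (d + d') := by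
  classical
  intro e he
  rw [coeff_mul]
  refine Finset.sum_eq_zero fun x hx => ?_
  replace hx := Finset.HasAntidiagonal.mem_antidiagonal.1 hx
  rw [← hx, map_add] at he
  by_cases h : d ≤ x.1.degree
  · rw [hF _ h, zero_mul]
  · rw [hG _ (by lia), mul_zero]

theorem monomial_mem_degreeLT {e : σ →₀ ℕ} {d : ℕ} (h : e.degree < d) (r : S) :
    monomial e r ∈ degreeLT σ S d := by
  classical
  intro e' he'
  rw [coeff_monomial, if_neg]
  rintro rfl
  lia

/-- `G` has leading monomial `x ^ e`. -/
def IsLeading (e : σ →₀ ℕ) (G : MvPolynomial σ S) : Prop :=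
  G - monomial e 1 ∈ degreeLT σ S e.degree

theorem IsLeading.mem {e : σ →₀ ℕ} {G : MvPolynomial σ S} (h : IsLeading e G) :
    G ∈ degreeLT σ S (e.degree + 1) := by
  have := add_mem (degreeLT_mono (Nat.le_succ _) h)
    (monomial_mem_degreeLT (Nat.lt_succ_self e.degree) (1 : S))
  simpa using this

theorem isLeading_monomial (e : σ →₀ ℕ) : IsLeading e (monomial e (1 : S)) := by
  simp [IsLeading]

theorem IsLeading.mul {e e' : σ →₀ ℕ} {G G' : MvPolynomial σ S} (h : IsLeading e G)
    (h' : IsLeading e' G') : IsLeading (e + e') (G * G') := by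
  have h1 := mul_mem_degreeLT h h'.mem
  have h2 := mul_mem_degreeLT h' (monomial_mem_degreeLT (Nat.lt_succ_self e.degree) (1 : S))
  rw [add_comm e'.degree] at h2
  have h3 := add_mem h1 h2
  rw [← map_add] at h3
  have h4 : monomial (e + e') (1 : S) = monomial e 1 * monomial e' 1 := by
    rw [monomial_mul, one_mul]
  unfold IsLeading
  rw [h4]
  convert h3 using 1
  ring

theorem IsLeading.pow {e : σ →₀ ℕ} {G : MvPolynomial σ S} (h : IsLeading e G) (n : ℕ) :
    IsLeading (n • e) (G ^ n) := by
  induction n with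
  | zero => simpa using isLeading_monomial (S := S) (0 : σ →₀ ℕ)
  | succ n ih => rw [pow_succ, succ_nsmul]; exact ih.mul h

theorem IsLeading.prod {ι : Type*} (s : Finset ι) {e : ι → σ →₀ ℕ} {G : ι → MvPolynomial σ S}
    (h : ∀ i, IsLeading (e i) (G i)) : IsLeading (∑ i ∈ s, e i) (∏ i ∈ s, G i) := by
  classical
  induction s using Finset.induction_on with
  | empty => simpa using isLeading_monomial (S := S) (0 : σ →₀ ℕ)
  | insert a s ha ih => rw [Finset.sum_insert ha, Finset.prod_insert ha]; exact (h a).mul ih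

variable [Fintype σ]

/-- The relation `x_j ^ p - ∑ l_{jk} x_k`. -/
noncomputable def rel (p : ℕ) (l : σ → σ → S) (j : σ) : MvPolynomial σ S :=
  X j ^ p - ∑ k, C (l j k) * X k

/-- The ideal generated by the relations `x_j ^ p - ∑ l_{jk} x_k`. -/
noncomputable def relIdeal (p : ℕ) (l : σ → σ → S) : Ideal (MvPolynomial σ S) :=
  Ideal.span (Set.range (rel p l))

section Basis

variable {p : ℕ} (hp : 1 < p) (l : σ → σ → S)

include hp in
-- Since 1 < p, the linear part has smaller degree than x_j ^ p. The basis argument below uses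
-- nothing else about the linear part.
theorem isLeading_rel (j : σ) : IsLeading (p • Finsupp.single j 1) (rel p l j) := by
  unfold IsLeading rel
  have h : (X j ^ p : MvPolynomial σ S) = monomial (p • Finsupp.single j 1) 1 := by
    rw [X, monomial_pow, one_pow]
  rw [h]
  have h1 : (p • Finsupp.single j 1 : σ →₀ ℕ).degree = p := by simp
  rw [h1, sub_right_comm, sub_self, zero_sub]
  refine neg_mem (sum_mem fun k _ => ?_)
  rw [C_mul_X_eq_monomial]
  exact monomial_mem_degreeLT (by simpa using hp) _

/-- The product `∏ (x_j ^ p - ℓ_j) ^ (e_j / p) x_j ^ (e_j % p)`. -/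
noncomputable def adapted (p : ℕ) (l : σ → σ → S) (e : σ →₀ ℕ) : MvPolynomial σ S :=
  ∏ j, (rel p l j ^ (e j / p) * X j ^ (e j % p))

include hp in
theorem isLeading_adapted (e : σ →₀ ℕ) : IsLeading e (adapted p l e) := by
  have h := IsLeading.prod (S := S) Finset.univ (fun j : σ =>
    ((isLeading_rel hp l j).pow (e j / p)).mul
      ((isLeading_monomial (Finsupp.single j 1)).pow (e j % p)))
  -- Division with remainder, e_j = p (e_j / p) + e_j % p, makes the exponents of the factors add up
  -- to e.
  have he : ∑ j, ((e j / p) • p • Finsupp.single j 1 + (e j % p) • Finsupp.single j 1) = e := by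
    conv_rhs => rw [← Finsupp.univ_sum_single e]
    refine Finset.sum_congr rfl fun j _ => ?_
    rw [smul_smul, ← add_smul, Nat.div_add_mod', Finsupp.smul_single, smul_eq_mul, mul_one]
  rw [he] at h
  exact h

/-- The linear map sending `x ^ e` to `adapted p l e`. -/
noncomputable def adaptedMap (p : ℕ) (l : σ → σ → S) : MvPolynomial σ S →ₗ[S] MvPolynomial σ S :=
  (basisMonomials σ S).constr S (adapted p l)

theorem adaptedMap_monomial (p : ℕ) (l : σ → σ → S) (e : σ →₀ ℕ) :
    adaptedMap p l (monomial e 1) = adapted p l e := by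
  have := (basisMonomials σ S).constr_basis S (adapted p l) e
  rwa [coe_basisMonomials] at this

omit [Fintype σ] in
theorem sum_smul_monomial (F : MvPolynomial σ S) :
    F = ∑ e ∈ F.support, F.coeff e • monomial e (1 : S) := by
  conv_lhs => rw [F.as_sum]
  simp [smul_monomial]

include hp in
-- Each `adapted p l e` has leading monomial x ^ e, so `adaptedMap` is unitriangular for the degree
-- filtration. Its bijectivity follows by induction on the degree.
theorem adaptedMap_sub_mem {F : MvPolynomial σ S} {d : ℕ} (hF : F ∈ degreeLT σ S (d + 1)) :
    adaptedMap p l F - F ∈ degreeLT σ S d := by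
  have h : adaptedMap p l F - F = ∑ e ∈ F.support, F.coeff e •
      (adapted p l e - monomial e (1 : S)) := by
    conv_lhs => rw [sum_smul_monomial F]
    simp only [map_sum, map_smul, adaptedMap_monomial, smul_sub, Finset.sum_sub_distrib]
  rw [h]
  refine sum_mem fun e he => Submodule.smul_mem _ _ ?_
  refine degreeLT_mono ?_ (isLeading_adapted hp l e)
  by_contra hlt
  exact (mem_support_iff.1 he) (hF e (by lia))

omit [Fintype σ] in
theorem exists_mem_degreeLT (F : MvPolynomial σ S) : ∃ d, F ∈ degreeLT σ S d := by
  refine ⟨F.totalDegree + 1, fun e he => ?_⟩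
  apply coeff_eq_zero_of_totalDegree_lt
  change F.totalDegree < e.degree
  lia

include hp in
theorem adaptedMap_injective : Function.Injective (adaptedMap p l) := by
  rw [injective_iff_map_eq_zero]
  intro F hF
  obtain ⟨d, hd⟩ := exists_mem_degreeLT F
  have key : ∀ d, F ∈ degreeLT σ S d → F = 0 := by
    intro d
    induction d with
    | zero => intro h; ext e; simpa using h e (Nat.zero_le _)
    | succ d ih =>
      intro h
      have := adaptedMap_sub_mem hp l h
      rw [hF, zero_sub] at this
      exact ih (by simpa using neg_mem this)
  exact key d hd

include hp in
theorem adaptedMap_surjective : Function.Surjective (adaptedMap p l) := by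
  intro F
  obtain ⟨d, hd⟩ := exists_mem_degreeLT F
  suffices key : ∀ d, ∀ F ∈ degreeLT σ S d, F ∈ LinearMap.range (adaptedMap p l) from key d F hd
  intro d
  induction d with
  | zero =>
    intro F h
    have : F = 0 := by ext e; simpa using h e (Nat.zero_le _)
    rw [this]; exact zero_mem _
  | succ d ih =>
    intro F h
    have := sub_mem (LinearMap.mem_range_self (adaptedMap p l) F)
      (ih _ (adaptedMap_sub_mem hp l h))
    simpa using this

/-- The span of the monomials that are not reduced. -/
def nonReduced (p : ℕ) (σ S : Type*) [CommRing S] : Submodule S (MvPolynomial σ S) where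
  carrier := {F | ∀ e : σ →₀ ℕ, (∀ i, e i < p) → F.coeff e = 0}
  zero_mem' := by simp
  add_mem' hF hG e he := by rw [coeff_add, hF e he, hG e he, add_zero]
  smul_mem' r F hF e he := by rw [coeff_smul, hF e he, smul_zero]

include hp in
theorem adapted_mem_relIdeal {e : σ →₀ ℕ} {i : σ} (h : p ≤ e i) :
    adapted p l e ∈ relIdeal p l := by
  refine Ideal.mem_of_dvd _ (Finset.dvd_prod_of_mem _ (Finset.mem_univ i)) ?_
  refine Ideal.mul_mem_right _ _ (Ideal.pow_mem_of_mem _ (Ideal.subset_span (Set.mem_range_self i)) _ ?_)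
  exact Nat.div_pos h (by lia)

theorem adapted_of_reduced {e : σ →₀ ℕ} (h : ∀ i, e i < p) :
    adapted p l e = monomial e 1 := by
  rw [monomial_eq, Finsupp.prod_fintype _ _ (by simp)]
  simp only [adapted, C_1, one_mul]
  refine Finset.prod_congr rfl fun j _ => ?_
  rw [Nat.div_eq_of_lt (h j), Nat.mod_eq_of_lt (h j), pow_zero, one_mul]

include hp in
-- Raising e_i by p raises the quotient e_i / p by one and keeps the remainder. Multiplication by a
-- relation is thus a shift on the adapted basis, which makes the ideal visible in that basis.
theorem rel_mul_adapted (i : σ) (e : σ →₀ ℕ) :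
    rel p l i * adapted p l e = adapted p l (e + p • Finsupp.single i 1) := by
  classical
  unfold adapted
  rw [← Finset.mul_prod_erase _ _ (Finset.mem_univ i),
    ← Finset.mul_prod_erase _ _ (Finset.mem_univ i), ← mul_assoc]
  congr 1
  · have : (e + p • Finsupp.single i 1 : σ →₀ ℕ) i = e i + p := by simp
    rw [this, Nat.add_div_right _ (by lia), Nat.add_mod_right, pow_succ]
    ring
  · refine Finset.prod_congr rfl fun j hj => ?_
    have hij : i ≠ j := (Finset.ne_of_mem_erase hj).symm
    have : (e + p • Finsupp.single i 1 : σ →₀ ℕ) j = e j := by simp [hij]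
    rw [this]

include hp in
-- In the adapted basis the ideal is spanned by the elements with some exponent at least p. Each of
-- them contains a relation as a factor; conversely any multiple of a relation, expanded in the
-- adapted basis, is shifted into this span.
theorem mem_relIdeal_iff {F : MvPolynomial σ S} :
    F ∈ relIdeal p l ↔ ∃ G ∈ nonReduced p σ S, adaptedMap p l G = F := by
  classical
  constructor
  · intro h
    change F ∈ (nonReduced p σ S).map (adaptedMap p l)
    refine Submodule.span_induction (p := fun F _ => F ∈ (nonReduced p σ S).map (adaptedMap p l))
      ?_ (zero_mem _) (fun _ _ _ _ => add_mem) ?_ h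
    · rintro _ ⟨i, rfl⟩
      refine ⟨monomial (p • Finsupp.single i 1) 1, ?_, ?_⟩
      · intro e he
        rw [coeff_monomial, if_neg]
        rintro rfl
        simpa using he i
      · have := rel_mul_adapted hp l i 0
        rw [zero_add] at this
        rw [adaptedMap_monomial, ← this, adapted_of_reduced (p := p) l (by simp; lia)]
        simp
    · rintro a F - ⟨G, hG, rfl⟩
      -- multiplication by a relation-adapted polynomial preserves the non-reduced part
      have hsum : adaptedMap p l G ∈ Submodule.span S
          (Set.range fun x : σ × (σ →₀ ℕ) => rel p l x.1 * adapted p l x.2) := by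
        rw [sum_smul_monomial G, map_sum]
        refine sum_mem fun e he => ?_
        rw [map_smul, adaptedMap_monomial]
        refine Submodule.smul_mem _ _ (Submodule.subset_span ?_)
        have : ∃ i, p ≤ e i := by
          by_contra hcon
          push Not at hcon
          exact (mem_support_iff.1 he) (hG e hcon)
        obtain ⟨i, hi⟩ := this
        refine ⟨(i, e - p • Finsupp.single i 1), ?_⟩
        simp only
        rw [rel_mul_adapted hp, tsub_add_cancel_of_le]
        intro j
        by_cases hij : i = j
        · subst hij; simpa using hi
        · simp [hij]
      refine Submodule.span_induction
        (p := fun F _ => a • F ∈ (nonReduced p σ S).map (adaptedMap p l)) ?_ (by simp)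
        (fun x y _ _ hx hy => by rw [smul_add]; exact add_mem hx hy)
        (fun r x _ hx => by rw [smul_comm]; exact Submodule.smul_mem _ _ hx) hsum
      rintro _ ⟨⟨i, e⟩, rfl⟩
      -- The arbitrary multiplier is absorbed by expanding a * `adapted p l e` in the adapted basis;
      -- the remaining factor `rel p l i` acts by a shift.
      obtain ⟨b, hb⟩ := adaptedMap_surjective hp l (a * adapted p l e)
      have h1 : a • (rel p l i * adapted p l e) = rel p l i * adaptedMap p l b := by
        rw [hb, smul_eq_mul]; ring
      rw [h1]
      clear h1 hb
      rw [sum_smul_monomial b, map_sum, Finset.mul_sum]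
      refine sum_mem fun e' _ => ?_
      rw [map_smul, adaptedMap_monomial, mul_smul_comm, rel_mul_adapted hp]
      refine Submodule.smul_mem _ _ ⟨monomial (e' + p • Finsupp.single i 1) 1, ?_, ?_⟩
      · intro e he
        rw [coeff_monomial, if_neg]
        rintro rfl
        have := he i
        simp at this
      · rw [adaptedMap_monomial]
  · rintro ⟨G, hG, rfl⟩
    rw [sum_smul_monomial G, map_sum]
    refine sum_mem fun e he => ?_
    rw [map_smul, adaptedMap_monomial, smul_eq_C_mul]
    have : ∃ i, p ≤ e i := by
      by_contra hcon
      push Not at hcon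
      exact (mem_support_iff.1 he) (hG e hcon)
    obtain ⟨i, hi⟩ := this
    exact Ideal.mul_mem_left _ _ (adapted_mem_relIdeal hp l hi)

theorem adaptedMap_of_reduced {F : MvPolynomial σ S} (hF : F ∈ reduced p σ S) :
    adaptedMap p l F = F := by
  conv_rhs => rw [sum_smul_monomial F]
  conv_lhs => rw [sum_smul_monomial F]
  rw [map_sum]
  refine Finset.sum_congr rfl fun e he => ?_
  rw [map_smul, adaptedMap_monomial, adapted_of_reduced]
  intro i
  by_contra h
  exact (mem_support_iff.1 he) (hF e i (by lia))

include hp in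
-- `adaptedMap` fixes reduced polynomials, so by injectivity F is its own preimage and is both
-- reduced and nonreduced.
theorem eq_zero_of_reduced_of_mem {F : MvPolynomial σ S} (hF : F ∈ reduced p σ S)
    (h : F ∈ relIdeal p l) : F = 0 := by
  obtain ⟨G, hG, hGF⟩ := (mem_relIdeal_iff hp l).1 h
  rw [← adaptedMap_of_reduced l hF] at hGF
  have := adaptedMap_injective hp l hGF
  subst this
  ext e
  rw [coeff_zero]
  by_cases he : ∀ i, e i < p
  · exact hG e he
  · push Not at he
    obtain ⟨i, hi⟩ := he
    exact hF e i hi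

include hp in
-- In the adapted expansion of F the terms with all exponents below p are plain monomials, and the
-- others lie in the ideal.
theorem exists_reduced (F : MvPolynomial σ S) :
    ∃ G ∈ reduced p σ S, F - G ∈ relIdeal p l := by
  classical
  obtain ⟨H, rfl⟩ := adaptedMap_surjective hp l F
  rw [sum_smul_monomial H]
  refine Finset.sum_induction _
    (fun F => ∃ G ∈ reduced p σ S, adaptedMap p l F - G ∈ relIdeal p l) ?_ ?_ ?_
  · rintro a b ⟨G, hG, h⟩ ⟨G', hG', h'⟩
    refine ⟨G + G', add_mem hG hG', ?_⟩
    rw [map_add, add_sub_add_comm]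
    exact add_mem h h'
  · exact ⟨0, zero_mem _, by simp⟩
  · intro e _
    rw [map_smul, adaptedMap_monomial]
    by_cases he : ∀ i, e i < p
    · refine ⟨H.coeff e • monomial e 1, Submodule.smul_mem _ _ ?_, ?_⟩
      · intro e' i hi
        rw [coeff_monomial, if_neg]
        rintro rfl
        exact absurd (he i) (by lia)
      · rw [adapted_of_reduced _ he, sub_self]
        exact zero_mem _
    · push Not at he
      obtain ⟨i, hi⟩ := he
      refine ⟨0, zero_mem _, ?_⟩
      rw [sub_zero, smul_eq_C_mul]
      exact Ideal.mul_mem_left _ _ (adapted_mem_relIdeal hp l hi)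

end Basis

end FrobRel

/-- Bézout for n and p gives an inverse modulo p. The ring may be zero or have zero divisors, so no
field argument is available. -/
theorem isUnit_natCast_of_lt {p : ℕ} (hp : p.Prime) {S : Type*} [CommRing S] (h0 : (p : S) = 0)
    {n : ℕ} (hn : 0 < n) (hnp : n < p) : IsUnit (n : S) := by
  have hc : IsCoprime (n : ℤ) (p : ℤ) :=
    Nat.isCoprime_iff_coprime.2
      ((Nat.Prime.coprime_iff_not_dvd hp).2 (Nat.not_dvd_of_pos_of_lt hn hnp)).symm
  obtain ⟨a, b, hab⟩ := hc
  have h := congrArg (Int.cast : ℤ → S) hab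
  push_cast at h
  rw [h0, mul_zero, add_zero] at h
  exact IsUnit.of_mul_eq_one_right _ h

/-! ### Substitutions and base changes that preserve reduced polynomials -/

namespace FrobRel

open MvPolynomial

variable {σ : Type*} {S : Type*} [CommRing S] {p : ℕ}

theorem map_mem_reduced {S' : Type*} [CommRing S'] (g : S →+* S') {F : MvPolynomial σ S}
    (hF : F ∈ reduced p σ S) : map g F ∈ reduced p σ S' := by
  intro e i h
  rw [coeff_map, hF e i h, map_zero]

theorem mem_reduced_iff_degreeOf (hp : 0 < p) {F : MvPolynomial σ S} :
    F ∈ reduced p σ S ↔ ∀ i, degreeOf i F < p := by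
  simp_rw [degreeOf_lt_iff hp]
  constructor
  · intro h i m hm
    by_contra hc
    exact (mem_support_iff.1 hm) (h m i (by lia))
  · intro h e i hi
    by_contra hc
    exact absurd (h i e (mem_support_iff.2 hc)) (by lia)

/-- A new variable i occurs only in the polynomial substituted for κ i, with degree at most 1, so
its degree in the image of x ^ e is at most e (κ i) < p. -/
theorem aeval_mem_reduced [Fintype σ] {σ' : Type*} (hp : 0 < p) {F : MvPolynomial σ S}
    (hF : F ∈ reduced p σ S) (f : σ → MvPolynomial σ' S) (κ : σ' → σ)
    (hf : ∀ i, degreeOf i (f (κ i)) ≤ 1) (hf0 : ∀ i k, κ i ≠ k → degreeOf i (f k) = 0) :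
    aeval f F ∈ reduced p σ' S := by
  classical
  rw [F.as_sum, map_sum]
  refine sum_mem fun e he => ?_
  rw [aeval_monomial, algebraMap_eq, ← smul_eq_C_mul, Finsupp.prod_fintype _ _ (by simp)]
  refine Submodule.smul_mem _ _ ((mem_reduced_iff_degreeOf hp).2 fun i => ?_)
  refine (degreeOf_prod_le i _ _).trans_lt ?_
  have : ∀ k, degreeOf i (f k ^ e k) ≤ if κ i = k then e k else 0 := by
    intro k
    refine (degreeOf_pow_le i _ _).trans ?_
    split_ifs with h
    · subst h
      simpa using Nat.mul_le_mul_left (e (κ i)) (hf i)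
    · rw [hf0 i k h, mul_zero]
  refine (Finset.sum_le_sum fun k _ => this k).trans_lt ?_
  rw [Finset.sum_ite_eq Finset.univ (κ i), if_pos (Finset.mem_univ _)]
  by_contra hc
  exact (mem_support_iff.1 he) (hF e (κ i) (by lia))

/-- Reduction modulo J keeps F reduced, so uniqueness of reduced representatives applies over S ⧸ J.
-/
theorem coeff_mem_of_mk_map_eq_zero [Fintype σ] (hp : 1 < p) (l : σ → σ → S) (J : Ideal S)
    {F : MvPolynomial σ S} (hF : F ∈ reduced p σ S)
    (h : Ideal.Quotient.mk (relIdeal p fun j k => Ideal.Quotient.mk J (l j k))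
      (map (Ideal.Quotient.mk J) F) = 0) (e : σ →₀ ℕ) : F.coeff e ∈ J := by
  have := eq_zero_of_reduced_of_mem hp _ (map_mem_reduced _ hF) (Ideal.Quotient.eq_zero_iff_mem.1 h)
  rw [← Ideal.Quotient.eq_zero_iff_mem, ← coeff_map, this, coeff_zero]

/-! ### Additive polynomials -/

/-- First-order Taylor expansion. Through it, functional equations for a polynomial become equations
for its partial derivatives. -/
theorem aeval_add_eps [DecidableEq σ] {A : Type*} [CommRing A] [Algebra S A] (v : σ → A) (j : σ)
    (G : MvPolynomial σ S) :
    aeval (fun k => (TrivSqZeroExt.inl (v k) + if k = j then TrivSqZeroExt.inr 1 else 0 :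
      DualNumber A)) G =
      TrivSqZeroExt.inl (aeval v G) + TrivSqZeroExt.inr (aeval v (pderiv j G)) := by
  induction G using MvPolynomial.induction_on with
  | C a =>
    rw [pderiv_C]
    simp only [algHom_C, map_zero, TrivSqZeroExt.inr_zero, add_zero]
    rfl
  | add f g hf hg =>
    simp only [map_add, hf, hg, TrivSqZeroExt.inl_add, TrivSqZeroExt.inr_add]
    abel
  | mul_X f k hf =>
    rw [map_mul, hf, aeval_X, Derivation.leibniz, pderiv_X]
    by_cases h : k = j
    · subst h
      ext <;> simp [mul_comm, add_comm]
    · ext <;> simp [h, mul_comm]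

/-- Set the variables in the block `B` to zero. -/
theorem coeff_aeval_zero_block [Fintype σ] (B : σ → Prop) [DecidablePred B] (F : MvPolynomial σ S)
    (b : σ →₀ ℕ) :
    coeff b (aeval (fun k => if B k then (0 : MvPolynomial σ S) else X k) F) =
      if ∀ k, B k → b k = 0 then coeff b F else 0 := by
  classical
  induction F using MvPolynomial.induction_on' with
  | add f g hf hg =>
    rw [map_add, coeff_add, coeff_add, hf, hg]
    split_ifs <;> simp
  | monomial e r =>
    rw [aeval_monomial, algebraMap_eq, Finsupp.prod_fintype _ _ (by simp)]
    by_cases he : ∀ k, B k → e k = 0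
    · have : ∏ k, (if B k then (0 : MvPolynomial σ S) else X k) ^ e k = ∏ k, X k ^ e k := by
        refine Finset.prod_congr rfl fun k _ => ?_
        by_cases hk : B k
        · rw [he k hk, pow_zero, pow_zero]
        · rw [if_neg hk]
      rw [this, ← Finsupp.prod_fintype e (fun k n => (X k : MvPolynomial σ S) ^ n) (by simp),
        ← monomial_eq, coeff_monomial]
      by_cases hb : e = b
      · subst hb; rw [if_pos he]
      · simp [hb]
    · push Not at he
      obtain ⟨k, hk, hek⟩ := he
      rw [Finset.prod_eq_zero (Finset.mem_univ k) (by rw [if_pos hk, zero_pow hek]), mul_zero,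
        coeff_zero, coeff_monomial]
      by_cases hb : e = b
      · subst hb
        rw [if_neg]
        intro h
        exact hek (h k hk)
      · simp [hb]

section Additive

variable [Fintype σ] [DecidableEq σ] (B : σ → Prop) [DecidablePred B]

/-- `G(x + x')`, where `x'` is restricted to the variables in the block `B`. -/
noncomputable def addBlock (G : MvPolynomial σ S) : MvPolynomial (σ ⊕ σ) S :=
  aeval (fun k => X (Sum.inl k) + if B k then X (Sum.inr k) else 0) G

/-- `G` in the variables `x'` in the block `B` and `x` outside the block. -/
noncomputable def swapBlock (G : MvPolynomial σ S) : MvPolynomial (σ ⊕ σ) S :=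
  aeval (fun k => if B k then X (Sum.inr k) else X (Sum.inl k)) G

/-- `G` in the variables `x`. -/
noncomputable def leftVars (G : MvPolynomial σ S) : MvPolynomial (σ ⊕ σ) S :=
  aeval (fun k => X (Sum.inl k)) G

theorem addBlock_mem_reduced (hp : 0 < p) {G : MvPolynomial σ S} (hG : G ∈ reduced p σ S) :
    addBlock B G ∈ reduced p (σ ⊕ σ) S := by
  nontriviality S
  refine aeval_mem_reduced hp hG _ (Sum.elim id id) (fun i => ?_) (fun i k hik => ?_)
  · refine (degreeOf_add_le _ _ _).trans (max_le ?_ ?_)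
    · rw [degreeOf_X]; split_ifs <;> simp
    · split_ifs
      · rw [degreeOf_X]; split_ifs <;> simp
      · simp
  · have h1 : degreeOf i (X (Sum.inl k) : MvPolynomial (σ ⊕ σ) S) = 0 :=
      degreeOf_X_of_ne (by rintro rfl; exact hik rfl)
    have h2 : degreeOf i (X (Sum.inr k) : MvPolynomial (σ ⊕ σ) S) = 0 :=
      degreeOf_X_of_ne (by rintro rfl; exact hik rfl)
    refine Nat.le_zero.1 ((degreeOf_add_le _ _ _).trans (max_le h1.le ?_))
    split_ifs
    · exact h2.le
    · simp

theorem swapBlock_mem_reduced (hp : 0 < p) {G : MvPolynomial σ S} (hG : G ∈ reduced p σ S) :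
    swapBlock B G ∈ reduced p (σ ⊕ σ) S := by
  nontriviality S
  refine aeval_mem_reduced hp hG _ (Sum.elim id id) (fun i => ?_) (fun i k hik => ?_)
  · split_ifs <;> (rw [degreeOf_X]; split_ifs <;> simp)
  · split_ifs <;> exact degreeOf_X_of_ne (by rintro rfl; exact hik rfl)

theorem leftVars_mem_reduced (hp : 0 < p) {G : MvPolynomial σ S} (hG : G ∈ reduced p σ S) :
    leftVars G ∈ reduced p (σ ⊕ σ) S := by
  nontriviality S
  refine aeval_mem_reduced hp hG _ (Sum.elim id id) (fun i => ?_) (fun i k hik => ?_)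
  · rw [degreeOf_X]; split_ifs <;> simp
  · exact degreeOf_X_of_ne (by rintro rfl; exact hik rfl)

/-- The substitution `x' = ε e_j`. -/
noncomputable def epsSubst (j : σ) :
    MvPolynomial (σ ⊕ σ) S →ₐ[S] DualNumber (MvPolynomial σ S) :=
  aeval (Sum.elim (fun k => TrivSqZeroExt.inl (X k))
    (fun k => if k = j then TrivSqZeroExt.inr 1 else 0))

variable {B}

omit [Fintype σ] in
theorem epsSubst_addBlock {j : σ} (hj : B j) (G : MvPolynomial σ S) :
    epsSubst j (addBlock B G) =
      TrivSqZeroExt.inl G + TrivSqZeroExt.inr (pderiv j G) := by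
  have h := aeval_add_eps (X : σ → MvPolynomial σ S) j G
  rw [aeval_X_left_apply, aeval_X_left_apply] at h
  rw [← h, addBlock, ← AlgHom.comp_apply, comp_aeval]
  congr 2
  funext k
  simp only [epsSubst, map_add, aeval_X, Sum.elim_inl]
  congr 1
  by_cases hk : B k
  · simp [hk]
  · have : k ≠ j := by rintro rfl; exact hk hj
    simp [hk, this]

omit [Fintype σ] in
theorem epsSubst_swapBlock {j : σ} (hj : B j) (G : MvPolynomial σ S) :
    epsSubst j (swapBlock B G) =
      TrivSqZeroExt.inl (aeval (fun k => if B k then (0 : MvPolynomial σ S) else X k) G) +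
      TrivSqZeroExt.inr
        (aeval (fun k => if B k then (0 : MvPolynomial σ S) else X k) (pderiv j G)) := by
  rw [← aeval_add_eps, swapBlock, ← AlgHom.comp_apply, comp_aeval]
  congr 2
  funext k
  by_cases hk : B k
  · simp [epsSubst, hk]
  · have : k ≠ j := by rintro rfl; exact hk hj
    simp [epsSubst, hk, this]

omit [Fintype σ] in
theorem epsSubst_leftVars (j : σ) (G : MvPolynomial σ S) :
    epsSubst j (leftVars G) = TrivSqZeroExt.inl G := by
  rw [leftVars, ← AlgHom.comp_apply, comp_aeval]
  have h : (fun k => epsSubst j (X (Sum.inl k))) = fun k : σ =>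
      TrivSqZeroExt.inlAlgHom S (MvPolynomial σ S) (MvPolynomial σ S) (X k) := by
    funext k; simp [epsSubst]
  rw [h, ← comp_aeval, AlgHom.comp_apply, aeval_X_left_apply]
  rfl

/-- Setting x' = 0 shows that every monomial of G involves the block B. The ε-part at x' = ε e_j
shows that ∂_j G does not involve the block. A monomial with 0 < a_j < p survives ∂_j because a_j is
a unit, so it is x_j times variables outside B. -/
theorem coeff_of_additive (hp : p.Prime) (h0 : (p : S) = 0) {G : MvPolynomial σ S}
    (hG : G ∈ reduced p σ S) (hadd : addBlock B G = leftVars G + swapBlock B G)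
    {a : σ →₀ ℕ} (ha : coeff a G ≠ 0) :
    ∃ j, B j ∧ a j = 1 ∧ ∀ k, B k → k ≠ j → a k = 0 := by
  have hzero : aeval (fun k => if B k then (0 : MvPolynomial σ S) else X k) G = 0 := by
    have h := congrArg (aeval (Sum.elim (fun k => (X k : MvPolynomial σ S)) fun _ => 0)) hadd
    rw [map_add, addBlock, leftVars, swapBlock] at h
    simp only [← AlgHom.comp_apply, comp_aeval] at h
    have h1 : (fun k : σ => aeval (R := S) (Sum.elim (fun k => (X k : MvPolynomial σ S)) fun _ => 0)
        (X (Sum.inl k) + if B k then X (Sum.inr k) else 0)) = fun k : σ => X k := by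
      funext k; by_cases hk : B k <;> simp [hk]
    have h2 : (fun k : σ => aeval (R := S) (Sum.elim (fun k => (X k : MvPolynomial σ S)) fun _ => 0)
        (X (Sum.inl k) : MvPolynomial (σ ⊕ σ) S)) = fun k : σ => X k := by
      funext k; simp
    have h3 : (fun k : σ => aeval (R := S) (Sum.elim (fun k => (X k : MvPolynomial σ S)) fun _ => 0)
        (if B k then (X (Sum.inr k) : MvPolynomial (σ ⊕ σ) S) else X (Sum.inl k))) =
        fun k : σ => if B k then 0 else X k := by
      funext k; by_cases hk : B k <;> simp [hk]
    rw [h1, h2, h3] at h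
    exact left_eq_add.1 h
  have key : ∀ j, B j → pderiv j G = aeval (fun k => if B k then (0 : MvPolynomial σ S) else X k) (pderiv j G) := by
    intro j hj
    have h := congrArg (epsSubst j) hadd
    rw [map_add, epsSubst_addBlock hj, epsSubst_swapBlock hj, epsSubst_leftVars] at h
    have h2 := congrArg TrivSqZeroExt.snd h
    simpa using h2
  have hex : ∃ j, B j ∧ a j ≠ 0 := by
    by_contra hc
    push Not at hc
    have h := congrArg (coeff a) hzero
    rw [coeff_aeval_zero_block, if_pos hc, coeff_zero] at h
    exact ha h
  obtain ⟨j, hj, haj⟩ := hex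
  have haj' : a = (a - Finsupp.single j 1) + Finsupp.single j 1 := by
    rw [tsub_add_cancel_of_le]
    intro k
    by_cases hk : j = k
    · subst hk; simp; lia
    · simp [hk]
  -- Otherwise the coefficient of x ^ (a - e_j) in ∂_j G, which is a_j times that of x ^ a in G,
  -- would vanish.
  have hb : ∀ k, B k → (a - Finsupp.single j 1 : σ →₀ ℕ) k = 0 := by
    by_contra hc
    have h := congrArg (coeff (a - Finsupp.single j 1)) (key j hj)
    rw [coeff_aeval_zero_block, if_neg hc, coeff_pderiv, ← haj'] at h
    have h1 : ((a - Finsupp.single j 1 : σ →₀ ℕ) j : S) + 1 = (a j : S) := by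
      conv_rhs => rw [haj', Finsupp.add_apply, Finsupp.single_eq_same]
      push_cast
      rfl
    have hlt : a j < p := by
      by_contra hcon
      exact ha (hG a j (by lia))
    rw [h1, mul_comm, (isUnit_natCast_of_lt hp h0 (Nat.pos_of_ne_zero haj) hlt).mul_right_eq_zero]
      at h
    exact ha h
  refine ⟨j, hj, ?_, fun k hk hkj => ?_⟩
  · have := hb j hj
    simp at this
    lia
  · have := hb k hk
    simpa [hkj.symm] using this

/-- Differentiating H(x + x') = H(x) H(x') at x' = 0 gives ∂_j H = y_j H, where y_j is the
coefficient of x_j. Hence n! times the coefficient of x_j ^ n is y_j ^ n. For n = p that monomial is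
not reduced, so y_j ^ p = 0. Up to the unit a_j, the coefficient of any reduced x ^ a with a_j > 0
is a multiple of y_j. -/
theorem coeff_pow_eq_zero_of_grouplike (hp : p.Prime) (h0 : (p : S) = 0) {H : MvPolynomial σ S}
    (hH : H ∈ reduced p σ S) (hc : coeff 0 H = 1)
    (hmul : addBlock (fun _ => True) H = leftVars H * swapBlock (fun _ => True) H)
    {a : σ →₀ ℕ} (ha : a ≠ 0) : coeff a H ^ p = 0 := by
  have key : ∀ (j : σ) (b : σ →₀ ℕ), coeff (b + Finsupp.single j 1) H * (b j + 1) =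
      coeff (Finsupp.single j 1) H * coeff b H := by
    intro j b
    have h := congrArg (epsSubst j) hmul
    rw [map_mul, epsSubst_addBlock trivial, epsSubst_swapBlock trivial, epsSubst_leftVars] at h
    have h2 := congrArg TrivSqZeroExt.snd h
    have hC : aeval (fun k : σ => if True then (0 : MvPolynomial σ S) else X k) (pderiv j H) =
        C (coeff (Finsupp.single j 1) H) := by
      ext e
      rw [coeff_aeval_zero_block, coeff_C]
      by_cases he : 0 = e
      · subst he; simp [coeff_pderiv]
      · rw [if_neg he, if_neg]
        intro h
        exact he (Finsupp.ext fun k => (h k trivial).symm)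
    rw [hC] at h2
    simp at h2
    have h3 := congrArg (coeff b) h2
    rw [coeff_pderiv, mul_comm H, coeff_C_mul] at h3
    exact h3
  have hpow : ∀ (j : σ) (n : ℕ), coeff (Finsupp.single j n) H * (n.factorial : S) =
      coeff (Finsupp.single j 1) H ^ n := by
    intro j n
    induction n with
    | zero => simp [hc]
    | succ n ih =>
      have := key j (Finsupp.single j n)
      rw [← Finsupp.single_add, Finsupp.single_eq_same] at this
      rw [Nat.factorial_succ, pow_succ', ← ih]
      push_cast
      linear_combination (n.factorial : S) * this
  have hy : ∀ j, coeff (Finsupp.single j 1) H ^ p = 0 := by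
    intro j
    rw [← hpow j p, hH _ j (by simp), zero_mul]
  obtain ⟨j, hj⟩ : ∃ j, a j ≠ 0 := by
    by_contra h
    push Not at h
    exact ha (Finsupp.ext h)
  by_cases hlt : a j < p
  · have haj' : a = (a - Finsupp.single j 1) + Finsupp.single j 1 := by
      rw [tsub_add_cancel_of_le]
      intro k
      by_cases hk : j = k
      · subst hk; simp; lia
      · simp [hk]
    have h := key j (a - Finsupp.single j 1)
    have h1 : ((a - Finsupp.single j 1 : σ →₀ ℕ) j : S) + 1 = (a j : S) := by
      conv_rhs => rw [haj', Finsupp.add_apply, Finsupp.single_eq_same]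
      push_cast
      rfl
    rw [← haj', h1] at h
    have h2 := congrArg (· ^ p) h
    simp only [mul_pow, hy, zero_mul] at h2
    rwa [((isUnit_natCast_of_lt hp h0 (Nat.pos_of_ne_zero hj) hlt).pow p).mul_left_eq_zero] at h2
  · rw [hH a j (by lia), zero_pow hp.ne_zero]

end Additive

/-! ### Multilinear polynomials -/

section Multilinear

variable {ι : Type*} [Fintype ι] [DecidableEq ι] {τ : ι → Type*} [∀ i, Fintype (τ i)]
  [∀ i, DecidableEq (τ i)]

/-- The exponent of `∏ x_{i, j i}`. -/
noncomputable def multiExp (j : ∀ i, τ i) : (Σ i, τ i) →₀ ℕ :=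
  ∑ i, Finsupp.single ⟨i, j i⟩ 1

omit [∀ i, Fintype (τ i)] in
theorem multiExp_apply (j : ∀ i, τ i) (i : ι) (k : τ i) :
    multiExp j ⟨i, k⟩ = if j i = k then 1 else 0 := by
  rw [multiExp, Finsupp.finsetSum_apply, Finset.sum_eq_single i]
  · simp [Finsupp.single_apply]
  · intro b _ hb
    rw [Finsupp.single_apply, if_neg]
    intro h
    exact hb (congrArg Sigma.fst h)
  · simp

omit [∀ i, Fintype (τ i)] in
theorem multiExp_injective : Function.Injective (multiExp (τ := τ)) := by
  intro j j' h
  funext i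
  have := DFunLike.congr_fun h ⟨i, j i⟩
  rw [multiExp_apply, multiExp_apply, if_pos rfl] at this
  by_contra hc
  rw [if_neg (Ne.symm hc)] at this
  exact one_ne_zero this

omit [DecidableEq ι] [∀ i, Fintype (τ i)] [∀ i, DecidableEq (τ i)] in
theorem monomial_multiExp (j : ∀ i, τ i) (r : S) :
    monomial (multiExp j) r = C r * ∏ i, X ⟨i, j i⟩ := by
  rw [multiExp, ← mul_one r, ← C_mul_monomial, monomial_sum_one, mul_one]
  rfl

omit [∀ i, Fintype (τ i)] in
theorem monomial_multiExp_mem_reduced (hp : 1 < p) (j : ∀ i, τ i) (r : S) :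
    monomial (multiExp j) r ∈ reduced p (Σ i, τ i) S := by
  classical
  rintro e ⟨i, k⟩ hi
  rw [coeff_monomial, if_neg]
  rintro rfl
  rw [multiExp_apply] at hi
  split_ifs at hi <;> lia

/-- Additivity in block i leaves exactly one variable of that block in the monomial, with exponent
1; its index is j i. -/
theorem exists_multiExp_of_multiadditive (hp : p.Prime) (h0 : (p : S) = 0)
    {G : MvPolynomial (Σ i, τ i) S} (hG : G ∈ reduced p _ S)
    (hadd : ∀ i, addBlock (fun k => k.1 = i) G = leftVars G + swapBlock (fun k => k.1 = i) G)
    {a : (Σ i, τ i) →₀ ℕ} (ha : coeff a G ≠ 0) :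
    ∃ j, a = multiExp j := by
  have h : ∀ i, ∃ k : τ i, a ⟨i, k⟩ = 1 ∧ ∀ k', k' ≠ k → a ⟨i, k'⟩ = 0 := by
    intro i
    obtain ⟨⟨i', k⟩, hi, h1, h2⟩ := coeff_of_additive hp h0 hG (hadd i) ha
    change i' = i at hi
    subst hi
    refine ⟨k, h1, fun k' hk' => h2 ⟨i', k'⟩ rfl fun h => hk' ?_⟩
    exact eq_of_heq (Sigma.mk.inj h).2
  choose j hj1 hj2 using h
  refine ⟨j, Finsupp.ext ?_⟩
  rintro ⟨i, k⟩
  rw [multiExp_apply]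
  split_ifs with hk
  · rw [← hk, hj1]
  · exact hj2 i k (Ne.symm hk)

end Multilinear

end FrobRel

/-! ### The truncated exponential -/

section TruncExp

/-- A natural number which is inverse to `k!` modulo `p`. -/
def invFact (p k : ℕ) : ℕ := ((k.factorial : ZMod p)⁻¹).val

/-- The truncated exponential `∑_{k < p} t ^ k / k!`. -/
def truncExp (p : ℕ) {T : Type*} [CommRing T] (t : T) : T :=
  ∑ k ∈ Finset.range p, (invFact p k : T) * t ^ k

variable {p : ℕ} [hp : Fact p.Prime] {T : Type*} [CommRing T]

theorem natCast_eq_of_zmod (h0 : (p : T) = 0) {a b : ℕ} (h : (a : ZMod p) = b) :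
    (a : T) = b := by
  rw [ZMod.natCast_eq_natCast_iff, Nat.modEq_iff_dvd] at h
  obtain ⟨c, hc⟩ := h
  have := congrArg (Int.cast : ℤ → T) hc
  push_cast at this
  rw [h0, zero_mul] at this
  exact (sub_eq_zero.1 this).symm

theorem invFact_mul_factorial (h0 : (p : T) = 0) {k : ℕ} (hk : k < p) :
    (invFact p k : T) * (k.factorial : T) = 1 := by
  rw [← Nat.cast_mul, ← Nat.cast_one]
  apply natCast_eq_of_zmod h0
  rw [Nat.cast_mul, invFact, ZMod.natCast_val, ZMod.cast_id, Nat.cast_one, inv_mul_cancel₀]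
  rw [Ne, ZMod.natCast_eq_zero_iff, hp.out.dvd_factorial]
  lia

theorem invFact_zero_cast (h0 : (p : T) = 0) : (invFact p 0 : T) = 1 := by
  simpa using invFact_mul_factorial h0 hp.out.pos

theorem invFact_one_cast (h0 : (p : T) = 0) : (invFact p 1 : T) = 1 := by
  simpa using invFact_mul_factorial h0 hp.out.one_lt

omit hp in
theorem map_truncExp {T' : Type*} [CommRing T'] (g : T →+* T') (t : T) :
    g (truncExp p t) = truncExp p (g t) := by
  simp [truncExp]

theorem truncExp_of_sq_eq_zero (h0 : (p : T) = 0) {t : T} (ht : t ^ 2 = 0) :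
    truncExp p t = 1 + t := by
  obtain ⟨n, hn⟩ := Nat.exists_eq_add_of_le hp.out.two_le
  have h : ∀ k ∈ Finset.range n, (invFact p (2 + k) : T) * t ^ (2 + k) = 0 := by
    intro k _
    rw [pow_add, ht, zero_mul, mul_zero]
  rw [truncExp]
  conv_lhs => rw [show Finset.range p = Finset.range (2 + n) by rw [hn]]
  rw [Finset.sum_range_add, Finset.sum_eq_zero h, Finset.sum_range_succ,
    Finset.sum_range_one, invFact_zero_cast h0, invFact_one_cast h0]
  ring

theorem truncExp_zero (h0 : (p : T) = 0) : truncExp p (0 : T) = 1 := by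
  rw [truncExp_of_sq_eq_zero h0 (by ring), add_zero]

theorem invFact_mul_choose (h0 : (p : T) = 0) {i j : ℕ} (h : i + j < p) :
    (invFact p (i + j) : T) * ((i + j).choose i : T) = invFact p i * invFact p j := by
  have h1 := invFact_mul_factorial h0 h
  have h2 := invFact_mul_factorial (T := T) h0 (show i < p by lia)
  have h3 := invFact_mul_factorial (T := T) h0 (show j < p by lia)
  have h4 : ((i + j).choose i : T) * i.factorial * j.factorial = (i + j).factorial := by
    have := congrArg (Nat.cast : ℕ → T) (Nat.add_choose_mul_factorial_mul_factorial j i)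
    rw [add_comm j i] at this
    push_cast at this
    linear_combination this
  calc (invFact p (i + j) : T) * ((i + j).choose i : T)
      = invFact p (i + j) * (i + j).choose i * ((invFact p i * i.factorial) *
          (invFact p j * j.factorial)) := by rw [h2, h3]; ring
    _ = invFact p i * invFact p j * (invFact p (i + j) *
          ((i + j).choose i * i.factorial * j.factorial)) := by ring
    _ = _ := by rw [h4, h1, mul_one]

/-- The terms x ^ i z ^ j of the product with i + j ≥ p vanish by hypothesis, and the remaining ones
regroup by the binomial theorem. -/
theorem truncExp_add (h0 : (p : T) = 0) {x z : T} (h : ∀ i j, p ≤ i + j → x ^ i * z ^ j = 0) :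
    truncExp p (x + z) = truncExp p x * truncExp p z := by
  rw [truncExp, truncExp, truncExp, Finset.sum_mul_sum, ← Finset.sum_product',
    ← Finset.sum_filter_of_ne (p := fun y : ℕ × ℕ => y.1 + y.2 < p)]
  · rw [← Finset.sum_fiberwise_of_maps_to (g := fun y : ℕ × ℕ => y.1 + y.2) (t := Finset.range p)]
    · refine Finset.sum_congr rfl fun n hn => ?_
      rw [Finset.mem_range] at hn
      have hfilter : (((Finset.range p ×ˢ Finset.range p).filter fun y : ℕ × ℕ =>
          y.1 + y.2 < p).filter fun y => y.1 + y.2 = n) = Finset.HasAntidiagonal.antidiagonal n := by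
        ext ⟨a, b⟩
        simp only [Finset.mem_filter, Finset.mem_product, Finset.mem_range,
          Finset.HasAntidiagonal.mem_antidiagonal]
        lia
      rw [hfilter, Commute.add_pow' (Commute.all x z), Finset.mul_sum]
      refine Finset.sum_congr rfl fun y hy => ?_
      replace hy := Finset.HasAntidiagonal.mem_antidiagonal.1 hy
      subst hy
      rw [nsmul_eq_mul]
      linear_combination x ^ y.1 * z ^ y.2 * invFact_mul_choose (T := T) h0 hn
    · intro y hy
      simpa using (Finset.mem_filter.1 hy).2
  · intro y _ hy
    by_contra hlt
    apply hy
    linear_combination (invFact p y.1 * invFact p y.2 : T) * h y.1 y.2 (by lia)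

theorem truncExp_mul_neg (h0 : (p : T) = 0) {t : T} (ht : t ^ p = 0) :
    truncExp p t * truncExp p (-t) = 1 := by
  rw [← truncExp_add h0, add_neg_cancel, truncExp_zero h0]
  intro i j hij
  rw [neg_pow, mul_left_comm, ← pow_add, pow_eq_zero_of_le hij ht, mul_zero]

/-- The truncated exponential of an element with vanishing `p`-th power, as a unit. -/
def truncExpUnit (h0 : (p : T) = 0) (t : T) (ht : t ^ p = 0) : Tˣ where
  val := truncExp p t
  inv := truncExp p (-t)
  val_inv := truncExp_mul_neg h0 ht
  inv_val := by rw [mul_comm, truncExp_mul_neg h0 ht]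

theorem truncExpUnit_val (h0 : (p : T) = 0) (t : T) (ht : t ^ p = 0) :
    (truncExpUnit h0 t ht : T) = truncExp p t := rfl

end TruncExp

/-! ### Coordinates on group functors -/

section Chart

variable {R : Type u} [CommRing R]

/-- The structure map of an algebra under `S`. -/
def underHom {S : CommAlgCat.{u} R} (T : Under S) : S →+* T.right :=
  ((show S ⟶ T.right from T.hom).hom : S →ₐ[R] T.right).toRingHom

theorem underHom_comp {S : CommAlgCat.{u} R} {T T' : Under S} (f : T ⟶ T') (s : S) :
    underHom T' s = f.right.hom (underHom T s) := by
  have h : T.hom ≫ f.right = T'.hom := Under.w f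
  have h2 := congrArg (fun g : S ⟶ T'.right => g.hom s) h
  exact h2.symm

/-- A ring homomorphism out of `S`, as an object under `S`. -/
def underOf {S : CommAlgCat.{u} R} {T : Type u} [CommRing T] (g : S →+* T) : Under S :=
  letI := (g.comp (algebraMap R S)).toAlgebra
  Under.mk (Y := CommAlgCat.of R T) (CommAlgCat.ofHom ({ g with commutes' := fun _ => rfl }))

theorem underHom_underOf {S : CommAlgCat.{u} R} {T : Type u} [CommRing T] (g : S →+* T) (s : S) :
    underHom (underOf g) s = g s := rfl

/-- A ring homomorphism over `S`, as a morphism of objects under `S`. -/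
def underOfHom {S : CommAlgCat.{u} R} {T : Type u} [CommRing T] (g : S →+* T) (T' : Under S)
    (f : T →+* T'.right) (hf : ∀ s, f (g s) = underHom T' s) : underOf g ⟶ T' :=
  letI := (g.comp (algebraMap R S)).toAlgebra
  Under.homMk (U := underOf g) (V := T') (CommAlgCat.ofHom (X := T) (Y := T'.right)
    ({ f with
        commutes' := fun r => by
          change f (g (algebraMap R S r)) = _
          rw [hf]
          exact AlgHom.commutes (T'.hom.hom : S →ₐ[R] T'.right) r })) (by
    ext s
    exact hf s)

variable (p : ℕ)

/-- Coordinates on the group functor `A` over the `R`-algebra `S`: the points of `A` over an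
`S`-algebra are the solutions of the equations `t_j ^ p = ∑ l_{jk} t_k`, under addition. -/
structure Chart (A : GrpFunctor.{u, u} R) (S : CommAlgCat.{u} R) (τ : Type) [Fintype τ] where
  l : τ → τ → S
  coord : ∀ T : Under S, A.obj T.right → τ → T.right
  coord_pow : ∀ T a j, coord T a j ^ p = ∑ k, underHom T (l j k) * coord T a k
  coord_mul : ∀ T a b j, coord T (a * b) j = coord T a j + coord T b j
  coord_map : ∀ {T T' : Under S} (f : T ⟶ T') a j,
    coord T' ((A.map f.right).hom a) j = f.right.hom (coord T a j)
  coord_injective : ∀ T, Function.Injective (coord T)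
  coord_surjective : ∀ T (t : τ → T.right), (∀ j, t j ^ p = ∑ k, underHom T (l j k) * t k) →
    ∃ a, coord T a = t

namespace Chart

variable {p}

/-- Base change of coordinates. -/
def baseChange {A : GrpFunctor.{u, u} R} {S S' : CommAlgCat.{u} R} {τ : Type} [Fintype τ]
    (c : Chart p A S τ) (f : S ⟶ S') : Chart p A S' τ where
  l j k := f.hom (c.l j k)
  coord T a := c.coord ((Under.map f).obj T) a
  coord_pow T a j := c.coord_pow ((Under.map f).obj T) a j
  coord_mul T a b j := c.coord_mul ((Under.map f).obj T) a b j
  coord_map g a j := c.coord_map ((Under.map f).map g) a j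
  coord_injective T := c.coord_injective ((Under.map f).obj T)
  coord_surjective T t ht := c.coord_surjective ((Under.map f).obj T) t ht

variable {ι : Type} [Fintype ι] [DecidableEq ι] {A : ι → GrpFunctor.{u, u} R}
  {S : CommAlgCat.{u} R} {τ : ι → Type} [∀ i, Fintype (τ i)] (c : ∀ i, Chart p (A i) S (τ i))

/-- The block diagonal matrix of the coefficients of a family of charts. -/
def prodL (x y : Σ i, τ i) : S :=
  if h : y.1 = x.1 then (c x.1).l x.2 (h ▸ y.2) else 0

theorem sum_prodL {T : Type*} [CommRing T] (g : S →+* T) (x : Σ i, τ i) (t : (Σ i, τ i) → T) :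
    ∑ y, g (prodL c x y) * t y = ∑ k, g ((c x.1).l x.2 k) * t ⟨x.1, k⟩ := by
  rw [Fintype.sum_sigma, Finset.sum_eq_single x.1]
  · refine Finset.sum_congr rfl fun k _ => ?_
    rw [prodL, dif_pos rfl]
  · intro i _ hi
    refine Finset.sum_eq_zero fun k _ => ?_
    rw [prodL, dif_neg hi, map_zero, zero_mul]
  · simp

/-- The coordinates of a family of points. -/
def prodCoord (T : Under S) (a : ∀ i, (A i).obj T.right) (x : Σ i, τ i) : T.right :=
  (c x.1).coord T (a x.1) x.2

theorem prodCoord_pow (T : Under S) (a : ∀ i, (A i).obj T.right) (x : Σ i, τ i) :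
    prodCoord c T a x ^ p = ∑ y, underHom T (prodL c x y) * prodCoord c T a y := by
  rw [sum_prodL, prodCoord, coord_pow]
  rfl

omit [Fintype ι] [DecidableEq ι] in
theorem prodCoord_map {T T' : Under S} (f : T ⟶ T') (a : ∀ i, (A i).obj T.right) (x : Σ i, τ i) :
    prodCoord c T' (fun i => ((A i).map f.right).hom (a i)) x = f.right.hom (prodCoord c T a x) :=
  (c x.1).coord_map f (a x.1) x.2

omit [Fintype ι] [DecidableEq ι] in
theorem prodCoord_injective (T : Under S) : Function.Injective (prodCoord c T) := by
  intro a b h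
  funext i
  apply (c i).coord_injective T
  funext k
  exact congrFun h ⟨i, k⟩

theorem prodCoord_surjective (T : Under S) (t : (Σ i, τ i) → T.right)
    (ht : ∀ x, t x ^ p = ∑ y, underHom T (prodL c x y) * t y) : ∃ a, prodCoord c T a = t := by
  have h : ∀ i, ∃ a, (c i).coord T a = fun k => t ⟨i, k⟩ := fun i =>
    (c i).coord_surjective T _ fun j => by
      have := ht ⟨i, j⟩
      rwa [sum_prodL] at this
  choose a ha using h
  exact ⟨a, funext fun x => congrFun (ha x.1) x.2⟩

omit [Fintype ι] in
theorem prodCoord_update (T : Under S) (a : ∀ i, (A i).obj T.right) (i : ι) (b : (A i).obj T.right)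
    (x : Σ i, τ i) : prodCoord c T (Function.update a i b) x =
      if h : x.1 = i then (c i).coord T b (h ▸ x.2) else prodCoord c T a x := by
  obtain ⟨i', k⟩ := x
  by_cases h : i' = i
  · subst h
    simp [prodCoord]
  · simp [prodCoord, h]

omit [Fintype ι] in
theorem prodCoord_update_mul (T : Under S) (a : ∀ i, (A i).obj T.right) (i : ι)
    (b b' : (A i).obj T.right) (x : Σ i, τ i) :
    prodCoord c T (Function.update a i (b * b')) x = prodCoord c T (Function.update a i b) x +
      if x.1 = i then prodCoord c T (Function.update a i b') x else 0 := by
  rw [prodCoord_update, prodCoord_update, prodCoord_update]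
  by_cases h : x.1 = i
  · simp [h, coord_mul]
  · simp [h]

/-- The block diagonal coefficients for a pair of families of points. -/
def doubleL {σ : Type*} {S : Type*} [CommRing S] (l : σ → σ → S) : σ ⊕ σ → σ ⊕ σ → S
  | Sum.inl a, Sum.inl b => l a b
  | Sum.inr a, Sum.inr b => l a b
  | _, _ => 0

theorem sum_doubleL {σ : Type*} [Fintype σ] {S T : Type*} [CommRing S] [CommRing T] (g : S →+* T)
    (l : σ → σ → S) (t : σ ⊕ σ → T) :
    (∀ x, t x ^ p = ∑ y, g (doubleL l x y) * t y) ↔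
    (∀ x, t (Sum.inl x) ^ p = ∑ y, g (l x y) * t (Sum.inl y)) ∧
    (∀ x, t (Sum.inr x) ^ p = ∑ y, g (l x y) * t (Sum.inr y)) := by
  rw [Sum.forall]
  simp [Fintype.sum_sum_type, doubleL]

end Chart

/-- A polynomial with exponents less than `p` which vanishes at all solutions of
`t_j ^ p = ∑ l_{jk} t_k` in `S`-algebras killed by `J` has coefficients in `J`. -/
theorem coeff_mem_of_forall_eval₂_eq_zero {p : ℕ} (hp : 1 < p) {S : CommAlgCat.{u} R} {σ : Type}
    [Fintype σ] (l : σ → σ → S) (J : Ideal S) {F : MvPolynomial σ S}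
    (hF : F ∈ FrobRel.reduced p σ S)
    (h : ∀ T : Under S, (∀ s ∈ J, underHom T s = 0) → ∀ t : σ → T.right,
      (∀ j, t j ^ p = ∑ k, underHom T (l j k) * t k) → F.eval₂ (underHom T) t = 0)
    (e : σ →₀ ℕ) : F.coeff e ∈ J := by
  refine FrobRel.coeff_mem_of_mk_map_eq_zero hp l J hF ?_ e
  -- The test algebra carries the universal solution of the equations over S ⧸ J.
  let U := MvPolynomial σ (S ⧸ J) ⧸ FrobRel.relIdeal p fun j k => Ideal.Quotient.mk J (l j k)
  let g : S →+* U := ((Ideal.Quotient.mk _).comp MvPolynomial.C).comp (Ideal.Quotient.mk J)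
  have hJ : ∀ s ∈ J, underHom (underOf g) s = 0 := by
    intro s hs
    rw [underHom_underOf]
    change g s = (0 : U)
    simp [g, Ideal.Quotient.eq_zero_iff_mem.2 hs]
  have h1 := h (underOf g) hJ (fun j => Ideal.Quotient.mk _ (MvPolynomial.X j)) (by
    intro j
    change (Ideal.Quotient.mk _ (MvPolynomial.X j) : U) ^ p = ∑ k, g (l j k) *
      (Ideal.Quotient.mk _ (MvPolynomial.X k) : U)
    have : FrobRel.rel p (fun j k => Ideal.Quotient.mk J (l j k)) j ∈
      FrobRel.relIdeal p fun j k => Ideal.Quotient.mk J (l j k) := Ideal.subset_span ⟨j, rfl⟩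
    rw [← Ideal.Quotient.eq_zero_iff_mem, FrobRel.rel, map_sub, sub_eq_zero] at this
    simpa [g] using this)
  refine Eq.trans ?_ h1
  change _ = F.eval₂ g _
  have hext : (Ideal.Quotient.mk (FrobRel.relIdeal p fun j k => Ideal.Quotient.mk J (l j k))).comp
      (MvPolynomial.map (Ideal.Quotient.mk J)) = MvPolynomial.eval₂Hom g fun j =>
        (Ideal.Quotient.mk _ (MvPolynomial.X j) : U) := by
    apply MvPolynomial.ringHom_ext
    · intro s; simp [g]
    · intro i; simp
  exact congrArg (fun φ : MvPolynomial σ S →+* U => φ F) hext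

/-- The case J = ⊥ of `coeff_mem_of_forall_eval₂_eq_zero`, applied to F - G. -/
theorem eval₂_unique_of_reduced {p : ℕ} (hp : 1 < p) {S : CommAlgCat.{u} R} {σ : Type}
    [Fintype σ] (l : σ → σ → S) {F G : MvPolynomial σ S}
    (hF : F ∈ FrobRel.reduced p σ S) (hG : G ∈ FrobRel.reduced p σ S)
    (h : ∀ T : Under S, ∀ t : σ → T.right,
      (∀ j, t j ^ p = ∑ k, underHom T (l j k) * t k) →
        F.eval₂ (underHom T) t = G.eval₂ (underHom T) t) : F = G := by
  rw [← sub_eq_zero]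
  ext e
  have := coeff_mem_of_forall_eval₂_eq_zero hp l ⊥ (sub_mem hF hG) (fun T _ t ht => by
    rw [MvPolynomial.eval₂_sub, h T t ht, sub_self]) e
  rw [MvPolynomial.coeff_zero]
  exact this

/-- Yoneda: the polynomial algebra U modulo the relations carries a universal family of points. F is
a reduced lift of the value of f there, and naturality transports the formula to every other family.
-/
theorem Chart.exists_polynomial {p : ℕ} (hp : 1 < p) {ι : Type} [Fintype ι] [DecidableEq ι]
    {A : ι → GrpFunctor.{u, u} R} {S : CommAlgCat.{u} R} {τ : ι → Type} [∀ i, Fintype (τ i)]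
    (c : ∀ i, Chart p (A i) S (τ i)) (f : ∀ T : Under S, (∀ i, (A i).obj T.right) → T.right)
    (hf : ∀ {T T' : Under S} (g : T ⟶ T') (a : ∀ i, (A i).obj T.right),
      f T' (fun i => ((A i).map g.right).hom (a i)) = g.right.hom (f T a)) :
    ∃ F ∈ FrobRel.reduced p (Σ i, τ i) S, ∀ T a,
      f T a = F.eval₂ (underHom T) (prodCoord c T a) := by
  let I := FrobRel.relIdeal p (prodL c)
  let U := MvPolynomial (Σ i, τ i) S ⧸ I
  let g : S →+* U := (Ideal.Quotient.mk _).comp MvPolynomial.C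
  obtain ⟨a, ha⟩ := prodCoord_surjective c (underOf g)
    (fun x => (Ideal.Quotient.mk I (MvPolynomial.X x) : U)) (by
    intro x
    change (Ideal.Quotient.mk I (MvPolynomial.X x) : U) ^ p = ∑ y, g (prodL c x y) *
      (Ideal.Quotient.mk I (MvPolynomial.X y) : U)
    have : FrobRel.rel p (prodL c) x ∈ I := Ideal.subset_span ⟨x, rfl⟩
    rw [← Ideal.Quotient.eq_zero_iff_mem, FrobRel.rel, map_sub, sub_eq_zero] at this
    simpa [g] using this)
  obtain ⟨F0, hF0⟩ := Ideal.Quotient.mk_surjective (show U from f (underOf g) a)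
  obtain ⟨F, hF, hFF⟩ := FrobRel.exists_reduced hp (prodL c) F0
  refine ⟨F, hF, fun T b => ?_⟩
  have hlift : ∀ G ∈ I, MvPolynomial.eval₂Hom (underHom T) (prodCoord c T b) G = 0 := by
    intro G hG
    have hle : I ≤ RingHom.ker (MvPolynomial.eval₂Hom (underHom T) (prodCoord c T b)) := by
      refine Ideal.span_le.2 ?_
      rintro _ ⟨x, rfl⟩
      simp [RingHom.mem_ker, FrobRel.rel, prodCoord_pow]
    exact hle hG
  let q : U →+* T.right := Ideal.Quotient.lift I _ hlift
  have hq : ∀ G, q (Ideal.Quotient.mk I G) = G.eval₂ (underHom T) (prodCoord c T b) := fun G => rfl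
  let φ := underOfHom g T q (fun s => by
    change q (Ideal.Quotient.mk I (MvPolynomial.C s)) = _
    rw [hq, MvPolynomial.eval₂_C])
  -- The family b is the image of the universal one under q, because the two have the same
  -- coordinates.
  have hb : (fun i => ((A i).map φ.right).hom (a i)) = b := by
    apply prodCoord_injective c T
    funext x
    rw [prodCoord_map, ha]
    change q (Ideal.Quotient.mk I (MvPolynomial.X x)) = _
    rw [hq, MvPolynomial.eval₂_X]
  have h := hf φ a
  rw [hb] at h
  rw [h]
  change q _ = _
  rw [← hq]
  congr 1
  refine Eq.trans hF0.symm (Ideal.Quotient.eq.2 hFF)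

end Chart

/-! ### Evaluation and base change of the block substitutions -/

namespace FrobRel

open MvPolynomial

variable {σ : Type*} {S : Type*} [CommRing S] {p : ℕ}

theorem eval₂_aeval {σ' : Type*} {T : Type*} [CommRing T] (g : S →+* T) (t : σ' → T)
    (f : σ → MvPolynomial σ' S) (G : MvPolynomial σ S) :
    (aeval f G).eval₂ g t = G.eval₂ g fun k => (f k).eval₂ g t := by
  induction G using MvPolynomial.induction_on with
  | C a => simp [algHom_C, algebraMap_eq]
  | add f g hf hg => rw [map_add, eval₂_add, hf, hg, eval₂_add]
  | mul_X f k hf => rw [map_mul, eval₂_mul, hf, aeval_X, eval₂_mul, eval₂_X]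

theorem map_aeval_eq {σ' : Type*} {S' : Type*} [CommRing S'] (g : S →+* S')
    (f : σ → MvPolynomial σ' S) (G : MvPolynomial σ S) :
    map g (aeval f G) = aeval (fun k => map g (f k)) (map g G) := by
  induction G using MvPolynomial.induction_on with
  | C a => simp [algHom_C, algebraMap_eq]
  | add f g hf hg => rw [map_add, map_add, hf, hg, map_add, map_add]
  | mul_X f k hf => rw [map_mul, map_mul, hf, aeval_X, map_mul, map_mul, map_X, aeval_X]

section Block

variable (B : σ → Prop) [DecidablePred B]

theorem map_addBlock {S' : Type*} [CommRing S'] (g : S →+* S') (G : MvPolynomial σ S) :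
    map g (addBlock B G) = addBlock B (map g G) := by
  rw [addBlock, map_aeval_eq, addBlock]
  congr 2
  funext k
  split_ifs <;> simp

theorem map_swapBlock {S' : Type*} [CommRing S'] (g : S →+* S') (G : MvPolynomial σ S) :
    map g (swapBlock B G) = swapBlock B (map g G) := by
  rw [swapBlock, map_aeval_eq, swapBlock]
  congr 2
  funext k
  split_ifs <;> simp

theorem map_leftVars {S' : Type*} [CommRing S'] (g : S →+* S') (G : MvPolynomial σ S) :
    map g (leftVars G) = leftVars (map g G) := by
  rw [leftVars, map_aeval_eq, leftVars]
  simp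

theorem eval₂_addBlock {T : Type*} [CommRing T] (g : S →+* T) (t : σ ⊕ σ → T)
    (G : MvPolynomial σ S) : (addBlock B G).eval₂ g t =
      G.eval₂ g fun k => t (Sum.inl k) + if B k then t (Sum.inr k) else 0 := by
  rw [addBlock, eval₂_aeval]
  congr 1
  funext k
  split_ifs <;> simp [eval₂_add]

theorem eval₂_swapBlock {T : Type*} [CommRing T] (g : S →+* T) (t : σ ⊕ σ → T)
    (G : MvPolynomial σ S) : (swapBlock B G).eval₂ g t =
      G.eval₂ g fun k => if B k then t (Sum.inr k) else t (Sum.inl k) := by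
  rw [swapBlock, eval₂_aeval]
  congr 1
  funext k
  split_ifs <;> simp

theorem eval₂_leftVars {T : Type*} [CommRing T] (g : S →+* T) (t : σ ⊕ σ → T)
    (G : MvPolynomial σ S) : (leftVars G).eval₂ g t = G.eval₂ g fun k => t (Sum.inl k) := by
  rw [leftVars, eval₂_aeval]
  simp

/-- The two factors involve disjoint sets of variables, so the degree in any single variable comes
from one factor only. -/
theorem leftVars_mul_swapBlock_mem_reduced [Fintype σ] (hp : 0 < p) {F G : MvPolynomial σ S}
    (hF : F ∈ reduced p σ S) (hG : G ∈ reduced p σ S) :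
    leftVars F * swapBlock (fun _ => True) G ∈ reduced p (σ ⊕ σ) S := by
  classical
  have h1 : leftVars F = rename Sum.inl F := DFunLike.congr_fun
    (algHom_ext (f := aeval fun k => (X (Sum.inl k) : MvPolynomial (σ ⊕ σ) S)) (by simp)) F
  have h2 : swapBlock (fun _ => True) G = rename Sum.inr G := by
    simp only [swapBlock, if_true]
    exact DFunLike.congr_fun
      (algHom_ext (f := aeval fun k => (X (Sum.inr k) : MvPolynomial (σ ⊕ σ) S)) (by simp)) G
  rw [mem_reduced_iff_degreeOf hp] at *
  intro i
  refine (degreeOf_mul_le i _ _).trans_lt ?_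
  rw [h1, h2]
  rcases i with i | i
  · rw [degreeOf_rename_of_injective Sum.inl_injective]
    have : degreeOf (Sum.inl i) (rename (Sum.inr : σ → σ ⊕ σ) G) = 0 := by
      by_contra h
      rw [← ne_eq, ← mem_vars_iff_degreeOf_ne_zero] at h
      have := vars_rename _ _ h
      simp at this
    rw [this]
    exact hF i
  · rw [degreeOf_rename_of_injective Sum.inr_injective]
    have : degreeOf (Sum.inr i) (rename (Sum.inl : σ → σ ⊕ σ) F) = 0 := by
      by_contra h
      rw [← ne_eq, ← mem_vars_iff_degreeOf_ne_zero] at h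
      have := vars_rename _ _ h
      simp at this
    rw [this, zero_add]
    exact hG i

end Block

theorem one_mem_reduced (hp : 0 < p) : (1 : MvPolynomial σ S) ∈ reduced p σ S := by
  classical
  intro e i hi
  rw [coeff_one, if_neg]
  rintro rfl
  simp at hi
  lia

theorem eval₂_eq_zero_of_coeff {T : Type*} [CommRing T] (g : S →+* T) (t : σ → T)
    {F : MvPolynomial σ S} (h : ∀ e, g (coeff e F) = 0) : F.eval₂ g t = 0 := by
  rw [eval₂_eq]
  exact Finset.sum_eq_zero fun e _ => by rw [h, zero_mul]

theorem eval₂_mul_eval₂_eq_zero {T : Type*} [CommRing T] (g : S →+* T) (t t' : σ → T)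
    {F G : MvPolynomial σ S} (h : ∀ e e', g (coeff e F * coeff e' G) = 0) :
    F.eval₂ g t * G.eval₂ g t' = 0 := by
  rw [eval₂_eq, eval₂_eq, Finset.sum_mul_sum]
  refine Finset.sum_eq_zero fun e _ => Finset.sum_eq_zero fun e' _ => ?_
  have := h e e'
  rw [map_mul] at this
  linear_combination (∏ i ∈ e.support, t i ^ e i) * (∏ i ∈ e'.support, t' i ^ e' i) * this

end FrobRel

/-! ### First-order perturbation of exponential products, and nilpotent ideals -/

theorem prod_one_add_of_mul_eq_zero {J T : Type*} [Fintype J] [CommRing T] (z : J → T)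
    (hz : ∀ i j, z i * z j = 0) : ∏ j, (1 + z j) = 1 + ∑ j, z j := by
  classical
  have h : ∀ s : Finset J, ∏ j ∈ s, (1 + z j) = 1 + ∑ j ∈ s, z j := by
    intro s
    induction s using Finset.induction_on with
    | empty => simp
    | insert a s ha ih =>
      rw [Finset.prod_insert ha, Finset.sum_insert ha, ih]
      have : z a * ∑ j ∈ s, z j = 0 := by
        rw [Finset.mul_sum]; exact Finset.sum_eq_zero fun j _ => hz a j
      linear_combination this
  exact h _

/-- Since z annihilates y and itself, all y_j ^ a z_j ^ b with a + b ≥ p vanish, so E is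
multiplicative here and E(z_j m_j) = 1 + z_j m_j. This is the linearisation used at each stage of
the successive approximation. -/
theorem prod_truncExp_add {p : ℕ} [hp : Fact p.Prime] {J T : Type*} [Fintype J] [CommRing T]
    (h0 : (p : T) = 0) (y z m : J → T) (hy : ∀ j, y j ^ p = 0) (hyz : ∀ i j, y i * z j = 0)
    (hzz : ∀ i j, z i * z j = 0) :
    ∏ j, truncExp p ((y j + z j) * m j) =
      (∏ j, truncExp p (y j * m j)) * (1 + ∑ j, z j * m j) := by
  rw [← prod_one_add_of_mul_eq_zero (fun j => z j * m j), ← Finset.prod_mul_distrib]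
  · refine Finset.prod_congr rfl fun j _ => ?_
    have hzp : (z j * m j) ^ 2 = 0 := by linear_combination m j ^ 2 * hzz j j
    rw [add_mul, truncExp_add h0, truncExp_of_sq_eq_zero h0 hzp]
    intro a b hab
    rcases Nat.eq_zero_or_pos a with rfl | ha
    · rw [pow_eq_zero_of_le (hp.out.two_le.trans (by lia)) hzp, mul_zero]
    · rcases Nat.eq_zero_or_pos b with rfl | hb
      · rw [mul_pow, pow_eq_zero_of_le (by lia) (hy j), zero_mul, zero_mul]
      · obtain ⟨a, rfl⟩ := Nat.exists_eq_add_of_lt ha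
        obtain ⟨b, rfl⟩ := Nat.exists_eq_add_of_lt hb
        rw [zero_add, zero_add, pow_succ, pow_succ]
        linear_combination (y j * m j) ^ a * (z j * m j) ^ b * m j * m j * hyz j j
  · intro i j
    linear_combination m i * m j * hzz i j

/-- An ideal generated by finitely many elements with vanishing `p`-th powers. -/
theorem exists_pow_span_eq_bot {p : ℕ} {S : Type*} [CommRing S] {s : Set S} (hs : s.Finite)
    (h : ∀ x ∈ s, x ^ p = 0) : ∃ n, Ideal.span s ^ n = ⊥ := by
  have hfg : (Ideal.span s).FG := ⟨hs.toFinset, by simp⟩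
  have : IsNilpotent (Ideal.span s) := by
    rw [hfg.isNilpotent_iff_le_nilradical, Ideal.span_le]
    intro x hx
    exact ⟨p, h x hx⟩
  exact this

theorem pow_eq_zero_of_mem_span {p : ℕ} [hp : Fact p.Prime] {S : Type*} [CommRing S]
    (h0 : (p : S) = 0) {s : Set S} (h : ∀ x ∈ s, x ^ p = 0) {x : S} (hx : x ∈ Ideal.span s) :
    x ^ p = 0 := by
  refine Submodule.span_induction (p := fun x _ => x ^ p = 0) h (zero_pow hp.out.ne_zero) ?_ ?_ hx
  · intro x y _ _ hx hy
    rw [add_pow_p_of_commute p h0 (Commute.all x y), hx, hy, add_zero]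
  · intro a x _ hx
    rw [smul_eq_mul, mul_pow, hx, mul_zero]

/-! ### Poly-additive maps to `𝔾_m` killed by Frobenius, in coordinates -/

section GmVal

variable {R : Type u} [CommRing R]

/-- The value in `S` of an `S`-point of `𝔾_m`. -/
def gmVal {S : CommAlgCat.{u} R} (v : (Gm R).obj S) : S := Units.val (α := S) v

/-- The `S`-point of `𝔾_m` given by a unit of `S`. -/
def gmOf {S : CommAlgCat.{u} R} (v : (S : Type u)ˣ) : (Gm R).obj S := v

theorem gmVal_gmOf {S : CommAlgCat.{u} R} (v : (S : Type u)ˣ) : gmVal (gmOf v) = v := rfl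

theorem gmVal_injective {S : CommAlgCat.{u} R} : Function.Injective (gmVal (S := S)) :=
  fun _ _ h => Units.ext h

theorem gmVal_mul {S : CommAlgCat.{u} R} (v w : (Gm R).obj S) :
    gmVal (v * w) = gmVal v * gmVal w := rfl

theorem gmVal_one {S : CommAlgCat.{u} R} : gmVal (1 : (Gm R).obj S) = 1 := rfl

theorem isUnit_gmVal {S : CommAlgCat.{u} R} (v : (Gm R).obj S) : IsUnit (gmVal v) :=
  Units.isUnit (M := S) v

theorem gmVal_map {S T : CommAlgCat.{u} R} (f : S ⟶ T) (v : (Gm R).obj S) :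
    gmVal (((Gm R).map f).hom v) = f.hom (gmVal v) := rfl

end GmVal

namespace Chart

variable {p : ℕ} [hp : Fact p.Prime] {R : Type u} [CommRing R] [Algebra (ZMod p) R]
  {ι : Type} [Fintype ι] [DecidableEq ι] {A : ι → GrpFunctor.{u, u} R}
  {S : CommAlgCat.{u} R} {τ : ι → Type} [∀ i, Fintype (τ i)]
  (c : ∀ i, Chart p (A i) S (τ i))

/-- The multilinear monomial `∏ x_{i, j i}` at a family of points. -/
def multiCoord (T : Under S) (a : ∀ i, (A i).obj T.right) (j : ∀ i, τ i) : T.right :=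
  ∏ i, (c i).coord T (a i) (j i)

theorem multiCoord_map {T T' : Under S} (f : T ⟶ T') (a : ∀ i, (A i).obj T.right)
    (j : ∀ i, τ i) : multiCoord c T' (fun i => ((A i).map f.right).hom (a i)) j =
      f.right.hom (multiCoord c T a j) := by
  rw [multiCoord, multiCoord, map_prod]
  exact Finset.prod_congr rfl fun i _ => (c i).coord_map f (a i) (j i)

theorem multiCoord_update_mul (T : Under S) (a : ∀ i, (A i).obj T.right) (i : ι)
    (b b' : (A i).obj T.right) (j : ∀ i, τ i) :
    multiCoord c T (Function.update a i (b * b')) j =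
      multiCoord c T (Function.update a i b) j + multiCoord c T (Function.update a i b') j := by
  have h : ∀ b, multiCoord c T (Function.update a i b) j =
      (c i).coord T b (j i) * ∏ k ∈ Finset.univ.erase i, (c k).coord T (a k) (j k) := by
    intro b
    rw [multiCoord, ← Finset.mul_prod_erase _ _ (Finset.mem_univ i), Function.update_self]
    congr 1
    refine Finset.prod_congr rfl fun k hk => ?_
    rw [Function.update_of_ne (Finset.ne_of_mem_erase hk)]
  rw [h, h, h, coord_mul, add_mul]

theorem eval₂_multiExp [∀ i, DecidableEq (τ i)] (T : Under S) (a : ∀ i, (A i).obj T.right)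
    (z : (∀ i, τ i) → S) :
    (∑ j, MvPolynomial.monomial (FrobRel.multiExp j) (z j)).eval₂ (underHom T) (prodCoord c T a) =
      ∑ j, underHom T (z j) * multiCoord c T a j := by
  rw [MvPolynomial.eval₂_sum]
  refine Finset.sum_congr rfl fun j _ => ?_
  rw [FrobRel.monomial_multiExp, MvPolynomial.eval₂_mul, MvPolynomial.eval₂_C,
    MvPolynomial.eval₂_prod]
  simp only [MvPolynomial.eval₂_X]
  rfl

variable (p) in
theorem natCast_under (T : Under S) : (p : T.right) = 0 :=
  natCast_p_eq_zero_of_algebra p R T.right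

theorem mul_pow_eq_zero_under (T : Under S) {y : S} (hy : y ^ p = 0) (m : T.right) :
    (underHom T y * m) ^ p = 0 := by
  rw [mul_pow, ← map_pow, hy, map_zero, zero_mul]

/-- The poly-additive map `∏_j E(y_j ∏_i x_{i, j i})`. -/
noncomputable def expPoly (y : (∀ i, τ i) → S) (hy : ∀ j, y j ^ p = 0) : PolyAddOver A (Gm R) S where
  toFun T a := gmOf (∏ j, truncExpUnit (natCast_under p T)
    (underHom T (y j) * multiCoord c T a j) (mul_pow_eq_zero_under T (hy j) _))
  naturality {T T'} f a := by
    apply gmVal_injective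
    rw [gmVal_map]
    simp only [gmVal_gmOf, Units.coe_prod, truncExpUnit_val]
    rw [map_prod]
    refine Finset.prod_congr rfl fun j _ => ?_
    rw [← AlgHom.coe_toRingHom, map_truncExp, map_mul, multiCoord_map, underHom_comp f]
    rfl
  map_mul T i a x y := by
    apply gmVal_injective
    rw [gmVal_mul]
    simp only [gmVal_gmOf, Units.coe_prod, truncExpUnit_val]
    rw [← Finset.prod_mul_distrib]
    refine Finset.prod_congr rfl fun j _ => ?_
    rw [multiCoord_update_mul, mul_add, truncExp_add (natCast_under p T)]
    intro m n hmn
    rw [mul_pow, mul_pow, mul_mul_mul_comm, ← pow_add, ← map_pow,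
      pow_eq_zero_of_le hmn (hy j), map_zero, zero_mul]

theorem gmVal_expPoly (y : (∀ i, τ i) → S) (hy : ∀ j, y j ^ p = 0) (T : Under S)
    (a : ∀ i, (A i).obj T.right) : gmVal ((expPoly c y hy).toFun T a) =
      ∏ j, truncExp p (underHom T (y j) * multiCoord c T a j) := by
  simp only [expPoly, gmVal_gmOf, Units.coe_prod, truncExpUnit_val]

theorem baseChange_expPoly {S' : CommAlgCat.{u} R} (f : S ⟶ S') (y : (∀ i, τ i) → S)
    (hy : ∀ j, y j ^ p = 0) : (expPoly c y hy).baseChange f =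
      expPoly (fun i => (c i).baseChange f) (fun j => f.hom (y j))
        (fun j => by rw [← map_pow, hy, map_zero]) := rfl

theorem expPoly_zero : expPoly c 0 (fun _ => zero_pow hp.out.ne_zero) = 1 := by
  ext T a
  apply gmVal_injective
  rw [gmVal_expPoly, PolyAddOver.one_toFun, gmVal_one]
  refine Finset.prod_eq_one fun j _ => ?_
  rw [Pi.zero_apply, map_zero, zero_mul, truncExp_zero (natCast_under p T)]

theorem polyAddOver_ext {f g : PolyAddOver A (Gm R) S}
    (h : ∀ T a, gmVal (f.toFun T a) = gmVal (g.toFun T a)) : f = g := by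
  ext T a
  exact gmVal_injective (h T a)

theorem exists_polynomial_of_polyAdd (f : PolyAddOver A (Gm R) S) :
    ∃ F ∈ FrobRel.reduced p (Σ i, τ i) S, ∀ T a,
      gmVal (f.toFun T a) = F.eval₂ (underHom T) (prodCoord c T a) :=
  exists_polynomial hp.out.one_lt c (fun T a => gmVal (f.toFun T a)) fun g a => by
    rw [f.naturality, gmVal_map]

/-- Reduced representatives are unique and compatible with base change, so triviality after base
change is read off the coefficients. For the Frobenius of S the criterion is that the coefficients
of F - 1 have vanishing p-th powers. -/
theorem baseChange_eq_one_iff {S' : CommAlgCat.{u} R} (g : S ⟶ S') {f : PolyAddOver A (Gm R) S}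
    {F : MvPolynomial (Σ i, τ i) S} (hF : F ∈ FrobRel.reduced p (Σ i, τ i) S)
    (hf : ∀ T a, gmVal (f.toFun T a) = F.eval₂ (underHom T) (prodCoord c T a)) :
    f.baseChange g = 1 ↔ ∀ e, g.hom ((F - 1).coeff e) = 0 := by
  have hval : ∀ (T : Under S') (a : ∀ i, (A i).obj T.right),
      gmVal ((f.baseChange g).toFun T a) = (F.map (g.hom : S →+* S')).eval₂ (underHom T)
        (prodCoord (fun i => (c i).baseChange g) T a) := by
    intro T a
    refine (hf ((Under.map g).obj T) a).trans ?_
    rw [MvPolynomial.eval₂_map]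
    rfl
  constructor
  · intro h
    have hmap : F.map (g.hom : S →+* S') = 1 := by
      refine eval₂_unique_of_reduced hp.out.one_lt (prodL fun i => (c i).baseChange g)
        (FrobRel.map_mem_reduced _ hF) (FrobRel.one_mem_reduced hp.out.pos) fun T t ht => ?_
      obtain ⟨a, rfl⟩ := prodCoord_surjective _ T t ht
      rw [← hval, h, MvPolynomial.eval₂_one]
      rfl
    intro e
    have : (F - 1).map (g.hom : S →+* S') = 0 := by rw [map_sub, hmap, map_one, sub_self]
    have h2 := congrArg (MvPolynomial.coeff e) this
    rw [MvPolynomial.coeff_map, MvPolynomial.coeff_zero] at h2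
    exact h2
  · intro h
    have hmap : F.map (g.hom : S →+* S') = 1 := by
      rw [← sub_eq_zero, ← map_one (MvPolynomial.map (g.hom : S →+* S')), ← map_sub]
      ext e
      rw [MvPolynomial.coeff_map, MvPolynomial.coeff_zero]
      exact h e
    refine polyAddOver_ext fun T a => ?_
    rw [hval, hmap, MvPolynomial.eval₂_one]
    rfl

/-- The twist changes only the R-algebra structure of S, not the ring. -/
theorem frobHom_apply_eq_zero_iff (s : S) : (frobHom p S).hom s = 0 ↔ s ^ p = 0 := Iff.rfl

theorem baseChange_frobHom_expPoly (y : (∀ i, τ i) → S) (hy : ∀ j, y j ^ p = 0) :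
    (expPoly c y hy).baseChange (frobHom p S) = 1 := by
  rw [baseChange_expPoly, ← expPoly_zero fun i => (c i).baseChange (frobHom p S)]
  congr 1
  funext j
  exact (frobHom_apply_eq_zero_iff (y j)).2 (hy j)

/-- Write f = 1 + G. The coefficients of G lie in J, so the quadratic term of (1 + G)(1 + G') dies
modulo J * J ≤ K, and multiplicativity of f becomes additivity of G in each block. A reduced
polynomial additive in every block is multilinear. -/
theorem exists_multilinear_of_trivial_mod [∀ i, DecidableEq (τ i)] (f : PolyAddOver A (Gm R) S)
    (J K : Ideal S) (hKJ : J * J ≤ K)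
    (hf : ∀ T : Under S, (∀ s ∈ J, underHom T s = 0) → ∀ a, gmVal (f.toFun T a) = 1) :
    ∃ z : (∀ i, τ i) → S, (∀ j, z j ∈ J) ∧ ∀ T : Under S, (∀ s ∈ K, underHom T s = 0) →
      ∀ a, gmVal (f.toFun T a) = 1 + ∑ j, underHom T (z j) * multiCoord c T a j := by
  obtain ⟨F, hF, hFf⟩ := exists_polynomial_of_polyAdd c f
  set G := F - 1 with hG
  have hGr : G ∈ FrobRel.reduced p (Σ i, τ i) S :=
    sub_mem hF (FrobRel.one_mem_reduced hp.out.pos)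
  have hGval : ∀ T a, gmVal (f.toFun T a) = 1 + G.eval₂ (underHom T) (prodCoord c T a) := by
    intro T a
    rw [hFf, hG, MvPolynomial.eval₂_sub, MvPolynomial.eval₂_one]
    ring
  have hGJ : ∀ e, G.coeff e ∈ J := by
    refine coeff_mem_of_forall_eval₂_eq_zero hp.out.one_lt (prodL c) J hGr fun T hT t ht => ?_
    obtain ⟨a, rfl⟩ := prodCoord_surjective c T t ht
    have := hGval T a
    rw [hf T hT a] at this
    exact left_eq_add.1 this
  have hadd : ∀ i, FrobRel.addBlock (fun k => k.1 = i) (G.map (Ideal.Quotient.mk K)) =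
      FrobRel.leftVars (G.map (Ideal.Quotient.mk K)) +
        FrobRel.swapBlock (fun k => k.1 = i) (G.map (Ideal.Quotient.mk K)) := by
    intro i
    -- The additive law is an identity in two independent sets of variables, tested on pairs of
    -- families, i.e. on solutions of the doubled system.
    have hD : ∀ e, (FrobRel.addBlock (fun k => k.1 = i) G - (FrobRel.leftVars G +
        FrobRel.swapBlock (fun k => k.1 = i) G)).coeff e ∈ K := by
      refine coeff_mem_of_forall_eval₂_eq_zero hp.out.one_lt (doubleL (prodL c)) K
        (sub_mem (FrobRel.addBlock_mem_reduced _ hp.out.pos hGr)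
          (add_mem (FrobRel.leftVars_mem_reduced hp.out.pos hGr)
            (FrobRel.swapBlock_mem_reduced _ hp.out.pos hGr))) fun T hT t ht => ?_
      obtain ⟨ht1, ht2⟩ := (sum_doubleL (underHom T) (prodL c) t).1 ht
      obtain ⟨a, ha⟩ := prodCoord_surjective c T _ ht1
      obtain ⟨b, hb⟩ := prodCoord_surjective c T _ ht2
      rw [MvPolynomial.eval₂_sub, MvPolynomial.eval₂_add, FrobRel.eval₂_addBlock,
        FrobRel.eval₂_leftVars, FrobRel.eval₂_swapBlock]
      have e1 : (fun k : Σ i, τ i => t (Sum.inl k) + if k.1 = i then t (Sum.inr k) else 0) =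
          prodCoord c T (Function.update a i (a i * b i)) := by
        funext k
        rw [prodCoord_update_mul, Function.update_eq_self, ha]
        congr 1
        split_ifs with h
        · rw [prodCoord_update, dif_pos h, ← congrFun hb k]
          subst h
          rfl
        · rfl
      have e2 : (fun k : Σ i, τ i => if k.1 = i then t (Sum.inr k) else t (Sum.inl k)) =
          prodCoord c T (Function.update a i (b i)) := by
        funext k
        rw [prodCoord_update]
        split_ifs with h
        · rw [← congrFun hb k]
          subst h
          rfl
        · rw [ha]
      rw [e1, e2, ← ha]
      have h1 := congrArg gmVal (f.map_mul T i a (a i) (b i))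
      rw [gmVal_mul, hGval, hGval, hGval, Function.update_eq_self] at h1
      -- The quadratic error of the multiplicative law; its coefficients lie in J * J ≤ K.
      have h2 := FrobRel.eval₂_mul_eval₂_eq_zero (F := G) (G := G) (underHom T)
        (prodCoord c T a) (prodCoord c T (Function.update a i (b i)))
        (fun e e' => hT _ (hKJ (Ideal.mul_mem_mul (hGJ e) (hGJ e'))))
      linear_combination h1 + h2
    rw [← FrobRel.map_addBlock, ← FrobRel.map_leftVars, ← FrobRel.map_swapBlock, ← sub_eq_zero,
      ← map_add, ← map_sub]
    ext e
    rw [MvPolynomial.coeff_map, MvPolynomial.coeff_zero]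
    exact Ideal.Quotient.eq_zero_iff_mem.2 (hD e)
  have h0 : (p : S ⧸ K) = 0 := by
    rw [← map_natCast (Ideal.Quotient.mk K), natCast_p_eq_zero_of_algebra p R S, map_zero]
  refine ⟨fun j => G.coeff (FrobRel.multiExp j), fun j => hGJ _, fun T hT a => ?_⟩
  rw [hGval, ← eval₂_multiExp]
  congr 1
  rw [← sub_eq_zero, ← MvPolynomial.eval₂_sub]
  refine FrobRel.eval₂_eq_zero_of_coeff _ _ fun e => hT _ ?_
  rw [MvPolynomial.coeff_sub, MvPolynomial.coeff_sum]
  simp only [MvPolynomial.coeff_monomial]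
  by_cases he : ∃ j : ∀ i, τ i, e = FrobRel.multiExp j
  · obtain ⟨j, rfl⟩ := he
    simp [FrobRel.multiExp_injective.eq_iff]
  · rw [Finset.sum_eq_zero, sub_zero]
    · by_contra hne
      apply he
      refine FrobRel.exists_multiExp_of_multiadditive hp.out h0
        (FrobRel.map_mem_reduced _ hGr) hadd (a := e) ?_
      rw [MvPolynomial.coeff_map]
      exact fun h => hne (Ideal.Quotient.eq_zero_iff_mem.1 h)
    · intro j _
      rw [if_neg]
      rintro rfl
      exact he ⟨j, rfl⟩

/-- Successive approximation along the powers of the ideal I generated by the coefficients of F - 1.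
Triviality under Frobenius makes I nilpotent, with x ^ p = 0 for all x in I. If f agrees with the
exponential product of y modulo I ^ (n + 1), the quotient of the two is 1 plus a multilinear form
with coefficients z modulo I ^ (n + 2), and y + z is the next approximation. -/
theorem exists_expPoly_eq (f : PolyAddOver A (Gm R) S) (hf : f.baseChange (frobHom p S) = 1) :
    ∃ y hy, expPoly c y hy = f := by
  classical
  obtain ⟨F, hF, hFf⟩ := exists_polynomial_of_polyAdd c f
  have hcoeff := (baseChange_eq_one_iff c (frobHom p S) hF hFf).1 hf
  have h0 : (p : S) = 0 := natCast_p_eq_zero_of_algebra p R S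
  let s : Set S := ↑((F - 1).support.image fun e => (F - 1).coeff e)
  have hs : ∀ x ∈ s, x ^ p = 0 := by
    intro x hx
    obtain ⟨e, -, rfl⟩ := Finset.mem_image.1 (Finset.mem_coe.1 hx)
    exact hcoeff e
  let I := Ideal.span s
  have hI : ∀ x ∈ I, x ^ p = 0 := fun x hx => pow_eq_zero_of_mem_span h0 hs hx
  have key : ∀ n : ℕ, ∃ y : (∀ i, τ i) → S, (∀ j, y j ∈ I) ∧ ∀ T : Under S,
      (∀ x ∈ I ^ (n + 1), underHom T x = 0) → ∀ a, gmVal (f.toFun T a) =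
        ∏ j, truncExp p (underHom T (y j) * multiCoord c T a j) := by
    intro n
    induction n with
    | zero =>
      -- Modulo I every coefficient of F - 1 dies, so f is trivial and y = 0 serves as the start.
      refine ⟨0, fun _ => zero_mem _, fun T hT a => ?_⟩
      rw [Finset.prod_eq_one fun j _ => by
        rw [Pi.zero_apply, map_zero, zero_mul, truncExp_zero (natCast_under p T)]]
      rw [hFf, ← sub_eq_zero, ← MvPolynomial.eval₂_one (underHom T) (prodCoord c T a),
        ← MvPolynomial.eval₂_sub]
      refine FrobRel.eval₂_eq_zero_of_coeff _ _ fun e => ?_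
      by_cases he : e ∈ (F - 1).support
      · apply hT
        rw [zero_add, pow_one]
        exact Ideal.subset_span (Finset.mem_coe.2 (Finset.mem_image_of_mem _ he))
      · rw [MvPolynomial.notMem_support_iff.1 he, map_zero]
    | succ n ih =>
      obtain ⟨y, hyI, hy⟩ := ih
      have hyp : ∀ j, y j ^ p = 0 := fun j => hI _ (hyI j)
      -- The quotient of f by the current approximation is trivial modulo I ^ (n + 1), and the
      -- square of that ideal lies in I ^ (n + 2).
      obtain ⟨z, hzJ, hz⟩ := exists_multilinear_of_trivial_mod c (f * (expPoly c y hyp)⁻¹)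
        (I ^ (n + 1)) (I ^ (n + 1 + 1)) (by
          rw [← pow_add]
          exact Ideal.pow_le_pow_right (by lia)) (fun T hT a => by
          rw [PolyAddOver.mul_toFun, PolyAddOver.inv_toFun, ← gmVal_one]
          congr 1
          rw [mul_inv_eq_one]
          apply gmVal_injective
          rw [hy T hT, gmVal_expPoly])
      have hzI : ∀ j, z j ∈ I := fun j => Ideal.pow_le_self (Nat.succ_ne_zero n) (hzJ j)
      refine ⟨y + z, fun j => add_mem (hyI j) (hzI j), fun T hT a => ?_⟩
      have h1 : gmVal (f.toFun T a) = gmVal ((expPoly c y hyp).toFun T a) *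
          gmVal ((f * (expPoly c y hyp)⁻¹).toFun T a) := by
        rw [← gmVal_mul]
        simp
      rw [h1, hz T hT, gmVal_expPoly]
      simp only [Pi.add_apply, map_add]
      rw [prod_truncExp_add (natCast_under p T)]
      · intro j
        rw [← map_pow, hyp, map_zero]
      · intro i j
        rw [← map_mul]
        apply hT
        rw [pow_succ' I (n + 1)]
        exact Ideal.mul_mem_mul (hyI i) (hzJ j)
      · intro i j
        rw [← map_mul]
        apply hT
        rw [pow_succ' I (n + 1)]
        exact Ideal.mul_mem_mul (hzI i) (hzJ j)
  obtain ⟨n, hn⟩ := exists_pow_span_eq_bot (Finset.finite_toSet _) hs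
  obtain ⟨y, hyI, hy⟩ := key n
  refine ⟨y, fun j => hI _ (hyI j), polyAddOver_ext fun T a => ?_⟩
  rw [gmVal_expPoly, hy T]
  intro x hx
  have : x ∈ (⊥ : Ideal S) := hn ▸ Ideal.pow_le_pow_right (Nat.le_succ n) hx
  rw [Ideal.mem_bot.1 this, map_zero]

/-- Uniqueness along the same kind of filtration, with I generated by all y_j and y'_j. If the
differences lie in I ^ (n + 1), then modulo I ^ (n + 2) the quotient of the two maps is 1 + Σ (y_j -
y'_j) m_j, with m_j the multilinear monomials. This reduced polynomial therefore vanishes at all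
points modulo I ^ (n + 2), so its coefficients lie there. -/
theorem expPoly_injective {y y' : (∀ i, τ i) → S} (hy : ∀ j, y j ^ p = 0)
    (hy' : ∀ j, y' j ^ p = 0) (h : expPoly c y hy = expPoly c y' hy') : y = y' := by
  classical
  have h0 : (p : S) = 0 := natCast_p_eq_zero_of_algebra p R S
  let s : Set S := Set.range y ∪ Set.range y'
  have hs : ∀ x ∈ s, x ^ p = 0 := by
    rintro x (⟨j, rfl⟩ | ⟨j, rfl⟩)
    · exact hy j
    · exact hy' j
  let I := Ideal.span s
  have hyI : ∀ j, y j ∈ I := fun j => Ideal.subset_span (Or.inl ⟨j, rfl⟩)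
  have hyI' : ∀ j, y' j ∈ I := fun j => Ideal.subset_span (Or.inr ⟨j, rfl⟩)
  have key : ∀ n : ℕ, ∀ j, y j - y' j ∈ I ^ (n + 1) := by
    intro n
    induction n with
    | zero => intro j; simpa using sub_mem (hyI j) (hyI' j)
    | succ n ih =>
      have hzI : ∀ j, y j - y' j ∈ I := fun j => Ideal.pow_le_self (Nat.succ_ne_zero n) (ih j)
      have hG := coeff_mem_of_forall_eval₂_eq_zero hp.out.one_lt (prodL c) (I ^ (n + 1 + 1))
        (F := ∑ j, MvPolynomial.monomial (FrobRel.multiExp j) (y j - y' j))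
        (sum_mem fun j _ => FrobRel.monomial_multiExp_mem_reduced hp.out.one_lt j _)
        (fun T hT t ht => by
          obtain ⟨a, rfl⟩ := prodCoord_surjective c T t ht
          rw [eval₂_multiExp]
          have h1 := congrArg (fun f : PolyAddOver A (Gm R) S => gmVal (f.toFun T a)) h
          simp only [gmVal_expPoly] at h1
          have h2 : ∀ j, underHom T (y j) = underHom T (y' j) + underHom T (y j - y' j) := by
            intro j
            rw [← map_add, add_sub_cancel]
          simp only [h2] at h1
          rw [prod_truncExp_add (natCast_under p T)] at h1
          · rw [← gmVal_expPoly c y' hy'] at h1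
            exact left_eq_add.1 (((isUnit_gmVal _).mul_right_inj).1
              (h1.trans (mul_one _).symm)).symm
          · intro j
            rw [← map_pow, hy', map_zero]
          · intro i j
            rw [← map_mul]
            apply hT
            rw [pow_succ' I (n + 1)]
            exact Ideal.mul_mem_mul (hyI' i) (ih j)
          · intro i j
            rw [← map_mul]
            apply hT
            rw [pow_succ' I (n + 1)]
            exact Ideal.mul_mem_mul (hzI i) (ih j))
      intro j
      have := hG (FrobRel.multiExp j)
      rw [MvPolynomial.coeff_sum] at this
      simpa [MvPolynomial.coeff_monomial, FrobRel.multiExp_injective.eq_iff] using this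
  obtain ⟨n, hn⟩ := exists_pow_span_eq_bot ((Set.finite_range y).union (Set.finite_range y')) hs
  funext j
  have : y j - y' j ∈ (⊥ : Ideal S) := hn ▸ Ideal.pow_le_pow_right (Nat.le_succ n) (key n j)
  exact sub_eq_zero.1 (Ideal.mem_bot.1 this)

/-- Coordinates on the Frobenius kernel of the group of poly-additive maps to `𝔾_m`. -/
noncomputable def polyAddEquiv : {y : (∀ i, τ i) → S // ∀ j, y j ^ p = 0} ≃
    {f : PolyAddOver A (Gm R) S // f.baseChange (frobHom p S) = 1} :=
  Equiv.ofBijective (fun y => ⟨expPoly c y.1 y.2, baseChange_frobHom_expPoly c y.1 y.2⟩)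
    ⟨fun y y' h => Subtype.ext (expPoly_injective c y.2 y'.2 (congrArg Subtype.val h)), fun f => by
      obtain ⟨y, hy, h⟩ := exists_expPoly_eq c f.1 f.2
      exact ⟨⟨y, hy⟩, Subtype.ext h⟩⟩

end Chart

/-! ### Homomorphisms to `𝔾_m` in coordinates -/

section HomPoly

variable {R : Type u} [CommRing R]

/-- A homomorphism as a poly-additive map of one variable. -/
def HomOver.toPoly {A : GrpFunctor.{u, v} R} {G : GrpFunctor.{u, w} R} {S : CommAlgCat.{u} R}
    (h : HomOver A G S) : PolyAddOver (fun _ : Unit => A) G S where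
  toFun T a := h.toFun T (a ())
  naturality f a := h.naturality f (a ())
  map_mul T i a x y := by simp [h.map_mul]

/-- A poly-additive map of one variable as a homomorphism. -/
def HomOver.ofPoly {A : GrpFunctor.{u, v} R} {G : GrpFunctor.{u, w} R} {S : CommAlgCat.{u} R}
    (h : PolyAddOver (fun _ : Unit => A) G S) : HomOver A G S where
  toFun T a := h.toFun T fun _ => a
  naturality f a := h.naturality f fun _ => a
  map_mul T a b := by
    have := h.map_mul T () (fun _ => a) a b
    have e : ∀ c : A.obj T.right, Function.update (fun _ : Unit => a) () c = fun _ => c := by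
      intro c; funext i; simp
    rwa [e, e, e] at this

theorem HomOver.toPoly_injective {A : GrpFunctor.{u, v} R} {G : GrpFunctor.{u, w} R}
    {S : CommAlgCat.{u} R} : Function.Injective (HomOver.toPoly (A := A) (G := G) (S := S)) := by
  intro h h' e
  have := congrArg HomOver.ofPoly e
  exact this

variable {p : ℕ} [hp : Fact p.Prime] [Algebra (ZMod p) R]

namespace Chart

variable {A : GrpFunctor.{u, u} R} {S : CommAlgCat.{u} R} {τ : Type} [Fintype τ] (c : Chart p A S τ)

theorem coord_one (T : Under S) (j : τ) : c.coord T 1 j = 0 := by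
  have := c.coord_mul T 1 1 j
  rw [mul_one] at this
  exact left_eq_add.1 this

include c in
/-- Homomorphisms to `𝔾_m` are killed by Frobenius. -/
theorem hom_baseChange_frobHom (h : HomOver A (Gm R) S) : h.baseChange (frobHom p S) = 1 := by
  classical
  apply HomOver.toPoly_injective
  change h.toPoly.baseChange (frobHom p S) = 1
  obtain ⟨F, hF, hFf⟩ := exists_polynomial_of_polyAdd (fun _ : Unit => c) h.toPoly
  rw [baseChange_eq_one_iff (fun _ : Unit => c) (frobHom p S) hF hFf]
  have hmul : ∀ (T : Under S) (a b : Unit → A.obj T.right),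
      gmVal (h.toPoly.toFun T fun i => a i * b i) =
        gmVal (h.toPoly.toFun T a) * gmVal (h.toPoly.toFun T b) := by
    intro T a b
    rw [← gmVal_mul]
    exact congrArg gmVal (h.map_mul T (a ()) (b ()))
  have h1 : F.coeff 0 = 1 := by
    let T : Under S := Under.mk (𝟙 S)
    have e1 := hFf T 1
    have e2 : prodCoord (fun _ : Unit => c) T 1 = 0 := by
      funext x
      exact c.coord_one T x.2
    have e3 : gmVal (h.toPoly.toFun T 1) = 1 := by
      have := h.map_mul T 1 1
      rw [mul_one] at this
      have h2 : h.toFun T 1 = 1 := left_eq_mul.1 this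
      exact congrArg gmVal h2
    rw [e2, e3] at e1
    have e4 : F.eval₂ (underHom T) 0 = MvPolynomial.constantCoeff F := by
      rw [MvPolynomial.eval₂_zero_apply]
      rfl
    rw [← MvPolynomial.constantCoeff_eq, ← e4]
    exact e1.symm
  -- Both sides are reduced polynomials in twice the variables, so the homomorphism law may be
  -- tested on pairs of points.
  have hid : FrobRel.addBlock (fun _ => True) F =
      FrobRel.leftVars F * FrobRel.swapBlock (fun _ => True) F := by
    refine eval₂_unique_of_reduced hp.out.one_lt (doubleL (prodL fun _ : Unit => c))
      (FrobRel.addBlock_mem_reduced _ hp.out.pos hF)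
      (FrobRel.leftVars_mul_swapBlock_mem_reduced hp.out.pos hF hF) fun T t ht => ?_
    obtain ⟨ht1, ht2⟩ := (sum_doubleL (underHom T) (prodL fun _ : Unit => c) t).1 ht
    obtain ⟨a, ha⟩ := prodCoord_surjective (fun _ : Unit => c) T _ ht1
    obtain ⟨b, hb⟩ := prodCoord_surjective (fun _ : Unit => c) T _ ht2
    rw [MvPolynomial.eval₂_mul, FrobRel.eval₂_addBlock, FrobRel.eval₂_leftVars,
      FrobRel.eval₂_swapBlock]
    simp only [if_true]
    rw [← ha, ← hb, ← hFf, ← hFf, ← hmul, hFf]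
    congr 1
    funext x
    rw [← congrFun ha x, ← congrFun hb x]
    exact (c.coord_mul T (a ()) (b ()) x.2).symm
  have h0 : (p : S) = 0 := natCast_p_eq_zero_of_algebra p R S
  intro e
  rw [frobHom_apply_eq_zero_iff, MvPolynomial.coeff_sub, MvPolynomial.coeff_one]
  by_cases he : e = 0
  · subst he
    rw [if_pos rfl, h1, sub_self, zero_pow hp.out.ne_zero]
  · rw [if_neg (Ne.symm he), sub_zero]
    exact FrobRel.coeff_pow_eq_zero_of_grouplike hp.out h0 hF h1 hid he

end Chart

end HomPoly

/-! ### Coordinates on `A_{P,φ}` -/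

section FrobLinearChart

variable {p : ℕ} [hp : Fact p.Prime] {R : Type u} [CommRing R] [Algebra (ZMod p) R]
  {P : Type u} [AddCommMonoid P] [Module R P] (φ : P →ₛₗ[frob p R] P)

/-- The base change of a `p`-linear map, `s ⊗ x ↦ s ^ p ⊗ φ(x)`. -/
noncomputable def baseChangeFrob (S : Type u) [CommRing S] [Algebra R S] :
    S ⊗[R] P →ₗ[R] FrobPull p (S ⊗[R] P) :=
  TensorProduct.lift (LinearMap.mk₂ R (fun s x => ((s ^ p) ⊗ₜ[R] φ x : S ⊗[R] P))
    (fun s s' x => by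
      rw [add_pow_p_of_commute p (natCast_p_eq_zero_of_algebra p R S) (Commute.all s s'),
        TensorProduct.add_tmul]
      rfl)
    (fun r s x => by
      rw [smul_pow]
      exact (TensorProduct.smul_tmul' (r ^ p) (s ^ p) (φ x)).symm)
    (fun s x y => by rw [map_add, TensorProduct.tmul_add]; rfl)
    (fun r s x => by
      rw [LinearMap.map_smulₛₗ, TensorProduct.tmul_smul]
      rfl))

theorem baseChangeFrob_tmul (S : Type u) [CommRing S] [Algebra R S] (s : S) (x : P) :
    baseChangeFrob φ S (s ⊗ₜ x) = ((s ^ p) ⊗ₜ[R] φ x : S ⊗[R] P) := rfl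

theorem baseChangeFrob_smul (S : Type u) [CommRing S] [Algebra R S] (s : S) (z : S ⊗[R] P) :
    (show S ⊗[R] P from baseChangeFrob φ S (s • z)) =
      s ^ p • (show S ⊗[R] P from baseChangeFrob φ S z) := by
  induction z with
  | zero =>
    rw [smul_zero, map_zero]
    exact (smul_zero (A := S ⊗[R] P) (s ^ p)).symm
  | add x y hx hy =>
    rw [smul_add, map_add, map_add]
    exact (congrArg₂ (· + ·) hx hy).trans (smul_add (A := S ⊗[R] P) (s ^ p) _ _).symm
  | tmul s' x =>
    rw [TensorProduct.smul_tmul', baseChangeFrob_tmul, baseChangeFrob_tmul, smul_eq_mul, mul_pow]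
    rfl

variable {S : CommAlgCat.{u} R}

/-- The extension of a linear map `P → T` to `S ⊗ P`. -/
noncomputable def liftPt (T : Under S) (ξ : P →ₗ[R] T.right) : S ⊗[R] P →ₗ[R] T.right :=
  TensorProduct.lift ((LinearMap.mul R T.right).compl₁₂
    ((show S ⟶ T.right from T.hom).hom : S →ₐ[R] T.right).toLinearMap ξ)

theorem liftPt_tmul (T : Under S) (ξ : P →ₗ[R] T.right) (s : S) (x : P) :
    liftPt T ξ (s ⊗ₜ x) = underHom T s * ξ x := rfl

theorem liftPt_smul (T : Under S) (ξ : P →ₗ[R] T.right) (s : S) (z : S ⊗[R] P) :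
    liftPt T ξ (s • z) = underHom T s * liftPt T ξ z := by
  induction z with
  | zero => simp
  | add x y hx hy => rw [smul_add, map_add, map_add, hx, hy, mul_add]
  | tmul s' x => rw [TensorProduct.smul_tmul', liftPt_tmul, liftPt_tmul, smul_eq_mul, map_mul,
      mul_assoc]

theorem liftPt_baseChangeFrob (T : Under S) (ξ : P →ₗ[R] T.right) (hξ : ∀ x, ξ (φ x) = ξ x ^ p)
    (z : S ⊗[R] P) : liftPt T ξ (show S ⊗[R] P from baseChangeFrob φ S z) = liftPt T ξ z ^ p := by
  induction z with
  | zero => simp [zero_pow hp.out.ne_zero]; exact map_zero (liftPt T ξ)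
  | add x y hx hy =>
    rw [map_add, map_add, add_pow_p_of_commute p (natCast_p_eq_zero_of_algebra p R T.right)
      (Commute.all _ _), ← hx, ← hy]
    exact map_add (liftPt T ξ) _ _
  | tmul s x => rw [baseChangeFrob_tmul, liftPt_tmul, liftPt_tmul, hξ, mul_pow, map_pow]

variable {τ : Type} [Fintype τ] (b : Module.Basis τ S (S ⊗[R] P))

/-- The point of `A_{P,φ}` with given coordinates, as a linear map. -/
noncomputable def ofCoord (T : Under S) (t : τ → T.right) : P →ₗ[R] T.right where
  toFun x := ∑ j, underHom T (b.repr (1 ⊗ₜ x) j) * t j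
  map_add' x y := by
    simp only [TensorProduct.tmul_add, map_add, Finsupp.add_apply, add_mul, Finset.sum_add_distrib]
  map_smul' r x := by
    have h : (1 : S) ⊗ₜ[R] (r • x) = algebraMap R S r • ((1 : S) ⊗ₜ[R] x) := by
      rw [TensorProduct.tmul_smul, algebraMap_smul]
    have h2 : underHom T (algebraMap R S r) = algebraMap R T.right r :=
      AlgHom.commutes ((show S ⟶ T.right from T.hom).hom : S →ₐ[R] T.right) r
    simp only [h, map_smul, Finsupp.smul_apply, smul_eq_mul, map_mul, h2, RingHom.id_apply,
      Algebra.smul_def, mul_assoc, Finset.mul_sum]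

theorem liftPt_ofCoord (T : Under S) (t : τ → T.right) (z : S ⊗[R] P) :
    liftPt T (ofCoord b T t) z = ∑ j, underHom T (b.repr z j) * t j := by
  induction z with
  | zero => simp
  | add x y hx hy => simp only [map_add, hx, hy, Finsupp.add_apply, add_mul, Finset.sum_add_distrib]
  | tmul s x =>
    have h : s ⊗ₜ[R] x = s • ((1 : S) ⊗ₜ[R] x) := by
      rw [TensorProduct.smul_tmul', smul_eq_mul, mul_one]
    rw [liftPt_tmul, h]
    simp only [map_smul, Finsupp.smul_apply, smul_eq_mul, map_mul, mul_assoc, ← Finset.mul_sum]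
    rfl

theorem liftPt_eq_sum (T : Under S) (ξ : P →ₗ[R] T.right) (z : S ⊗[R] P) :
    liftPt T ξ z = ∑ j, underHom T (b.repr z j) * liftPt T ξ (b j) := by
  conv_lhs => rw [← b.sum_repr z]
  simp only [map_sum, liftPt_smul]

/-- A basis of `S ⊗ P` gives coordinates on `A_{P,φ}` over `S`. -/
noncomputable def frobLinearChart : Chart p (frobLinearGrp φ) S τ where
  l j k := b.repr (show S ⊗[R] P from baseChangeFrob φ S (b j)) k
  coord T ξ j := liftPt T (Multiplicative.toAdd ξ).1 (b j)
  coord_pow T ξ j := by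
    rw [← liftPt_baseChangeFrob φ T _ (Multiplicative.toAdd ξ).2, liftPt_eq_sum b]
  coord_mul T ξ η j := by
    have h : liftPt T ((Multiplicative.toAdd ξ).1 + (Multiplicative.toAdd η).1) =
        liftPt T (Multiplicative.toAdd ξ).1 + liftPt T (Multiplicative.toAdd η).1 := by
      ext s x
      exact mul_add _ _ _
    exact congrArg (fun f : S ⊗[R] P →ₗ[R] T.right => f (b j)) h
  coord_map {T T'} f ξ j := by
    have h : liftPt T' (f.right.hom.toLinearMap ∘ₗ (Multiplicative.toAdd ξ).1) =
        f.right.hom.toLinearMap ∘ₗ liftPt T (Multiplicative.toAdd ξ).1 := by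
      apply TensorProduct.ext'
      intro s x
      rw [liftPt_tmul, underHom_comp f]
      exact (map_mul f.right.hom _ _).symm
    exact congrArg (fun f : S ⊗[R] P →ₗ[R] T'.right => f (b j)) h
  coord_injective T ξ η h := by
    apply Subtype.ext
    change (Multiplicative.toAdd ξ).1 = (Multiplicative.toAdd η).1
    ext x
    have e : ∀ ζ : P →ₗ[R] T.right, ζ x = liftPt T ζ (1 ⊗ₜ x) := fun ζ => by
      rw [liftPt_tmul, map_one, one_mul]
    rw [e, e, liftPt_eq_sum b, liftPt_eq_sum b T (Multiplicative.toAdd η).1]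
    exact Finset.sum_congr rfl fun j _ => congrArg _ (congrFun h j)
  coord_surjective T t ht := by
    have hb : ∀ j, liftPt T (ofCoord b T t) (b j) = t j := by
      intro j
      classical
      rw [liftPt_ofCoord, Finset.sum_eq_single j]
      · simp
      · intro k _ hk
        simp [hk.symm]
      · simp
    -- Both sides are additive and p-semilinear in z. They agree on the basis by the equations on t,
    -- hence on all of S ⊗ P.
    have hz : ∀ z, liftPt T (ofCoord b T t) (show S ⊗[R] P from baseChangeFrob φ S z) =
        liftPt T (ofCoord b T t) z ^ p := by
      intro z
      have hz : z ∈ Submodule.span S (Set.range b) := by rw [b.span_eq]; trivial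
      induction hz using Submodule.span_induction with
      | mem z hz =>
        obtain ⟨j, rfl⟩ := hz
        rw [liftPt_ofCoord, hb, ht]
      | zero =>
        rw [map_zero, map_zero, zero_pow hp.out.ne_zero]
        exact map_zero (liftPt T (ofCoord b T t))
      | add x y _ _ hx hy =>
        rw [map_add, map_add, add_pow_p_of_commute p
          (natCast_p_eq_zero_of_algebra p R T.right) (Commute.all _ _), ← hx, ← hy]
        exact map_add (liftPt T (ofCoord b T t)) _ _
      | smul s x _ hx =>
        rw [baseChangeFrob_smul, liftPt_smul, liftPt_smul, hx, mul_pow, map_pow]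
    refine ⟨Multiplicative.ofAdd ⟨ofCoord b T t, fun x => ?_⟩, funext hb⟩
    have := hz (1 ⊗ₜ x)
    rw [baseChangeFrob_tmul] at this
    change liftPt T (ofCoord b T t) ((1 ^ p) ⊗ₜ φ x) = _ at this
    rwa [liftPt_tmul, liftPt_tmul, one_pow, map_one, one_mul, one_mul] at this

end FrobLinearChart

/-! ### Functoriality of poly-additive maps -/

section Comp

variable {R : Type u} [CommRing R]

/-- Composition of a homomorphism to `G` with a homomorphism of group functors. -/
def HomOver.comp {A A' : GrpFunctor.{u, v} R} {G : GrpFunctor.{u, w} R} {S : CommAlgCat.{u} R}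
    (h : HomOver A G S) (α : A' ⟶ A) : HomOver A' G S where
  toFun T a := h.toFun T ((α.app T.right).hom a)
  naturality {T T'} f a := by
    rw [← h.naturality]
    congr 1
    exact congrArg (fun g => g.hom a) (α.naturality f.right)
  map_mul T a b :=
    (congrArg (h.toFun T) (_root_.map_mul (α.app T.right).hom a b)).trans (h.map_mul T _ _)

/-- Composition of a poly-additive map with homomorphisms in the variables. -/
def PolyAddOver.comp {ι : Type} [DecidableEq ι] {A A' : ι → GrpFunctor.{u, v} R}
    {G : GrpFunctor.{u, w} R} {S : CommAlgCat.{u} R} (f : PolyAddOver A G S)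
    (α : ∀ i, A' i ⟶ A i) : PolyAddOver A' G S where
  toFun T a := f.toFun T fun i => ((α i).app T.right).hom (a i)
  naturality {T T'} g a := by
    rw [← f.naturality]
    congr 1
    funext i
    exact congrArg (fun g => g.hom (a i)) ((α i).naturality g.right)
  map_mul T i a x y := by
    have h : ∀ c, (fun j => ((α j).app T.right).hom (Function.update a i c j)) =
        Function.update (fun j => ((α j).app T.right).hom (a j)) i (((α i).app T.right).hom c) := by
      intro c
      funext j
      exact Function.apply_update (fun j (c : (A' j).obj T.right) => ((α j).app T.right).hom c)
        a i c j
    rw [h, h, h]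
    exact (congrArg (fun c => f.toFun T (Function.update _ i c))
      (_root_.map_mul ((α i).app T.right).hom x y)).trans (f.map_mul T i _ _ _)

end Comp

/-! ### The dual of the tensor product: free modules first, then retracts -/

section PartOne

variable {p : ℕ} [hp : Fact p.Prime] {R : Type u} [CommRing R] [Algebra (ZMod p) R]

/-- The homomorphism `A_{Q,ψ} → A_{P,φ}` induced by an equivariant linear map `P → Q`. -/
def frobLinearMap {P Q : Type u} [AddCommMonoid P] [Module R P] [AddCommMonoid Q] [Module R Q]
    {φ : P →ₛₗ[frob p R] P} {ψ : Q →ₛₗ[frob p R] Q} (u : P →ₗ[R] Q) (hu : ∀ x, u (φ x) = ψ (u x)) :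
    frobLinearGrp ψ ⟶ frobLinearGrp φ where
  app S := CommGrpCat.ofHom
    { toFun := fun ξ => Multiplicative.ofAdd ⟨(Multiplicative.toAdd ξ).1 ∘ₗ u, fun x => by
        rw [LinearMap.comp_apply, hu, (Multiplicative.toAdd ξ).2]
        rfl⟩
      map_one' := rfl
      map_mul' := fun _ _ => rfl }

variable {ι : Type} [Fintype ι] [DecidableEq ι]
  {P Q : ι → Type u} [∀ i, AddCommMonoid (P i)] [∀ i, Module R (P i)]
  [∀ i, AddCommMonoid (Q i)] [∀ i, Module R (Q i)]
  (φ : ∀ i, P i →ₛₗ[frob p R] P i) (ψ : ∀ i, Q i →ₛₗ[frob p R] Q i)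

variable {φ ψ} in
theorem map_tensorPLinear (u : ∀ i, P i →ₗ[R] Q i) (hu : ∀ i x, u i (φ i x) = ψ i (u i x))
    (x : PiTensorProduct R P) : PiTensorProduct.map u (tensorPLinear φ x) =
      tensorPLinear ψ (PiTensorProduct.map u x) := by
  induction x using PiTensorProduct.induction_on with
  | smul_tprod r x =>
    rw [LinearMap.map_smulₛₗ, tensorPLinear_tprod, map_smul, map_smul, LinearMap.map_smulₛₗ,
      PiTensorProduct.map_tprod, PiTensorProduct.map_tprod, tensorPLinear_tprod]
    simp only [hu]
  | add x y hx hy => rw [map_add, map_add, map_add, map_add, hx, hy]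

/-- The map on `S`-points underlying `dualToPolyAdd`. -/
def dualToPoly {S : CommAlgCat.{u} R} (h : HomOver (frobLinearGrp (tensorPLinear φ)) (Gm R) S) :
    PolyAddOver (fun i => frobLinearGrp (φ i)) (Gm R) S :=
  ((dualToPolyAdd φ).app S).hom h

theorem dualToPoly_toFun {S : CommAlgCat.{u} R}
    (h : HomOver (frobLinearGrp (tensorPLinear φ)) (Gm R) S) (T : Under S) (ξ) :
    (dualToPoly φ h).toFun T ξ = h.toFun T (tensorPoint φ T.right ξ) := rfl

theorem dualToPoly_baseChange {S S' : CommAlgCat.{u} R} (g : S ⟶ S')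
    (h : HomOver (frobLinearGrp (tensorPLinear φ)) (Gm R) S) :
    (dualToPoly φ h).baseChange g = dualToPoly φ (h.baseChange g) := rfl

/-- `dualToPolyAdd` identifies the source with the Frobenius kernel of the target. -/
def IsDualIso : Prop :=
  ∀ S : CommAlgCat.{u} R, Function.Injective (dualToPoly φ (S := S)) ∧
    ∀ f : PolyAddOver (fun i => frobLinearGrp (φ i)) (Gm R) S,
      f.baseChange (frobHom p S) = 1 ↔ ∃ h, dualToPoly φ h = f

variable {φ ψ} in
theorem dualToPoly_comp (u : ∀ i, P i →ₗ[R] Q i) (hu : ∀ i x, u i (φ i x) = ψ i (u i x))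
    {S : CommAlgCat.{u} R} (h : HomOver (frobLinearGrp (tensorPLinear φ)) (Gm R) S) :
    dualToPoly ψ (h.comp (frobLinearMap (PiTensorProduct.map u) (map_tensorPLinear u hu))) =
      (dualToPoly φ h).comp fun i => frobLinearMap (u i) (hu i) := by
  ext T ξ
  change h.toFun T _ = h.toFun T _
  congr 1
  apply Subtype.ext
  apply PiTensorProduct.ext
  ext x
  change tensorLinear (S := T.right) _ (PiTensorProduct.map u (PiTensorProduct.tprod R x)) =
    tensorLinear (S := T.right) _ (PiTensorProduct.tprod R x)
  rw [PiTensorProduct.map_tprod, tensorLinear_tprod, tensorLinear_tprod]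
  rfl

variable {φ ψ} in
-- `dualToPoly` commutes with pullback along equivariant linear maps. Pulling back along u, then v,
-- is the identity on both sides, so bijectivity onto the Frobenius kernel descends from ψ to φ.
theorem IsDualIso.of_retract (u : ∀ i, P i →ₗ[R] Q i) (hu : ∀ i x, u i (φ i x) = ψ i (u i x))
    (v : ∀ i, Q i →ₗ[R] P i) (hv : ∀ i x, v i (ψ i x) = φ i (v i x))
    (hvu : ∀ i, v i ∘ₗ u i = LinearMap.id) (H : IsDualIso ψ) : IsDualIso φ := by
  intro S
  have key : ∀ h : HomOver (frobLinearGrp (tensorPLinear φ)) (Gm R) S,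
      (h.comp (frobLinearMap (PiTensorProduct.map u) (map_tensorPLinear u hu))).comp
        (frobLinearMap (PiTensorProduct.map v) (map_tensorPLinear v hv)) = h := by
    intro h
    ext T ξ
    change h.toFun T _ = h.toFun T _
    congr 1
    apply Subtype.ext
    change ((Multiplicative.toAdd ξ).1 ∘ₗ PiTensorProduct.map v) ∘ₗ PiTensorProduct.map u = _
    rw [LinearMap.comp_assoc, ← PiTensorProduct.map_comp]
    simp only [hvu]
    have : PiTensorProduct.map (R := R) (fun i => (LinearMap.id : P i →ₗ[R] P i)) = LinearMap.id :=
      PiTensorProduct.map_id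
    rw [this, LinearMap.comp_id]
    rfl
  have key2 : ∀ {S' : CommAlgCat.{u} R} (f : PolyAddOver (fun i => frobLinearGrp (φ i)) (Gm R) S'),
      (f.comp fun i => frobLinearMap (u i) (hu i)).comp
        (fun i => frobLinearMap (v i) (hv i)) = f := by
    intro S' f
    ext T ξ
    change f.toFun T _ = f.toFun T _
    congr 1
    funext i
    apply Subtype.ext
    change ((Multiplicative.toAdd (ξ i)).1 ∘ₗ v i) ∘ₗ u i = _
    rw [LinearMap.comp_assoc, hvu, LinearMap.comp_id]
    rfl
  refine ⟨fun h h' e => ?_, fun f => ⟨fun hf => ?_, ?_⟩⟩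
  · have e2 := congrArg (fun f : PolyAddOver (fun i => frobLinearGrp (φ i)) (Gm R) S =>
      f.comp fun i => frobLinearMap (u i) (hu i)) e
    simp only [← dualToPoly_comp] at e2
    rw [← key h, ← key h', (H S).1 e2]
  · obtain ⟨h, hh⟩ := ((H S).2 (f.comp fun i => frobLinearMap (u i) (hu i))).1 (by
      change (f.baseChange (frobHom p S)).comp _ = 1
      rw [hf]
      rfl)
    refine ⟨h.comp (frobLinearMap (PiTensorProduct.map v) (map_tensorPLinear v hv)), ?_⟩
    rw [dualToPoly_comp v hv, hh, key2]
  · rintro ⟨h, rfl⟩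
    have h1 := ((H S).2 _).2 ⟨h.comp (frobLinearMap (PiTensorProduct.map u)
      (map_tensorPLinear u hu)), rfl⟩
    rw [dualToPoly_comp u hu] at h1
    rw [← key2 ((dualToPoly φ h).baseChange (frobHom p S))]
    change (((dualToPoly φ h).comp fun i => frobLinearMap (u i) (hu i)).baseChange
      (frobHom p S)).comp _ = 1
    rw [h1]
    rfl

/-- The coordinates on `A_{P,φ}` over `S` given by a basis of `P`. -/
noncomputable def basisChart {P : Type u} [AddCommMonoid P] [Module R P] (φ : P →ₛₗ[frob p R] P)
    {τ : Type} [Fintype τ] (b : Module.Basis τ R P) (S : CommAlgCat.{u} R) :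
    Chart p (frobLinearGrp φ) S τ :=
  frobLinearChart φ (Algebra.TensorProduct.basis S b)

theorem basisChart_coord {P : Type u} [AddCommMonoid P] [Module R P] (φ : P →ₛₗ[frob p R] P)
    {τ : Type} [Fintype τ] (b : Module.Basis τ R P) {S : CommAlgCat.{u} R} (T : Under S)
    (ξ : (frobLinearGrp φ).obj T.right) (j : τ) :
    (basisChart φ b S).coord T ξ j = (Multiplicative.toAdd ξ).1 (b j) := by
  change liftPt T (Multiplicative.toAdd ξ).1 (Algebra.TensorProduct.basis S b j) = _
  rw [Algebra.TensorProduct.basis_apply, liftPt_tmul, map_one, one_mul]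

/-- The coordinates of A_{P,φ} in the tensor basis pull back to the multilinear monomials on ∏
A_{P_i,φ_i}. A character ∏ E(y_j t_j) is therefore sent to the exponential product with the same
parameters y. Every character has this form because characters are killed by Frobenius. -/
theorem isDualIso_of_basis {τ : ι → Type} [∀ i, Fintype (τ i)]
    (b : ∀ i, Module.Basis (τ i) R (P i)) : IsDualIso φ := by
  classical
  intro S
  let c : ∀ i, Chart p (frobLinearGrp (φ i)) S (τ i) := fun i => basisChart (φ i) (b i) S
  let d : Chart p (frobLinearGrp (tensorPLinear φ)) S (∀ i, τ i) :=
    basisChart (tensorPLinear φ) (Basis.piTensorProduct b) S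
  have hdc : ∀ (T : Under S) (ξ : ∀ i, (frobLinearGrp (φ i)).obj T.right) (j : ∀ i, τ i),
      d.coord T (tensorPoint φ T.right ξ) j = Chart.multiCoord c T ξ j := by
    intro T ξ j
    rw [basisChart_coord, Basis.piTensorProduct_apply, Chart.multiCoord]
    refine (tensorLinear_tprod (S := T.right) _ _).trans ?_
    exact Finset.prod_congr rfl fun i _ => (basisChart_coord (φ i) (b i) T (ξ i) (j i)).symm
  have hexp : ∀ (y : (Unit → ∀ i, τ i) → S) (hy : ∀ j, y j ^ p = 0),
      dualToPoly φ (HomOver.ofPoly (Chart.expPoly (fun _ : Unit => d) y hy)) =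
        Chart.expPoly c (fun j => y fun _ => j) (fun j => hy fun _ => j) := by
    intro y hy
    refine Chart.polyAddOver_ext fun T ξ => ?_
    rw [dualToPoly_toFun]
    change gmVal ((Chart.expPoly (fun _ : Unit => d) y hy).toFun T fun _ => _) = _
    rw [Chart.gmVal_expPoly, Chart.gmVal_expPoly]
    refine Fintype.prod_equiv (Equiv.funUnique Unit (∀ i, τ i)) _ _ fun j => ?_
    rw [← hdc, Chart.multiCoord]
    simp only [Finset.univ_unique, Finset.prod_singleton]
    rfl
  have hform : ∀ h : HomOver (frobLinearGrp (tensorPLinear φ)) (Gm R) S,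
      ∃ y hy, HomOver.ofPoly (Chart.expPoly (fun _ : Unit => d) y hy) = h := by
    intro h
    obtain ⟨y, hy, e⟩ := Chart.exists_expPoly_eq (fun _ : Unit => d) h.toPoly
      (congrArg HomOver.toPoly (d.hom_baseChange_frobHom h))
    exact ⟨y, hy, congrArg HomOver.ofPoly e⟩
  refine ⟨fun h h' e => ?_, fun f => ⟨fun hf => ?_, ?_⟩⟩
  · obtain ⟨y, hy, rfl⟩ := hform h
    obtain ⟨y', hy', rfl⟩ := hform h'
    rw [hexp, hexp] at e
    have e2 := Chart.expPoly_injective c _ _ e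
    have : y = y' := funext fun j => congrFun e2 (j ())
    subst this
    rfl
  · obtain ⟨y, hy, rfl⟩ := Chart.exists_expPoly_eq c f hf
    exact ⟨HomOver.ofPoly (Chart.expPoly (fun _ : Unit => d) (fun j => y (j ()))
      (fun j => hy (j ()))), hexp _ _⟩
  · rintro ⟨h, rfl⟩
    rw [dualToPoly_baseChange, d.hom_baseChange_frobHom]
    rfl

/-- A finitely generated projective module with a `p`-linear map is an equivariant retract of a
free one. -/
theorem exists_free_retract {P : Type u} [AddCommGroup P] [Module R P] [Module.Finite R P]
    [Module.Projective R P] (φ : P →ₛₗ[frob p R] P) :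
    ∃ (n : ℕ) (ψ : (Fin n → R) →ₛₗ[frob p R] (Fin n → R)) (u : P →ₗ[R] (Fin n → R))
      (v : (Fin n → R) →ₗ[R] P), (∀ x, u (φ x) = ψ (u x)) ∧ (∀ x, v (ψ x) = φ (v x)) ∧
        v ∘ₗ u = LinearMap.id := by
  obtain ⟨n, v, hv⟩ := Module.Finite.exists_fin' R P
  obtain ⟨u, hu⟩ := Module.projective_lifting_property v LinearMap.id hv
  have h : ∀ x, v (u x) = x := fun x => LinearMap.congr_fun hu x
  -- With v ∘ u = id, the map ψ = u φ v extends φ from the summand u(P) and vanishes on the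
  -- complement ker v.
  refine ⟨n, u.comp (φ.comp v), u, v, fun x => ?_, fun x => ?_, hu⟩
  · simp [h]
  · simp [h]

theorem isDualIso_of_projective {P : ι → Type u} [∀ i, AddCommGroup (P i)] [∀ i, Module R (P i)]
    [∀ i, Module.Finite R (P i)] [∀ i, Module.Projective R (P i)]
    (φ : ∀ i, P i →ₛₗ[frob p R] P i) : IsDualIso φ := by
  choose n ψ u v hu hv hvu using fun i => exists_free_retract (φ i)
  exact IsDualIso.of_retract u hu v hv hvu
    (isDualIso_of_basis ψ fun i => Pi.basisFun R (Fin (n i)))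

theorem IsDualIso.exists_iso {φ : ∀ i, P i →ₛₗ[frob p R] P i} (H : IsDualIso φ) :
    ∃ e : cartierDual (frobLinearGrp (tensorPLinear φ)) ≅
        frobKernel p (polyAdd (fun i => frobLinearGrp (φ i)) (Gm R)),
      e.hom ≫ frobKernelInclusion p (polyAdd (fun i => frobLinearGrp (φ i)) (Gm R)) =
        dualToPolyAdd φ := by
  let f : ∀ S : CommAlgCat.{u} R, (cartierDual (frobLinearGrp (tensorPLinear φ))).obj S →*
      frobKernelSubgroup p (polyAdd (fun i => frobLinearGrp (φ i)) (Gm R)) S := fun S =>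
    ((dualToPolyAdd φ).app S).hom.codRestrict _ fun h => ((H S).2 _).2 ⟨h, rfl⟩
  have hf : ∀ S, Function.Bijective (f S) := fun S =>
    ⟨fun h h' e => (H S).1 (congrArg Subtype.val e), fun y => by
      obtain ⟨h, hh⟩ := ((H S).2 y.1).1 y.2
      exact ⟨h, Subtype.ext hh⟩⟩
  refine ⟨NatIso.ofComponents (fun S => (MulEquiv.ofBijective (f S) (hf S)).toCommGrpIso) ?_, ?_⟩
  · intro S T g
    rfl
  · rfl

end PartOne

/-! ### Representable group functors -/

section Representable

variable {R : Type u} [CommRing R]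

/-- A bijection between the points of the group functor `F` and the points of `Spec C`. -/
structure GrpRepr (F : GrpFunctor.{u, v} R) (C : Type u) [CommRing C] [Algebra R C] where
  equiv : ∀ S : CommAlgCat.{u} R, (C →ₐ[R] S) ≃ F.obj S
  naturality : ∀ {S T : CommAlgCat.{u} R} (f : S ⟶ T) (x : C →ₐ[R] S),
    equiv T (f.hom.comp x) = (F.map f).hom (equiv S x)

namespace GrpRepr

variable {F : GrpFunctor.{u, v} R} {C : Type u} [CommRing C] [Algebra R C] (E : GrpRepr F C)

/-- The group element attached to an algebra map. -/
def pt {S : Type u} [CommRing S] [Algebra R S] (x : C →ₐ[R] S) : F.obj (CommAlgCat.of R S) :=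
  E.equiv (CommAlgCat.of R S) x

theorem pt_injective {S : Type u} [CommRing S] [Algebra R S] :
    Function.Injective (E.pt (S := S)) := (E.equiv (CommAlgCat.of R S)).injective

theorem pt_comp {S T : Type u} [CommRing S] [Algebra R S] [CommRing T] [Algebra R T]
    (f : S →ₐ[R] T) (x : C →ₐ[R] S) :
    E.pt (f.comp x) = (F.map (CommAlgCat.ofHom f)).hom (E.pt x) :=
  E.naturality (CommAlgCat.ofHom f) x

/-- The comultiplication given by the group law. -/
noncomputable def comulHom : C →ₐ[R] C ⊗[R] C :=
  (E.equiv (CommAlgCat.of R (C ⊗[R] C))).symm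
    (E.pt Algebra.TensorProduct.includeLeft * E.pt Algebra.TensorProduct.includeRight)

/-- The counit given by the unit section. -/
noncomputable def counitHom : C →ₐ[R] R := (E.equiv (CommAlgCat.of R R)).symm 1

/-- The antipode given by the inverse. -/
noncomputable def antipodeHom : C →ₐ[R] C :=
  (E.equiv (CommAlgCat.of R C)).symm (E.pt (AlgHom.id R C))⁻¹

theorem pt_comulHom : E.pt E.comulHom =
    E.pt Algebra.TensorProduct.includeLeft * E.pt Algebra.TensorProduct.includeRight :=
  Equiv.apply_symm_apply _ _

theorem pt_counitHom : E.pt E.counitHom = 1 := Equiv.apply_symm_apply _ _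

theorem pt_antipodeHom : E.pt E.antipodeHom = (E.pt (AlgHom.id R C))⁻¹ :=
  Equiv.apply_symm_apply _ _

variable {S : Type u} [CommRing S] [Algebra R S]

/-- Yoneda form of the definition of the comultiplication. Together with `pt_injective` it reduces
the Hopf algebra axioms to the group axioms. -/
theorem pt_comp_comulHom (g : C ⊗[R] C →ₐ[R] S) : E.pt (g.comp E.comulHom) =
    E.pt (g.comp Algebra.TensorProduct.includeLeft) *
      E.pt (g.comp Algebra.TensorProduct.includeRight) := by
  rw [pt_comp, pt_comulHom, map_mul, ← pt_comp, ← pt_comp]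

theorem pt_comp_counitHom (g : R →ₐ[R] S) : E.pt (g.comp E.counitHom) = 1 := by
  rw [pt_comp, pt_counitHom, map_one]

theorem lift_antipodeHom_left :
    (Algebra.TensorProduct.lift E.antipodeHom (.id R C) fun _ _ => Commute.all _ _).comp
      E.comulHom = (Algebra.ofId R C).comp E.counitHom := by
  apply E.pt_injective
  rw [pt_comp_comulHom, pt_comp_counitHom, Algebra.TensorProduct.lift_comp_includeLeft]
  have h := Algebra.TensorProduct.lift_comp_includeRight E.antipodeHom (AlgHom.id R C)
    fun _ _ => Commute.all _ _
  exact (congrArg (E.pt E.antipodeHom * E.pt ·) h).trans (by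
    rw [pt_antipodeHom, inv_mul_cancel])

theorem lift_antipodeHom_right :
    (Algebra.TensorProduct.lift (.id R C) E.antipodeHom fun _ _ => Commute.all _ _).comp
      E.comulHom = (Algebra.ofId R C).comp E.counitHom := by
  apply E.pt_injective
  rw [pt_comp_comulHom, pt_comp_counitHom, Algebra.TensorProduct.lift_comp_includeLeft]
  have h := Algebra.TensorProduct.lift_comp_includeRight (AlgHom.id R C) E.antipodeHom
    fun _ _ => Commute.all _ _
  exact (congrArg (E.pt (AlgHom.id R C) * E.pt ·) h).trans (by
    rw [pt_antipodeHom, mul_inv_cancel])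

/-- The Hopf algebra structure on an algebra representing a group functor. -/
@[reducible] noncomputable def hopfAlgebra : HopfAlgebra R C :=
  letI : Bialgebra R C := Bialgebra.ofAlgHom E.comulHom E.counitHom
    (by
      apply E.pt_injective
      rw [← AlgHom.comp_assoc, pt_comp_comulHom, pt_comp_comulHom]
      have h1 : ((Algebra.TensorProduct.assoc R R R C C C).toAlgHom.comp
          (Algebra.TensorProduct.map E.comulHom (.id R C))).comp
          Algebra.TensorProduct.includeLeft =
          ((Algebra.TensorProduct.assoc R R R C C C).toAlgHom.comp
            Algebra.TensorProduct.includeLeft).comp E.comulHom := by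
        ext c; simp
      have h2 : (Algebra.TensorProduct.map (.id R C) E.comulHom).comp
          Algebra.TensorProduct.includeRight =
          (Algebra.TensorProduct.includeRight (A := C) (B := C ⊗[R] C)).comp E.comulHom := by
        ext c; simp
      rw [h1, h2, pt_comp_comulHom, pt_comp_comulHom, mul_assoc]
      congr 1
      · congr 1; ext c; simp [Algebra.TensorProduct.one_def]
      · congr 1
        congr 1
        ext c
        simp [Algebra.TensorProduct.one_def])
    (by
      apply E.pt_injective
      rw [pt_comp_comulHom]
      have h1 : (Algebra.TensorProduct.map E.counitHom (.id R C)).comp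
          Algebra.TensorProduct.includeLeft =
          (Algebra.TensorProduct.includeLeft (A := R) (B := C)).comp E.counitHom := by
        ext c; simp
      rw [h1, pt_comp_counitHom, one_mul]
      congr 1; ext c; simp)
    (by
      apply E.pt_injective
      rw [pt_comp_comulHom]
      have h1 : (Algebra.TensorProduct.map (.id R C) E.counitHom).comp
          Algebra.TensorProduct.includeRight =
          (Algebra.TensorProduct.includeRight (A := C) (B := R)).comp E.counitHom := by
        ext c; simp
      rw [h1, pt_comp_counitHom, mul_one]
      congr 1; ext c; simp)
  HopfAlgebra.ofAlgHom E.antipodeHom E.lift_antipodeHom_left E.lift_antipodeHom_right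

/-- The flip of C ⊗ C exchanges the two universal points, and the group law is commutative. -/
theorem isCocomm : letI := E.hopfAlgebra; Coalgebra.IsCocomm R C := by
  let _ := E.hopfAlgebra
  refine ⟨?_⟩
  have : (Algebra.TensorProduct.comm R C C).toAlgHom.comp E.comulHom = E.comulHom := by
    apply E.pt_injective
    rw [pt_comp_comulHom, pt_comulHom, mul_comm]
    congr 1
  exact congrArg AlgHom.toLinearMap this

/-- The convolution of two points is a composite with `comulHom`, hence is their product in F by
`pt_comp_comulHom`. -/
theorem exists_iso : letI := E.hopfAlgebra; haveI := E.isCocomm;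
    Nonempty (GrpFunctorIso (specGrp R C) F) := by
  let _ := E.hopfAlgebra
  have := E.isCocomm
  refine ⟨⟨fun S => ⟨(WithConv.equiv _).trans (E.equiv S), ?_⟩, ?_⟩⟩
  · intro x y
    have h := E.pt_comp_comulHom (S := S) ((Algebra.TensorProduct.lmul' R).comp
      (Algebra.TensorProduct.map x.ofConv y.ofConv))
    refine Eq.trans ?_ (h.trans ?_)
    · rfl
    · congr 1
      all_goals congr 1; ext c; simp; rfl
  · intro S T f x
    exact E.naturality f x.ofConv

end GrpRepr

end Representable

/-! ### Retracts of representable functors -/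

section Retract

variable {R : Type u} [CommRing R]

/-- A retract of a representable functor is representable. -/
theorem GrpRepr.exists_of_retract {F : GrpFunctor.{u, v} R} {G : GrpFunctor.{u, w} R}
    {B : Type u} [CommRing B] [Algebra R B] (E : GrpRepr G B)
    (s : ∀ S, F.obj S → G.obj S) (r : ∀ S, G.obj S → F.obj S)
    (hs : ∀ {S T : CommAlgCat.{u} R} (f : S ⟶ T) x, s T ((F.map f).hom x) = (G.map f).hom (s S x))
    (hr : ∀ {S T : CommAlgCat.{u} R} (f : S ⟶ T) x, r T ((G.map f).hom x) = (F.map f).hom (r S x))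
    (hrs : ∀ S x, r S (s S x) = x) :
    ∃ (C : Type u) (_ : CommRing C) (_ : Algebra R C), Nonempty (GrpRepr F C) := by
  -- By Yoneda the idempotent s ∘ r of G is an idempotent endomorphism e of B; the range of e
  -- represents F.
  let e : B →ₐ[R] B := (E.equiv (CommAlgCat.of R B)).symm (s _ (r _ (E.pt (AlgHom.id R B))))
  have he : ∀ (S : CommAlgCat.{u} R) (x : B →ₐ[R] S),
      E.equiv S (x.comp e) = s S (r S (E.equiv S x)) := by
    intro S x
    have h1 := E.naturality (S := CommAlgCat.of R B) (CommAlgCat.ofHom x) e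
    have h2 := E.naturality (S := CommAlgCat.of R B) (CommAlgCat.ofHom x) (AlgHom.id R B)
    refine h1.trans ?_
    rw [Equiv.apply_symm_apply, ← hs, ← hr]
    exact congrArg (fun z => s S (r S z)) h2.symm
  have hee : e.comp e = e := by
    apply (E.equiv (CommAlgCat.of R B)).injective
    rw [he, Equiv.apply_symm_apply, hrs]
  let e' : B →ₐ[R] e.range := e.rangeRestrict
  have h1 : e.range.val.comp e' = e := AlgHom.val_comp_rangeRestrict e
  have h2 : e'.comp e.range.val = AlgHom.id R e.range := by
    ext ⟨_, b, rfl⟩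
    exact DFunLike.congr_fun hee b
  refine ⟨e.range, inferInstance, inferInstance, ⟨⟨fun S =>
    { toFun := fun z => r S (E.equiv S (z.comp e'))
      invFun := fun g => ((E.equiv S).symm (s S g)).comp e.range.val
      left_inv := fun z => ?_
      right_inv := fun g => ?_ }, ?_⟩⟩⟩
  · have : (E.equiv S).symm (s S (r S (E.equiv S (z.comp e')))) = z.comp e' := by
      rw [Equiv.symm_apply_eq, ← he, AlgHom.comp_assoc]
      have h3 : e'.comp e = e' := by
        ext b
        exact DFunLike.congr_fun hee b
      rw [h3]
    simp only [this]
    rw [AlgHom.comp_assoc, h2, AlgHom.comp_id]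
  · simp only
    rw [AlgHom.comp_assoc, h1, he, Equiv.apply_symm_apply, hrs, hrs]
  · intro S T f z
    change r T (E.equiv T (f.hom.comp (z.comp e'))) = _
    rw [E.naturality, hr]
    rfl

end Retract

/-! ### The truncated polynomial ring -/

section Trunc

variable {p : ℕ} [hp : Fact p.Prime] {r : ℕ} {A : Type u} [CommRing A]

/-- The ring homomorphism out of the truncated polynomial ring with prescribed values. -/
noncomputable def truncEval {T : Type*} [CommRing T] (g : A →+* T) (y : Fin r → T)
    (hy : ∀ j, y j ^ p = 0) : TruncPoly p 1 r A →+* T :=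
  Ideal.Quotient.lift _ (MvPolynomial.eval₂Hom g y) (by
    intro a ha
    have hle : Ideal.span (Set.range fun i : Fin r =>
        (MvPolynomial.X i : MvPolynomial (Fin r) A) ^ p ^ 1) ≤
        RingHom.ker (MvPolynomial.eval₂Hom g y) := by
      rw [Ideal.span_le]
      rintro _ ⟨i, rfl⟩
      simp [RingHom.mem_ker, hy]
    exact hle ha)

/-- The coordinates of the truncated polynomial ring. -/
noncomputable def truncX (p : ℕ) (A : Type u) [CommRing A] (j : Fin r) : TruncPoly p 1 r A :=
  Ideal.Quotient.mk _ (MvPolynomial.X j)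

theorem truncX_pow (j : Fin r) : truncX p A j ^ p = 0 := by
  rw [truncX, ← map_pow, Ideal.Quotient.eq_zero_iff_mem]
  apply Ideal.subset_span
  exact ⟨j, by simp⟩

@[simp] theorem truncEval_truncX {T : Type*} [CommRing T] (g : A →+* T) (y : Fin r → T)
    (hy : ∀ j, y j ^ p = 0) (j : Fin r) : truncEval g y hy (truncX p A j) = y j := by
  change MvPolynomial.eval₂Hom g y (MvPolynomial.X j) = y j
  simp

@[simp] theorem truncEval_algebraMap {T : Type*} [CommRing T] (g : A →+* T) (y : Fin r → T)
    (hy : ∀ j, y j ^ p = 0) (a : A) :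
    truncEval g y hy (algebraMap A (TruncPoly p 1 r A) a) = g a := by
  change MvPolynomial.eval₂Hom g y (MvPolynomial.C a) = g a
  simp

theorem truncPoly_ringHom_ext {T : Type*} [CommRing T] {f g : TruncPoly p 1 r A →+* T}
    (h : ∀ a, f (algebraMap A _ a) = g (algebraMap A _ a))
    (hX : ∀ j, f (truncX p A j) = g (truncX p A j)) : f = g := by
  apply Ideal.Quotient.ringHom_ext
  apply MvPolynomial.ringHom_ext
  · exact h
  · exact hX

theorem truncPoly_algHom_ext {T : Type*} [CommRing T] [Algebra A T]
    {f g : TruncPoly p 1 r A →ₐ[A] T} (hX : ∀ j, f (truncX p A j) = g (truncX p A j)) : f = g :=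
  AlgHom.coe_ringHom_injective (truncPoly_ringHom_ext
    (fun a => (f.commutes a).trans (g.commutes a).symm) hX)

/-- The points of the spectrum of the truncated polynomial ring. -/
noncomputable def truncPoints {σ : Type} (e : σ ≃ Fin r) (T : Type*) [CommRing T] [Algebra A T] :
    (TruncPoly p 1 r A →ₐ[A] T) ≃ {y : σ → T // ∀ j, y j ^ p = 0} where
  toFun x := ⟨fun j => x (truncX p A (e j)), fun j => by
    rw [← map_pow, truncX_pow, map_zero]⟩
  invFun y :=
    { truncEval (algebraMap A T) (fun k => y.1 (e.symm k)) (fun k => y.2 _) with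
      commutes' := fun a => truncEval_algebraMap _ _ _ a }
  left_inv x := by
    refine truncPoly_algHom_ext fun j => ?_
    refine (truncEval_truncX (algebraMap A T) (fun k => x (truncX p A (e (e.symm k))))
      (fun k => by rw [← map_pow, truncX_pow, map_zero]) j).trans ?_
    rw [Equiv.apply_symm_apply]
  right_inv y := Subtype.ext (funext fun j => by
    refine (truncEval_truncX (algebraMap A T) (fun k => y.1 (e.symm k))
      (fun k => y.2 _) (e j)).trans ?_
    rw [Equiv.symm_apply_apply])

theorem truncAug_truncX (j : Fin r) : truncAug p 1 r A (truncX p A j) = 0 := by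
  change MvPolynomial.aeval (fun _ => (0 : A)) (MvPolynomial.X j) = 0
  simp

end Trunc

/-! ### Points of the Frobenius kernel of the functor of poly-additive maps -/

section Points

variable {p : ℕ} [hp : Fact p.Prime] {R : Type u} [CommRing R] [Algebra (ZMod p) R]

theorem Chart.coord_congr {A : GrpFunctor.{u, u} R} {S T : CommAlgCat.{u} R} {τ : Type} [Fintype τ]
    (c : Chart p A S τ) {f g : S ⟶ T} (h : f = g) (a : A.obj T) :
    c.coord (Under.mk f) a = c.coord (Under.mk g) a := by
  subst h; rfl

variable {ι : Type} [Fintype ι] [DecidableEq ι] {A : ι → GrpFunctor.{u, u} R}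
  {S : CommAlgCat.{u} R} {τ : ι → Type} [∀ i, Fintype (τ i)] (c : ∀ i, Chart p (A i) S (τ i))

/-- The description of the Frobenius kernel of `PolyAdd(∏ A_i, 𝔾_m)` by coordinates on the
`A_i`. -/
noncomputable def kernelPoint (T : Under S) :
    {y : (∀ i, τ i) → T.right // ∀ j, y j ^ p = 0} ≃ (frobKernel p (polyAdd A (Gm R))).obj T.right :=
  Chart.polyAddEquiv fun i => (c i).baseChange T.hom

theorem kernelPoint_map {T T' : Under S} (f : T ⟶ T')
    (y : {y : (∀ i, τ i) → T.right // ∀ j, y j ^ p = 0}) :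
    kernelPoint c T' ⟨fun j => f.right.hom (y.1 j), fun j => by rw [← map_pow, y.2, map_zero]⟩ =
      ((frobKernel p (polyAdd A (Gm R))).map f.right).hom (kernelPoint c T y) := by
  apply Subtype.ext
  change Chart.expPoly _ (fun j => f.right.hom (y.1 j)) (fun j => by rw [← map_pow, y.2, map_zero]) =
    (Chart.expPoly _ y.1 y.2).baseChange f.right
  rw [Chart.baseChange_expPoly]
  refine Chart.polyAddOver_ext fun U a => ?_
  rw [Chart.gmVal_expPoly, Chart.gmVal_expPoly]
  refine Finset.prod_congr rfl fun j _ => ?_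
  congr 2
  refine Finset.prod_congr rfl fun i _ => ?_
  refine congrFun ((c i).coord_congr (f := T'.hom ≫ U.hom) (g := T.hom ≫ f.right ≫ U.hom) ?_ (a i))
    (j i)
  rw [← Category.assoc, Under.w f]

theorem kernelPoint_zero (T : Under S) :
    kernelPoint c T ⟨0, fun _ => zero_pow hp.out.ne_zero⟩ = 1 :=
  Subtype.ext (Chart.expPoly_zero _)

/-- Coordinates over `R` represent the Frobenius kernel by a truncated polynomial ring. -/
theorem exists_repr_of_chart {r : ℕ} (c : ∀ i, Chart p (A i) (CommAlgCat.of R R) (τ i))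
    (e : (∀ i, τ i) ≃ Fin r) :
    Nonempty (GrpRepr (frobKernel p (polyAdd A (Gm R))) (TruncPoly p 1 r R)) := by
  let u : ∀ S : CommAlgCat.{u} R, Under (CommAlgCat.of R R) := fun S =>
    Under.mk (CommAlgCat.ofHom (Algebra.ofId R S))
  refine ⟨⟨fun S => (truncPoints e S).trans (kernelPoint c (u S)), fun {S T} f x => ?_⟩⟩
  have hf : (CommAlgCat.ofHom (Algebra.ofId R S) : CommAlgCat.of R R ⟶ S) ≫ f =
      CommAlgCat.ofHom (Algebra.ofId R T) := by
    ext
  exact kernelPoint_map c (Under.homMk f hf : u S ⟶ u T) (truncPoints e S x)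

/-- If `C` represents the Frobenius kernel, then coordinates over an `R`-algebra `B` identify
`B ⊗ C` with a truncated polynomial ring. -/
theorem exists_truncPoly_equiv {C : Type u} [CommRing C] [Algebra R C]
    (E : GrpRepr (frobKernel p (polyAdd A (Gm R))) C) {B : Type u} [CommRing B] [Algebra R B]
    (c : ∀ i, Chart p (A i) (CommAlgCat.of R B) (τ i)) {r : ℕ} (e : (∀ i, τ i) ≃ Fin r) :
    ∃ f : (B ⊗[R] C) ≃ₐ[B] TruncPoly p 1 r B, ∀ x : C,
      truncAug p 1 r B (f (1 ⊗ₜ x)) = algebraMap R B (E.counitHom x) := by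
  let D := TruncPoly p 1 r B
  let tD : Under (CommAlgCat.of R B) :=
    Under.mk (Y := CommAlgCat.of R D) (CommAlgCat.ofHom (IsScalarTower.toAlgHom R B D))
  let tC : Under (CommAlgCat.of R B) :=
    Under.mk (Y := CommAlgCat.of R (B ⊗[R] C)) (CommAlgCat.ofHom Algebra.TensorProduct.includeLeft)
  let tB : Under (CommAlgCat.of R B) :=
    Under.mk (Y := CommAlgCat.of R B) (CommAlgCat.ofHom (AlgHom.id R B))
  -- The universal family of elements with vanishing p-th powers.
  let X : {y : (∀ i, τ i) → D // ∀ j, y j ^ p = 0} :=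
    ⟨fun j => truncX p B (e j), fun j => truncX_pow _⟩
  let g : C →ₐ[R] D := (E.equiv (CommAlgCat.of R D)).symm (kernelPoint c tD X)
  -- The exponential coordinates of the universal point of the kernel over B ⊗ C.
  let Y : {y : (∀ i, τ i) → B ⊗[R] C // ∀ j, y j ^ p = 0} :=
    (kernelPoint c tC).symm (E.pt Algebra.TensorProduct.includeRight)
  let Φ : B ⊗[R] C →ₐ[B] D := Algebra.TensorProduct.lift (Algebra.ofId B D) g
    fun _ _ => Commute.all _ _
  let Ψ : D →ₐ[B] B ⊗[R] C :=
    (truncPoints e (B ⊗[R] C)).symm Y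
  have hΨ : ∀ j, Ψ (truncX p B (e j)) = Y.1 j := fun j =>
    congrArg (fun y => y.1 j) ((truncPoints e (B ⊗[R] C)).apply_symm_apply Y)
  have hΦ : (Φ.restrictScalars R).comp Algebra.TensorProduct.includeRight = g := by
    ext x
    simp [Φ]
  have hg : E.pt g = kernelPoint c tD X := Equiv.apply_symm_apply _ _
  have hY : kernelPoint c tC Y = E.pt Algebra.TensorProduct.includeRight :=
    Equiv.apply_symm_apply _ _
  let fΦ : tC ⟶ tD := Under.homMk (CommAlgCat.ofHom (Φ.restrictScalars R)) (by
    ext b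
    exact Φ.commutes b)
  let fΨ : tD ⟶ tC := Under.homMk (CommAlgCat.ofHom (Ψ.restrictScalars R)) (by
    ext b
    exact Ψ.commutes b)
  let fa : tD ⟶ tB := Under.homMk (CommAlgCat.ofHom ((truncAug p 1 r B).restrictScalars R)) (by
    ext b
    exact (truncAug p 1 r B).commutes b)
  have h1 : ∀ j, Φ (Y.1 j) = X.1 j := by
    intro j
    have h := kernelPoint_map c fΦ Y
    have h2 := E.pt_comp (Φ.restrictScalars R) Algebra.TensorProduct.includeRight
    rw [hΦ, hg, ← hY] at h2
    exact congrArg (fun y => y.1 j) ((kernelPoint c tD).injective (h.trans h2.symm))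
  have h2 : (Ψ.restrictScalars R).comp g = Algebra.TensorProduct.includeRight := by
    apply E.pt_injective
    rw [E.pt_comp, hg, ← hY]
    refine (kernelPoint_map c fΨ X).symm.trans ?_
    congr 1
    exact Subtype.ext (funext hΨ)
  -- Φ carries Y to X, and Ψ carries g back to the inclusion of C, so each composite fixes the
  -- universal object on its side.
  have h3 : Φ.comp Ψ = AlgHom.id B D := by
    refine truncPoly_algHom_ext fun j => ?_
    obtain ⟨j, rfl⟩ := e.surjective j
    change Φ (Ψ (truncX p B (e j))) = _
    rw [hΨ, h1]
    rfl
  have h4 : Ψ.comp Φ = AlgHom.id B (B ⊗[R] C) := by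
    apply Algebra.TensorProduct.ext'
    intro b x
    have hx : Φ (b ⊗ₜ x) = b • g x := by
      simp only [Φ, Algebra.TensorProduct.lift_tmul, Algebra.ofId_apply]
      exact (Algebra.smul_def b (g x)).symm
    rw [AlgHom.comp_apply, hx, map_smul]
    have := DFunLike.congr_fun h2 x
    rw [show Ψ (g x) = 1 ⊗ₜ x from this, TensorProduct.smul_tmul']
    simp
  refine ⟨AlgEquiv.ofAlgHom Φ Ψ h3 h4, fun x => ?_⟩
  -- The base point x = 0 corresponds to y = 0, whose exponential product is the trivial map, i.e.
  -- the unit section.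
  have h5 : ((truncAug p 1 r B).restrictScalars R).comp g =
      (Algebra.ofId R B).comp E.counitHom := by
    apply E.pt_injective
    rw [E.pt_comp_counitHom, E.pt_comp, hg]
    refine (kernelPoint_map c fa X).symm.trans ?_
    refine Eq.trans ?_ (kernelPoint_zero c tB)
    congr 1
    exact Subtype.ext (funext fun j => truncAug_truncX (e j))
  have hx : Φ (1 ⊗ₜ x) = g x := by simp [Φ]
  exact (congrArg (truncAug p 1 r B) hx).trans (DFunLike.congr_fun h5 x)

/-- Composition with homomorphisms in the variables, on the Frobenius kernel. -/
def kernelComp {A A' : ι → GrpFunctor.{u, u} R} (α : ∀ i, A' i ⟶ A i) (S : CommAlgCat.{u} R)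
    (f : (frobKernel p (polyAdd A (Gm R))).obj S) : (frobKernel p (polyAdd A' (Gm R))).obj S :=
  ⟨PolyAddOver.comp (A := A) f.1 α, by
    have h : PolyAddOver.baseChange (A := A) (frobHom p S) f.1 = 1 := f.2
    change PolyAddOver.comp (PolyAddOver.baseChange (A := A) (frobHom p S) f.1) α = 1
    rw [h]
    rfl⟩

theorem kernelComp_map {A A' : ι → GrpFunctor.{u, u} R} (α : ∀ i, A' i ⟶ A i)
    {S T : CommAlgCat.{u} R} (g : S ⟶ T) (f : (frobKernel p (polyAdd A (Gm R))).obj S) :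
    kernelComp α T (((frobKernel p (polyAdd A (Gm R))).map g).hom f) =
      ((frobKernel p (polyAdd A' (Gm R))).map g).hom (kernelComp α S f) := rfl

theorem PolyAddOver.comp_comp_of_id {A A' : ι → GrpFunctor.{u, u} R} {G : GrpFunctor.{u, w} R}
    (α : ∀ i, A i ⟶ A' i) (β : ∀ i, A' i ⟶ A i) (h : ∀ i, α i ≫ β i = 𝟙 _)
    {S : CommAlgCat.{u} R} (f : PolyAddOver A G S) : (f.comp β).comp α = f := by
  ext T a
  change f.toFun T _ = f.toFun T _
  congr 1
  funext i
  exact congrArg (fun g : A i ⟶ A i => (g.app T.right).hom (a i)) (h i)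

/-- For free modules the kernel is represented by a truncated polynomial ring, and in general it is
a retract of such a kernel. Representability is thus obtained globally, without gluing local charts.
-/
theorem exists_repr_of_retract {A : ι → GrpFunctor.{u, u} R} {P : ι → Type u}
    [∀ i, AddCommGroup (P i)] [∀ i, Module R (P i)] [∀ i, Module.Finite R (P i)]
    [∀ i, Module.Projective R (P i)] (φ : ∀ i, P i →ₛₗ[frob p R] P i)
    (α : ∀ i, A i ⟶ frobLinearGrp (φ i)) (β : ∀ i, frobLinearGrp (φ i) ⟶ A i)
    (h : ∀ i, α i ≫ β i = 𝟙 _) : ∃ (C : Type u) (_ : CommRing C) (_ : Algebra R C),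
      Nonempty (GrpRepr (frobKernel p (polyAdd A (Gm R))) C) := by
  choose n ψ u v hu hv hvu using fun i => exists_free_retract (φ i)
  let α' : ∀ i, A i ⟶ frobLinearGrp (ψ i) := fun i => α i ≫ frobLinearMap (v i) (hv i)
  let β' : ∀ i, frobLinearGrp (ψ i) ⟶ A i := fun i => frobLinearMap (u i) (hu i) ≫ β i
  have h' : ∀ i, α' i ≫ β' i = 𝟙 _ := by
    intro i
    have : frobLinearMap (v i) (hv i) ≫ frobLinearMap (u i) (hu i) = 𝟙 _ := by
      ext S ξ
      apply Subtype.ext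
      change ((Multiplicative.toAdd ξ).1 ∘ₗ v i) ∘ₗ u i = _
      rw [LinearMap.comp_assoc, hvu, LinearMap.comp_id]
      rfl
    simp only [α', β', Category.assoc]
    rw [← Category.assoc (frobLinearMap (v i) (hv i)), this, Category.id_comp, h]
  obtain ⟨E⟩ := exists_repr_of_chart (A := fun i => frobLinearGrp (ψ i))
    (fun i => basisChart (ψ i) (Pi.basisFun R (Fin (n i))) (CommAlgCat.of R R))
    (Fintype.equivFin (∀ i, Fin (n i)))
  exact E.exists_of_retract (fun S => kernelComp β' S) (fun S => kernelComp α' S)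
    (fun f x => kernelComp_map β' f x) (fun f x => kernelComp_map α' f x)
    fun S x => Subtype.ext (PolyAddOver.comp_comp_of_id α' β' h' x.1)

/-- Transport of coordinates along an isomorphism of group functors. -/
def Chart.ofIso {A A' : GrpFunctor.{u, u} R} (α : GrpFunctorIso A A') {τ : Type} [Fintype τ]
    (c : Chart p A' S τ) : Chart p A S τ where
  l := c.l
  coord T a := c.coord T (α.equiv T.right a)
  coord_pow T a j := c.coord_pow T _ j
  coord_mul T a b j := by rw [map_mul, c.coord_mul]
  coord_map f a j := by rw [α.naturality, c.coord_map]
  coord_injective T a b h := (α.equiv T.right).injective (c.coord_injective T h)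
  coord_surjective T t ht := by
    obtain ⟨a, ha⟩ := c.coord_surjective T t ht
    exact ⟨(α.equiv T.right).symm a, by rw [MulEquiv.apply_symm_apply, ha]⟩

/-- The morphism underlying an isomorphism of group functors. -/
def GrpFunctorIso.hom {A A' : GrpFunctor.{u, u} R} (α : GrpFunctorIso A A') : A ⟶ A' where
  app S := CommGrpCat.ofHom (α.equiv S).toMonoidHom
  naturality S T f := by
    ext x
    exact α.naturality f x

/-- The inverse of an isomorphism of group functors. -/
def GrpFunctorIso.symm {A : GrpFunctor.{u, v} R} {A' : GrpFunctor.{u, w} R}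
    (α : GrpFunctorIso A A') : GrpFunctorIso A' A where
  equiv S := (α.equiv S).symm
  naturality {S T} f x := by
    rw [MulEquiv.symm_apply_eq, α.naturality, MulEquiv.apply_symm_apply]

theorem GrpFunctorIso.hom_symm_hom {A A' : GrpFunctor.{u, u} R} (α : GrpFunctorIso A A') :
    α.hom ≫ α.symm.hom = 𝟙 _ := by
  ext S x
  exact (α.equiv S).symm_apply_apply x

/-- The Frobenius kernel of the functor of poly-additive maps on functors `A_{P_i,φ_i}` is
1-smooth; its rank is the product of the ranks of the `P_i`. -/
theorem isSmoothGroup_of_iso {m : ℕ} {A : Fin m → GrpFunctor.{u, u} R} {P : Fin m → Type u}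
    [∀ i, AddCommGroup (P i)] [∀ i, Module R (P i)] [∀ i, Module.Finite R (P i)]
    [∀ i, Module.Projective R (P i)] (φ : ∀ i, P i →ₛₗ[frob p R] P i)
    (α : ∀ i, GrpFunctorIso (A i) (frobLinearGrp (φ i))) (r : Fin m → PrimeSpectrum R → ℕ)
    (hr : ∀ 𝔭 : PrimeSpectrum R, ∃ f ∉ 𝔭.asIdeal, ∀ i, Nonempty
      (Module.Basis (Fin (r i 𝔭)) (Localization.Away f) (Localization.Away f ⊗[R] P i))) :
    IsSmoothGroup p 1 (frobKernel p (polyAdd A (Gm R))) fun 𝔭 => ∏ i, r i 𝔭 := by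
  obtain ⟨C, _, _, ⟨E⟩⟩ := exists_repr_of_retract φ (fun i => (α i).hom) (fun i => (α i).symm.hom)
    fun i => (α i).hom_symm_hom
  refine ⟨C, inferInstance, E.hopfAlgebra, E.isCocomm, E.exists_iso, fun 𝔭 => ?_⟩
  obtain ⟨f, hf, hb⟩ := hr 𝔭
  exact ⟨f, hf, exists_truncPoly_equiv E (fun i => Chart.ofIso (α i)
    (frobLinearChart (S := CommAlgCat.of R (Localization.Away f)) (φ i) (hb i).some))
    finPiFinEquiv⟩

end Points

/-! ### Characters of a commutative group scheme and the dual algebra -/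

section Pairing

variable {R : Type u} [CommRing R] {C : Type u} [CommRing C]

/-- The extension `S ⊗ C → S` of a functional on `C`. -/
noncomputable def coeffMap [Algebra R C] (S : Type u) [CommRing S] [Algebra R S] (l : C →ₗ[R] R) :
    S ⊗[R] C →ₗ[R] S :=
  TensorProduct.lift ((LinearMap.lsmul R S).flip.compl₂ l)

@[simp] theorem coeffMap_tmul [Algebra R C] (S : Type u) [CommRing S] [Algebra R S]
    (l : C →ₗ[R] R) (s : S) (c : C) : coeffMap S l (s ⊗ₜ c) = l c • s := rfl

/-- The Leibniz rule of D extends S-linearly. The unit of the convolution algebra is the counit,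
which is why `1` appears. -/
theorem coeffMap_mul_of_mem_lieAlg [HopfAlgebra R C] (S : Type u) [CommRing S] [Algebra R S]
    {D : WithConv (C →ₗ[R] R)} (hD : D ∈ lieAlg R C) (z w : S ⊗[R] C) :
    coeffMap S D.ofConv (z * w) =
      coeffMap S (1 : WithConv (C →ₗ[R] R)).ofConv z * coeffMap S D.ofConv w +
        coeffMap S D.ofConv z * coeffMap S (1 : WithConv (C →ₗ[R] R)).ofConv w := by
  induction z with
  | zero => simp
  | add a b ha hb => simp only [map_add, add_mul, ha, hb]; ring
  | tmul s c =>
    induction w with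
    | zero => simp
    | add a b ha hb => simp only [map_add, mul_add, ha, hb]; ring
    | tmul s' c' =>
      rw [Algebra.TensorProduct.tmul_mul_tmul]
      simp only [coeffMap_tmul]
      have e : D.ofConv (c * c') = _ := hD c c'
      have e1 : ∀ c, (1 : WithConv (C →ₗ[R] R)).ofConv c = Coalgebra.counit (R := R) c :=
        fun _ => rfl
      rw [e, e1, e1, smul_mul_smul_comm, smul_mul_smul_comm, add_smul]

variable [HopfAlgebra R C] [Coalgebra.IsCocomm R C] {S : CommAlgCat.{u} R}

/-- The point of `Spec C` given by an algebra map. -/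
def specPt {T : CommAlgCat.{u} R} (x : C →ₐ[R] T) : (specGrp R C).obj T := toConv x

/-- The algebra map given by a point of `Spec C`. -/
def specHom {T : CommAlgCat.{u} R} (x : (specGrp R C).obj T) : C →ₐ[R] T :=
  WithConv.ofConv (A := C →ₐ[R] T) x

/-- The `S`-algebra `S ⊗ C`. -/
def univUnder (C : Type u) [CommRing C] [Algebra R C] (S : CommAlgCat.{u} R) : Under S :=
  Under.mk (Y := CommAlgCat.of R (S ⊗[R] C)) (CommAlgCat.ofHom Algebra.TensorProduct.includeLeft)

theorem dualStructure_apply (S : CommAlgCat.{u} R) (a b : R) :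
    (dualStructure S).hom (TrivSqZeroExt.inl a + TrivSqZeroExt.inr b : DualNumber R) =
      (TrivSqZeroExt.inl (algebraMap R S a) + TrivSqZeroExt.inr (algebraMap R S b) :
        DualNumber S) := by
  have hb : (TrivSqZeroExt.inr b : DualNumber R) = b • DualNumber.eps := by
    ext <;> simp
  have hb' : (TrivSqZeroExt.inr (algebraMap R S b) : DualNumber S) = b • DualNumber.eps := by
    ext
    · change (0 : S) = b • (0 : S)
      rw [smul_zero]
    · change algebraMap R S b = b • (1 : S)
      rw [Algebra.smul_def, mul_one]
  rw [hb, hb']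
  have h1 : (dualStructure S).hom (DualNumber.eps : DualNumber R) =
    (DualNumber.eps : DualNumber S) := DualNumber.lift_apply_eps _
  have h2 : (dualStructure S).hom (TrivSqZeroExt.inl a : DualNumber R) =
    (TrivSqZeroExt.inl (algebraMap R S a) : DualNumber S) := DualNumber.lift_apply_inl _ _
  refine (map_add (dualStructure S).hom _ _).trans ?_
  rw [h2]
  congr 1
  exact (map_smul (dualStructure S).hom b _).trans (congrArg (b • ·) h1)

namespace HomOver

variable (h : HomOver (specGrp R C) (Gm R) S)

/-- The group-like element of `S ⊗ C` attached to a character. -/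
noncomputable def elt : S ⊗[R] C :=
  gmVal (h.toFun (univUnder C S) (specPt (T := CommAlgCat.of R (S ⊗[R] C))
    Algebra.TensorProduct.includeRight))

/-- The map `S ⊗ C → T` given by a point. -/
noncomputable def evalAt (T : Under S) (x : (specGrp R C).obj T.right) : S ⊗[R] C →ₐ[R] T.right :=
  Algebra.TensorProduct.lift (show S ⟶ T.right from T.hom).hom (specHom x) fun _ _ => Commute.all _ _

omit [Coalgebra.IsCocomm R C] in
theorem evalAt_tmul [Coalgebra.IsCocomm R C] (T : Under S) (x : (specGrp R C).obj T.right) (s : S)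
    (c : C) : evalAt T x (s ⊗ₜ c) = underHom T s * specHom x c := rfl

/-- Yoneda: x is the image of the universal point over S ⊗ C, so h is determined by its value there.
-/
theorem gmVal_toFun (T : Under S) (x : (specGrp R C).obj T.right) :
    gmVal (h.toFun T x) = evalAt T x h.elt := by
  let f : univUnder C S ⟶ T := Under.homMk (CommAlgCat.ofHom (evalAt T x)) (by
    apply CommAlgCat.hom_ext
    exact Algebra.TensorProduct.lift_comp_includeLeft _ _ fun _ _ => Commute.all _ _)
  have h1 := h.naturality f (specPt (T := CommAlgCat.of R (S ⊗[R] C))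
    Algebra.TensorProduct.includeRight)
  have h2 : ((specGrp R C).map f.right).hom (specPt (T := CommAlgCat.of R (S ⊗[R] C))
    Algebra.TensorProduct.includeRight) = x :=
    WithConv.ofConv_injective
      (Algebra.TensorProduct.lift_comp_includeRight _ _ fun _ _ => Commute.all _ _)
  rw [h2] at h1
  rw [h1]
  rfl

/-- The value of a functional on the group-like element of a character. -/
noncomputable def pairing (l : WithConv (C →ₗ[R] R)) : S := coeffMap S l.ofConv h.elt

theorem toFun_one (T : Under S) : h.toFun T 1 = 1 := by
  have := h.map_mul T 1 1
  rw [mul_one] at this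
  exact left_eq_mul.1 this

/-- Pairing with the counit is evaluation of the character at the unit section. -/
theorem pairing_one : h.pairing 1 = 1 := by
  have h1 := h.gmVal_toFun (Under.mk (𝟙 S)) 1
  rw [toFun_one, gmVal_one] at h1
  refine Eq.trans ?_ h1.symm
  rw [pairing]
  generalize h.elt = z
  induction z with
  | zero => rw [map_zero, map_zero]
  | add x y hx hy => rw [map_add, map_add, hx, hy]
  | tmul s c =>
    rw [coeffMap_tmul, evalAt_tmul, Algebra.smul_def, mul_comm]
    rfl

/-- Let x and y be the two universal points over S ⊗ (C ⊗ C). Multiplicativity of h at x and y says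
that the comultiplication of its element is the product of the two copies of that element. Applying
l ⊗ m, here L, gives the claim, since convolution is dual to comultiplication. -/
theorem pairing_mul (l m : WithConv (C →ₗ[R] R)) : h.pairing (l * m) = h.pairing l * h.pairing m := by
  let T : Under S := Under.mk (Y := CommAlgCat.of R (S ⊗[R] (C ⊗[R] C)))
    (CommAlgCat.ofHom Algebra.TensorProduct.includeLeft)
  let x : (specGrp R C).obj T.right := specPt (T := CommAlgCat.of R (S ⊗[R] (C ⊗[R] C)))
    (Algebra.TensorProduct.includeRight.comp Algebra.TensorProduct.includeLeft)
  let y : (specGrp R C).obj T.right := specPt (T := CommAlgCat.of R (S ⊗[R] (C ⊗[R] C)))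
    (Algebra.TensorProduct.includeRight.comp Algebra.TensorProduct.includeRight)
  have h1 := congrArg gmVal (h.map_mul T x y)
  rw [gmVal_mul, gmVal_toFun, gmVal_toFun, gmVal_toFun] at h1
  let L : S ⊗[R] (C ⊗[R] C) →ₗ[R] S :=
    TensorProduct.lift ((LinearMap.lsmul R S).flip.compl₂
      (LinearMap.mul' R R ∘ₗ TensorProduct.map l.ofConv m.ofConv))
  have hL : ∀ s w, L (s ⊗ₜ w) = (LinearMap.mul' R R (TensorProduct.map l.ofConv m.ofConv w)) • s :=
    fun s w => rfl
  have hxy : ∀ c, specHom (x * y) c =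
      (1 : S) ⊗ₜ[R] (Coalgebra.comul (R := R) c : C ⊗[R] C) := by
    intro c
    have e := AlgHom.convMul_apply (WithConv.toConv (specHom x)) (WithConv.toConv (specHom y)) c
    refine e.trans ?_
    generalize (Coalgebra.comul (R := R) c : C ⊗[R] C) = w
    induction w with
    | zero => simp
    | add a b ha hb => rw [map_add, ha, hb, TensorProduct.tmul_add]
    | tmul a b =>
      rw [Algebra.TensorProduct.lift_tmul]
      change ((1 : S) ⊗ₜ[R] (a ⊗ₜ[R] (1 : C))) * ((1 : S) ⊗ₜ[R] ((1 : C) ⊗ₜ[R] b)) = _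
      simp
  have h2 : ∀ z : S ⊗[R] C, L (evalAt T (x * y) z) = coeffMap S (l * m).ofConv z := by
    intro z
    induction z with
    | zero => rw [map_zero, map_zero, map_zero]
    | add a b ha hb => rw [map_add, map_add, map_add, ha, hb]
    | tmul s c =>
      have e : (evalAt T (x * y) (s ⊗ₜ c) : S ⊗[R] (C ⊗[R] C)) =
          s ⊗ₜ[R] (Coalgebra.comul (R := R) c : C ⊗[R] C) := by
        rw [evalAt_tmul, hxy]
        change (s ⊗ₜ[R] (1 : C ⊗[R] C)) * _ = _
        rw [Algebra.TensorProduct.tmul_mul_tmul, one_mul, mul_one]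
      rw [e, hL, coeffMap_tmul]
      rfl
  have h3 : ∀ z w : S ⊗[R] C, L (evalAt T x z * evalAt T y w) =
      coeffMap S l.ofConv z * coeffMap S m.ofConv w := by
    intro z w
    induction z with
    | zero => rw [map_zero, map_zero, zero_mul, map_zero, zero_mul]
    | add a b ha hb => rw [map_add, map_add, add_mul, map_add, ha, hb, add_mul]
    | tmul s c =>
      induction w with
      | zero => rw [map_zero, map_zero, mul_zero, map_zero, mul_zero]
      | add a b ha hb => rw [map_add, map_add, mul_add, map_add, ha, hb, mul_add]
      | tmul s' c' =>
        have ex : (evalAt T x (s ⊗ₜ c) : S ⊗[R] (C ⊗[R] C)) = s ⊗ₜ[R] (c ⊗ₜ[R] 1) := by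
          change (s ⊗ₜ[R] (1 : C ⊗[R] C)) * ((1 : S) ⊗ₜ[R] (c ⊗ₜ[R] (1 : C))) = _
          rw [Algebra.TensorProduct.tmul_mul_tmul, one_mul, mul_one]
        have ey : (evalAt T y (s' ⊗ₜ c') : S ⊗[R] (C ⊗[R] C)) = s' ⊗ₜ[R] (1 ⊗ₜ[R] c') := by
          change (s' ⊗ₜ[R] (1 : C ⊗[R] C)) * ((1 : S) ⊗ₜ[R] ((1 : C) ⊗ₜ[R] c')) = _
          rw [Algebra.TensorProduct.tmul_mul_tmul, one_mul, mul_one]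
        have exy : (evalAt T x (s ⊗ₜ c) * evalAt T y (s' ⊗ₜ c') : S ⊗[R] (C ⊗[R] C)) =
            (s * s') ⊗ₜ[R] (c ⊗ₜ[R] c') := by
          refine (congrArg₂ (fun z w : S ⊗[R] (C ⊗[R] C) => z * w) ex ey).trans ?_
          simp only [Algebra.TensorProduct.tmul_mul_tmul, one_mul, mul_one]
        rw [exy, hL, TensorProduct.map_tmul, LinearMap.mul'_apply, coeffMap_tmul, coeffMap_tmul,
          smul_mul_smul_comm]
  rw [pairing, ← h2, h1, h3]
  rfl

/-- The pairing with a character is an algebra homomorphism on the dual algebra. -/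
noncomputable def pairingHom : WithConv (C →ₗ[R] R) →ₐ[R] S :=
  AlgHom.ofLinearMap
    { toFun := h.pairing
      map_add' := fun l m => by
        rw [pairing, pairing, pairing]
        generalize h.elt = z
        induction z with
        | zero => simp
        | add a b ha hb => rw [map_add, map_add, map_add, ha, hb]; ring
        | tmul s c => simp [add_smul]
      map_smul' := fun r l => by
        rw [pairing, pairing]
        generalize h.elt = z
        induction z with
        | zero => simp
        | add a b ha hb => rw [map_add, map_add, ha, hb, smul_add]
        | tmul s c => simp [mul_smul] }
    h.pairing_one h.pairing_mul

theorem pairingHom_apply (l : WithConv (C →ₗ[R] R)) : h.pairingHom l = h.pairing l := rfl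

theorem elt_mul (h' : HomOver (specGrp R C) (Gm R) S) : (h * h').elt = h.elt * h'.elt := rfl

/-- The elements of S ⊗ C multiply, and D is a derivation at the unit section, where both characters
take the value 1. -/
theorem pairing_mul_of_mem_lieAlg (h' : HomOver (specGrp R C) (Gm R) S) {D : WithConv (C →ₗ[R] R)}
    (hD : D ∈ lieAlg R C) : (h * h').pairing D = h.pairing D + h'.pairing D := by
  have h1 := h.pairing_one
  have h2 := h'.pairing_one
  rw [pairing] at h1 h2
  rw [pairing, elt_mul, coeffMap_mul_of_mem_lieAlg S hD, h1, h2, one_mul, mul_one, add_comm]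
  rfl

theorem pairing_baseChange {S' : CommAlgCat.{u} R} (f : S ⟶ S') (l : WithConv (C →ₗ[R] R)) :
    (h.baseChange f).pairing l = f.hom (h.pairing l) := by
  have h1 : (h.baseChange f).elt = Algebra.TensorProduct.map f.hom (AlgHom.id R C) h.elt := by
    refine (h.gmVal_toFun ((Under.map f).obj (univUnder C S')) _).trans ?_
    generalize h.elt = z
    induction z with
    | zero => rw [map_zero, map_zero]; rfl
    | add a b ha hb => rw [map_add, map_add, ha, hb]; rfl
    | tmul s c =>
      change (f.hom s ⊗ₜ[R] (1 : C)) * ((1 : S') ⊗ₜ[R] c) = _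
      simp
  rw [pairing, h1, pairing]
  generalize h.elt = z
  induction z with
  | zero => simp
  | add a b ha hb => simp only [map_add, ha, hb]
  | tmul s c => simp

/-- The values of a character on tangent vectors. -/
theorem snd_toFun_dualInl (D : lieAlg R C) :
    TrivSqZeroExt.snd (show DualNumber S from gmVal (h.toFun (Under.mk (dualInl S))
      (((specGrp R C).map (dualStructure S)).hom (tangentPoint D)))) = h.pairing D.1 := by
  rw [gmVal_toFun, pairing]
  generalize h.elt = z
  induction z with
  | zero => rw [map_zero, map_zero]; rfl
  | add a b ha hb => rw [map_add, map_add, ← ha, ← hb]; rfl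
  | tmul s c =>
    have e : (dualStructure S).hom (specHom (tangentPoint D) c) =
        (TrivSqZeroExt.inl (algebraMap R S (Coalgebra.counit (R := R) c)) +
          TrivSqZeroExt.inr (algebraMap R S (D.1.ofConv c)) : DualNumber S) :=
      dualStructure_apply S _ _
    have e2 : (show DualNumber S from evalAt (Under.mk (dualInl S))
        (((specGrp R C).map (dualStructure S)).hom (tangentPoint D)) (s ⊗ₜ c)) =
        TrivSqZeroExt.inl s * (TrivSqZeroExt.inl (algebraMap R S (Coalgebra.counit (R := R) c)) +
          TrivSqZeroExt.inr (algebraMap R S (D.1.ofConv c))) :=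
      congrArg (fun z : DualNumber S => TrivSqZeroExt.inl s * z) e
    rw [e2, coeffMap_tmul]
    simp only [TrivSqZeroExt.snd_mul, TrivSqZeroExt.fst_inl, TrivSqZeroExt.snd_inl,
      TrivSqZeroExt.snd_add, TrivSqZeroExt.snd_inr, zero_add, smul_zero,
      add_zero, smul_eq_mul]
    rw [Algebra.smul_def, mul_comm]

end HomOver

end Pairing

/-! ### Poly-additive tangent vectors -/

section Tangents

variable {p : ℕ} [hp : Fact p.Prime] {R : Type u} [CommRing R] [Algebra (ZMod p) R]

/-- The unit `1 + e t`, `e ^ 2 = 0`. -/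
def oneAddUnit {T : Type*} [CommRing T] (e t : T) (he : e * e = 0) : Tˣ where
  val := 1 + e * t
  inv := 1 - e * t
  val_inv := by linear_combination (-t ^ 2) * he
  inv_val := by linear_combination (-t ^ 2) * he

/-- The ring `R[ε]`. -/
abbrev dualBase (R : Type u) [CommRing R] : CommAlgCat.{u} R := dualNumbers (CommAlgCat.of R R)

/-- The element `ε`. -/
def dualEps (R : Type u) [CommRing R] : dualBase R := (DualNumber.eps : DualNumber R)

theorem dualEps_mul_dualEps : dualEps R * dualEps R = 0 := DualNumber.eps_mul_eps

include hp in
theorem dualEps_pow : dualEps R ^ p = 0 := by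
  obtain ⟨k, hk⟩ := Nat.exists_eq_add_of_le hp.out.two_le
  rw [hk, pow_add, pow_two, dualEps_mul_dualEps, zero_mul]

theorem underHom_dualEps (T : Under (dualBase R)) :
    underHom T (dualEps R) * underHom T (dualEps R) = 0 := by
  rw [← map_mul, dualEps_mul_dualEps, map_zero]

/-- The reduction `R[ε] → R`. -/
def dualFst (R : Type u) [CommRing R] : dualBase R ⟶ CommAlgCat.of R R :=
  CommAlgCat.ofHom (TrivSqZeroExt.fstHom R R R)

variable {ι : Type} [Fintype ι] [DecidableEq ι]
  {P Q : ι → Type u} [∀ i, AddCommGroup (P i)] [∀ i, Module R (P i)]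
  [∀ i, AddCommGroup (Q i)] [∀ i, Module R (Q i)]
  (φ : ∀ i, P i →ₛₗ[frob p R] P i) (ψ : ∀ i, Q i →ₛₗ[frob p R] Q i)

/-- The linear map on `⨂ P_i` attached to points of the `A_{P_i,φ_i}`. -/
def tensorEval {S : CommAlgCat.{u} R} (ξ : ∀ i, (frobLinearGrp (φ i)).obj S) :
    PiTensorProduct R P →ₗ[R] S :=
  tensorLinear fun i => (Multiplicative.toAdd (ξ i)).1

theorem tensorEval_tprod {S : CommAlgCat.{u} R} (ξ : ∀ i, (frobLinearGrp (φ i)).obj S)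
    (x : ∀ i, P i) : tensorEval φ ξ (PiTensorProduct.tprod R x) =
      ∏ i, (Multiplicative.toAdd (ξ i)).1 (x i) := tensorLinear_tprod _ _

theorem tensorEval_map {S T : CommAlgCat.{u} R} (f : S ⟶ T)
    (ξ : ∀ i, (frobLinearGrp (φ i)).obj S) (t : PiTensorProduct R P) :
    tensorEval φ (fun i => ((frobLinearGrp (φ i)).map f).hom (ξ i)) t =
      f.hom (tensorEval φ ξ t) :=
  congrArg (fun z : (frobLinearGrp (tensorPLinear φ)).obj T => (Multiplicative.toAdd z).1 t)
    (tensorPoint_naturality φ f ξ)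

theorem tensorEval_update_mul {S : CommAlgCat.{u} R} (i : ι)
    (ξ : ∀ i, (frobLinearGrp (φ i)).obj S) (a b : (frobLinearGrp (φ i)).obj S)
    (t : PiTensorProduct R P) : tensorEval φ (Function.update ξ i (a * b)) t =
      tensorEval φ (Function.update ξ i a) t + tensorEval φ (Function.update ξ i b) t :=
  congrArg (fun z : (frobLinearGrp (tensorPLinear φ)).obj S => (Multiplicative.toAdd z).1 t)
    (tensorPoint_update_mul φ S i ξ a b)

theorem tensorEval_tensorPLinear {S : CommAlgCat.{u} R} (ξ : ∀ i, (frobLinearGrp (φ i)).obj S)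
    (t : PiTensorProduct R P) : tensorEval φ ξ (tensorPLinear φ t) = tensorEval φ ξ t ^ p :=
  tensorLinear_mem φ (fun i => Multiplicative.toAdd (ξ i)) t

/-- The poly-additive map `1 + ε t` over `R[ε]`. -/
def tangent (t : PiTensorProduct R P) :
    PolyAddOver (fun i => frobLinearGrp (φ i)) (Gm R) (dualBase R) where
  toFun T ξ := gmOf (oneAddUnit (underHom T (dualEps R)) (tensorEval φ ξ t) (underHom_dualEps T))
  naturality {T T'} f ξ := by
    apply gmVal_injective
    rw [gmVal_map]
    change 1 + _ * tensorEval φ (fun i => ((frobLinearGrp (φ i)).map f.right).hom (ξ i)) t =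
      f.right.hom (1 + _ * _)
    rw [tensorEval_map, map_add, map_mul, map_one, underHom_comp f]
  map_mul T i ξ a b := by
    apply gmVal_injective
    rw [gmVal_mul]
    change 1 + _ * tensorEval φ (Function.update ξ i (a * b)) t = (1 + _ * _) * (1 + _ * _)
    rw [tensorEval_update_mul]
    linear_combination (-tensorEval φ (Function.update ξ i a) t *
      tensorEval φ (Function.update ξ i b) t) * underHom_dualEps T

theorem gmVal_tangent (t : PiTensorProduct R P) (T : Under (dualBase R)) (ξ) :
    gmVal ((tangent φ t).toFun T ξ) = 1 + underHom T (dualEps R) * tensorEval φ ξ t := rfl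

theorem tangent_baseChange_frobHom (t : PiTensorProduct R P) :
    (tangent φ t).baseChange (frobHom p (dualBase R)) = 1 := by
  refine Chart.polyAddOver_ext fun T ξ => ?_
  have h : underHom ((Under.map (frobHom p (dualBase R))).obj T) (dualEps R) = 0 := by
    change underHom T ((dualEps R) ^ p : dualBase R) = 0
    exact (congrArg (underHom T) (dualEps_pow (p := p) (R := R))).trans (map_zero (underHom T))
  refine (gmVal_tangent φ t ((Under.map (frobHom p (dualBase R))).obj T) ξ).trans ?_
  rw [h, zero_mul, add_zero]
  rfl

theorem tangent_baseChange_dualFst (t : PiTensorProduct R P) :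
    (tangent φ t).baseChange (dualFst R) = 1 := by
  refine Chart.polyAddOver_ext fun T ξ => ?_
  have h : underHom ((Under.map (dualFst R)).obj T) (dualEps R) = 0 := map_zero (underHom T)
  refine (gmVal_tangent φ t ((Under.map (dualFst R)).obj T) ξ).trans ?_
  rw [h, zero_mul, add_zero]
  rfl

variable {φ ψ} in
theorem tangent_comp (u : ∀ i, P i →ₗ[R] Q i) (hu : ∀ i x, u i (φ i x) = ψ i (u i x))
    (t : PiTensorProduct R P) : (tangent φ t).comp (fun i => frobLinearMap (u i) (hu i)) =
      tangent ψ (PiTensorProduct.map u t) := by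
  refine Chart.polyAddOver_ext fun T ξ => ?_
  refine (gmVal_tangent φ t T _).trans ?_
  rw [gmVal_tangent]
  congr 2
  induction t using PiTensorProduct.induction_on with
  | smul_tprod r x =>
    rw [map_smul, map_smul, map_smul, PiTensorProduct.map_tprod, tensorEval_tprod, tensorEval_tprod]
    rfl
  | add x y hx hy => rw [map_add, map_add, map_add, hx, hy]

theorem prod_one_add_mul {κ T : Type*} [CommRing T] (e : T) (he : e * e = 0) (s : Finset κ)
    (t : κ → T) : ∏ j ∈ s, (1 + e * t j) = 1 + e * ∑ j ∈ s, t j := by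
  classical
  induction s using Finset.induction_on with
  | empty => simp
  | insert a s ha ih =>
    rw [Finset.prod_insert ha, Finset.sum_insert ha, ih]
    linear_combination (t a * ∑ j ∈ s, t j) * he

/-- The scalar multiple of `ε` in `R[ε]`. -/
def dualSmul (z : R) : dualBase R := (TrivSqZeroExt.inr z : DualNumber R)

theorem dualSmul_eq (z : R) : dualSmul z = algebraMap R (dualBase R) z * dualEps R := by
  rw [← Algebra.smul_def]
  change (TrivSqZeroExt.inr z : DualNumber R) = z • TrivSqZeroExt.inr 1
  rw [← TrivSqZeroExt.inr_smul, smul_eq_mul, mul_one]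

theorem dualSmul_injective : Function.Injective (dualSmul (R := R)) :=
  TrivSqZeroExt.inr_injective

theorem dualSmul_pow (z : R) : dualSmul z ^ p = 0 := by
  rw [dualSmul_eq, mul_pow, dualEps_pow, mul_zero]

/-- On elements of square zero the truncated exponential is 1 + u. So the exponential coordinates of
1 + ε t are ε times the tensor coordinates of t. -/
theorem tangent_eq_expPoly {τ : ι → Type} [∀ i, Fintype (τ i)]
    (b : ∀ i, Module.Basis (τ i) R (P i)) (z : (∀ i, τ i) → R) :
    tangent φ (∑ j, z j • PiTensorProduct.tprod R fun i => b i (j i)) =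
      Chart.expPoly (fun i => basisChart (φ i) (b i) (dualBase R)) (fun j => dualSmul (z j))
        fun j => dualSmul_pow (z j) := by
  refine Chart.polyAddOver_ext fun T ξ => ?_
  rw [Chart.gmVal_expPoly, gmVal_tangent, map_sum, ← prod_one_add_mul _ (underHom_dualEps T)]
  refine Finset.prod_congr rfl fun j _ => ?_
  have hm : Chart.multiCoord (fun i => basisChart (φ i) (b i) (dualBase R)) T ξ j =
      tensorEval φ ξ (PiTensorProduct.tprod R fun i => b i (j i)) := by
    rw [tensorEval_tprod, Chart.multiCoord]
    exact Finset.prod_congr rfl fun i _ => basisChart_coord (φ i) (b i) T (ξ i) (j i)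
  have hz : underHom T (algebraMap R (dualBase R) (z j)) = algebraMap R T.right (z j) :=
    AlgHom.commutes (show dualBase R ⟶ T.right from T.hom).hom (z j)
  have he : underHom T (dualSmul (z j)) * Chart.multiCoord
      (fun i => basisChart (φ i) (b i) (dualBase R)) T ξ j = underHom T (dualEps R) *
        tensorEval φ ξ (z j • PiTensorProduct.tprod R fun i => b i (j i)) := by
    rw [hm, map_smul, dualSmul_eq, map_mul, hz, Algebra.smul_def]
    ring
  rw [he, truncExp_of_sq_eq_zero (natCast_p_eq_zero_of_algebra p R T.right)]
  rw [mul_pow, pow_two, underHom_dualEps, zero_mul]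

theorem tangent_injective_of_basis {τ : ι → Type} [∀ i, Fintype (τ i)]
    (b : ∀ i, Module.Basis (τ i) R (P i)) : Function.Injective (tangent φ) := by
  classical
  let B := Basis.piTensorProduct b
  have hB : ∀ t, ∑ j, B.repr t j • PiTensorProduct.tprod R (fun i => b i (j i)) = t := by
    intro t
    conv_rhs => rw [← B.sum_repr t]
    exact Finset.sum_congr rfl fun j _ => by rw [Basis.piTensorProduct_apply]
  intro t t' h
  rw [← hB t, ← hB t', tangent_eq_expPoly, tangent_eq_expPoly] at h
  have h2 := Chart.expPoly_injective _ _ _ h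
  have h3 : ∀ j, B.repr t j = B.repr t' j := fun j => dualSmul_injective (congrFun h2 j)
  rw [← hB t, ← hB t']
  simp only [h3]

/-- Triviality at ε = 0 forces, by uniqueness of exponential coordinates, each y_j to be a multiple
of ε. -/
theorem exists_tangent_of_basis {τ : ι → Type} [∀ i, Fintype (τ i)]
    (b : ∀ i, Module.Basis (τ i) R (P i))
    (f : PolyAddOver (fun i => frobLinearGrp (φ i)) (Gm R) (dualBase R))
    (hf : f.baseChange (frobHom p (dualBase R)) = 1) (hf' : f.baseChange (dualFst R) = 1) :
    ∃ t, tangent φ t = f := by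
  classical
  obtain ⟨y, hy, rfl⟩ :=
    Chart.exists_expPoly_eq (fun i => basisChart (φ i) (b i) (dualBase R)) f hf
  rw [Chart.baseChange_expPoly, ← Chart.expPoly_zero fun i =>
    (basisChart (φ i) (b i) (dualBase R)).baseChange (dualFst R)] at hf'
  have h0 := Chart.expPoly_injective _ _ _ hf'
  have hz : ∀ j, y j = dualSmul (TrivSqZeroExt.snd (show DualNumber R from y j)) := by
    intro j
    have h1 : TrivSqZeroExt.fst (show DualNumber R from y j) = 0 := congrFun h0 j
    refine TrivSqZeroExt.ext ?_ ?_
    · exact h1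
    · rfl
  refine ⟨_, (tangent_eq_expPoly φ b fun j =>
    TrivSqZeroExt.snd (show DualNumber R from y j)).trans ?_⟩
  congr 1
  funext j
  exact (hz j).symm

section Projective

variable [∀ i, Module.Finite R (P i)] [∀ i, Module.Projective R (P i)]

/-- Reduction to free modules: by `tangent_comp` the pullback along u becomes the tensor product of
the maps u i, which has the tensor product of the v i as a left inverse. -/
theorem tangent_injective : Function.Injective (tangent φ) := by
  choose n ψ u v hu hv hvu using fun i => exists_free_retract (φ i)
  intro t t' h
  have h1 := congrArg (fun f : PolyAddOver (fun i => frobLinearGrp (φ i)) (Gm R) (dualBase R) =>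
    f.comp fun i => frobLinearMap (u i) (hu i)) h
  simp only [tangent_comp] at h1
  have h2 := congrArg (PiTensorProduct.map v)
    (tangent_injective_of_basis ψ (fun i => Pi.basisFun R (Fin (n i))) h1)
  have h3 : PiTensorProduct.map v ∘ₗ PiTensorProduct.map u = LinearMap.id := by
    rw [← PiTensorProduct.map_comp]
    simp only [hvu]
    exact PiTensorProduct.map_id
  rwa [← LinearMap.comp_apply, ← LinearMap.comp_apply, h3] at h2

theorem exists_tangent (f : PolyAddOver (fun i => frobLinearGrp (φ i)) (Gm R) (dualBase R))
    (hf : f.baseChange (frobHom p (dualBase R)) = 1) (hf' : f.baseChange (dualFst R) = 1) :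
    ∃ t, tangent φ t = f := by
  choose n ψ u v hu hv hvu using fun i => exists_free_retract (φ i)
  have hid : ∀ i, frobLinearMap (v i) (hv i) ≫ frobLinearMap (u i) (hu i) = 𝟙 _ := by
    intro i
    ext S ξ
    apply Subtype.ext
    change ((Multiplicative.toAdd ξ).1 ∘ₗ v i) ∘ₗ u i = _
    rw [LinearMap.comp_assoc, hvu, LinearMap.comp_id]
    rfl
  obtain ⟨t, ht⟩ := exists_tangent_of_basis ψ (fun i => Pi.basisFun R (Fin (n i)))
    (f.comp fun i => frobLinearMap (u i) (hu i))
    (by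
      change (f.baseChange (frobHom p (dualBase R))).comp _ = 1
      rw [hf]
      rfl)
    (by
      change (f.baseChange (dualFst R)).comp _ = 1
      rw [hf']
      rfl)
  refine ⟨PiTensorProduct.map v t, ?_⟩
  rw [← tangent_comp v hv, ht, PolyAddOver.comp_comp_of_id _ _ hid]

end Projective

end Tangents

/-! ### The Lie algebra of the Frobenius kernel -/

section LieKernel

variable {p : ℕ} [hp : Fact p.Prime] {R : Type u} [CommRing R] [Algebra (ZMod p) R]
  {ι : Type} [Fintype ι] [DecidableEq ι] {A : ι → GrpFunctor.{u, u} R}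
  {K : Type u} [CommRing K] [HopfAlgebra R K] [Coalgebra.IsCocomm R K]
  (κ : GrpFunctorIso (specGrp R K) (frobKernel p (polyAdd A (Gm R))))

/-- The poly-additive map attached to a point of `Spec K`. -/
noncomputable def kernelPoly {S : CommAlgCat.{u} R} (x : (specGrp R K).obj S) : PolyAddOver A (Gm R) S :=
  (κ.equiv S x).1

theorem kernelPoly_map {S T : CommAlgCat.{u} R} (f : S ⟶ T) (x : (specGrp R K).obj S) :
    kernelPoly κ (((specGrp R K).map f).hom x) = (kernelPoly κ x).baseChange f :=
  congrArg Subtype.val (κ.naturality f x)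

theorem kernelPoly_injective {S : CommAlgCat.{u} R} :
    Function.Injective (kernelPoly κ (S := S)) := fun _ _ h =>
  (κ.equiv S).injective (Subtype.ext h)

/-- Evaluation at points of the `A_i`, as a character of `Spec K`. -/
noncomputable def evalChar {S : CommAlgCat.{u} R} (a : ∀ i, (A i).obj S) : HomOver (specGrp R K) (Gm R) S where
  toFun T x := (kernelPoly κ x).toFun (Under.mk (𝟙 T.right)) fun i => ((A i).map T.hom).hom (a i)
  naturality {T T'} f x := by
    rw [kernelPoly_map]
    let g : Under.mk (𝟙 T.right) ⟶ Under.mk f.right := Under.homMk f.right (Category.id_comp _)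
    refine Eq.trans ?_ ((kernelPoly κ x).naturality g fun i => ((A i).map T.hom).hom (a i))
    refine ((kernelPoly κ x).toFun_congr (Category.comp_id f.right) _).trans ?_
    congr 1
    funext i
    have h := (A i).map_comp T.hom f.right
    rw [show T.hom ≫ f.right = T'.hom from Under.w f] at h
    exact congrArg (fun g => g.hom (a i)) h
  map_mul T x y := by
    have h : kernelPoly κ (x * y) = kernelPoly κ x * kernelPoly κ y :=
      congrArg Subtype.val (map_mul (κ.equiv T.right) x y)
    rw [h]
    rfl

/-- The roles are exchanged: instead of varying a for fixed D, the family a is fixed and defines a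
character of Spec K, which is evaluated at D. As a function of D the differential then extends to an
algebra map on the dual algebra of K. -/
theorem polyAddDifferential_tangentPoint (D : lieAlg R K) (S : CommAlgCat.{u} R)
    (a : ∀ i, (A i).obj S) :
    polyAddDifferential (κ.equiv _ (tangentPoint D)).1 S a = (evalChar κ a).pairing D.1 := by
  rw [← HomOver.snd_toFun_dualInl]
  have e : gmVal ((kernelPoly κ (tangentPoint D)).toFun (Under.mk (dualStructure S))
      fun i => ((A i).map (dualInl S)).hom (a i)) =
    gmVal ((kernelPoly κ (((specGrp R K).map (dualStructure S)).hom (tangentPoint D))).toFun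
      (Under.mk (𝟙 (dualNumbers S))) fun i => ((A i).map (dualInl S)).hom (a i)) := by
    rw [kernelPoly_map]
    exact congrArg gmVal
      ((kernelPoly κ (tangentPoint D)).toFun_congr (Category.comp_id _) _).symm
  exact congrArg (fun z : DualNumber S => TrivSqZeroExt.snd z) e

theorem tangentPoint_map_dualFst (D : lieAlg R K) :
    ((specGrp R K).map (dualFst R)).hom (tangentPoint D) = 1 := by
  apply WithConv.ofConv_injective
  ext c
  change TrivSqZeroExt.fst (TrivSqZeroExt.inl (Coalgebra.counit (R := R) c) +
    TrivSqZeroExt.inr (D.1.ofConv c) : DualNumber R) = Coalgebra.counit (R := R) c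
  simp

theorem tangentPoint_injective : Function.Injective (tangentPoint (R := R) (C := K)) := by
  intro D D' h
  apply Subtype.ext
  apply WithConv.ofConv_injective
  ext c
  have h1 : (TrivSqZeroExt.inl (Coalgebra.counit (R := R) c) +
    TrivSqZeroExt.inr (D.1.ofConv c) : DualNumber R) = (TrivSqZeroExt.inl
      (Coalgebra.counit (R := R) c) + TrivSqZeroExt.inr (D'.1.ofConv c) : DualNumber R) :=
    congrArg (fun x => specHom x c) h
  simpa using congrArg TrivSqZeroExt.snd h1

/-- For an algebra map to R[ε] with constant part the counit, multiplicativity is exactly the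
Leibniz rule for the coefficient of ε. -/
theorem exists_tangentPoint (x : (specGrp R K).obj (dualBase R))
    (hx : ((specGrp R K).map (dualFst R)).hom x = 1) : ∃ D, tangentPoint D = x := by
  let y : K →ₐ[R] DualNumber R := specHom x
  have h1 : ∀ c, TrivSqZeroExt.fst (y c) = Coalgebra.counit (R := R) c := fun c =>
    congrArg (fun x => specHom x c) hx
  let D : K →ₗ[R] R := TrivSqZeroExt.sndHom R R ∘ₗ y.toLinearMap
  refine ⟨⟨toConv D, fun a b => ?_⟩, ?_⟩
  · change TrivSqZeroExt.snd (y (a * b)) = _ * TrivSqZeroExt.snd (y b) +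
      TrivSqZeroExt.snd (y a) * _
    rw [map_mul, TrivSqZeroExt.snd_mul, h1, h1]
    simp [mul_comm]
  · apply WithConv.ofConv_injective
    refine AlgHom.ext fun c => TrivSqZeroExt.ext ?_ ?_
    · refine Eq.trans ?_ (h1 c).symm
      change TrivSqZeroExt.fst (TrivSqZeroExt.inl (Coalgebra.counit (R := R) c) +
        TrivSqZeroExt.inr (D c) : DualNumber R) = _
      simp
    · change TrivSqZeroExt.snd (TrivSqZeroExt.inl (Coalgebra.counit (R := R) c) +
        TrivSqZeroExt.inr (D c) : DualNumber R) = TrivSqZeroExt.snd (y c)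
      rw [TrivSqZeroExt.snd_add, TrivSqZeroExt.snd_inl, TrivSqZeroExt.snd_inr, zero_add]
      rfl

variable {P : ι → Type u} [∀ i, AddCommGroup (P i)] [∀ i, Module R (P i)]
  [∀ i, Module.Finite R (P i)] [∀ i, Module.Projective R (P i)]
  (φ : ∀ i, P i →ₛₗ[frob p R] P i) (α : ∀ i, GrpFunctorIso (A i) (frobLinearGrp (φ i)))

/-- The value of an element of `⨂ P_i` at points of the `A_i`. -/
def isoEval {S : CommAlgCat.{u} R} (a : ∀ i, (A i).obj S) : PiTensorProduct R P →ₗ[R] S :=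
  tensorEval φ fun i => (α i).equiv S (a i)

/-- The poly-additive map `1 + ε t`, transported along isomorphisms. -/
def isoTangent (t : PiTensorProduct R P) : PolyAddOver A (Gm R) (dualBase R) :=
  (tangent φ t).comp fun i => (α i).hom

theorem isoTangent_injective : Function.Injective (isoTangent φ α) := by
  intro t t' h
  apply tangent_injective φ
  have h1 := congrArg (fun f : PolyAddOver A (Gm R) (dualBase R) =>
    f.comp fun i => (α i).symm.hom) h
  simp only [isoTangent] at h1
  have hid : ∀ i, (α i).symm.hom ≫ (α i).hom = 𝟙 _ := fun i => (α i).symm.hom_symm_hom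
  rwa [PolyAddOver.comp_comp_of_id _ _ hid, PolyAddOver.comp_comp_of_id _ _ hid] at h1

/-- Points over all R-algebras separate ⨂ P_i: equal values give equal maps 1 + ε t, which determine
t. Identities in ⨂ P_i can therefore be checked after evaluation. -/
theorem isoTangent_congr {t t' : PiTensorProduct R P}
    (h : ∀ (S : CommAlgCat.{u} R) (a : ∀ i, (A i).obj S), isoEval φ α a t = isoEval φ α a t') :
    t = t' := by
  apply isoTangent_injective φ α
  refine Chart.polyAddOver_ext fun T a => ?_
  change 1 + underHom T (dualEps R) * isoEval φ α a t = 1 + underHom T (dualEps R) * isoEval φ α a t'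
  rw [h]

theorem polyAddDifferential_isoTangent (t : PiTensorProduct R P) (S : CommAlgCat.{u} R)
    (a : ∀ i, (A i).obj S) : polyAddDifferential (isoTangent φ α t) S a = isoEval φ α a t := by
  have h1 : isoEval φ α (fun i => ((A i).map (dualInl S)).hom (a i)) t =
      (dualInl S).hom (isoEval φ α a t) := by
    rw [isoEval, isoEval, ← tensorEval_map]
    congr 2
    funext i
    exact (α i).naturality (dualInl S) (a i)
  have h2 : (dualStructure S).hom (dualEps R) = (DualNumber.eps : DualNumber S) :=
    DualNumber.lift_apply_eps _
  have h3 : ∀ e z : DualNumber S, e = DualNumber.eps → z = TrivSqZeroExt.inl (isoEval φ α a t) →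
      TrivSqZeroExt.snd (1 + e * z) = isoEval φ α a t := by
    rintro e z rfl rfl
    simp
  exact h3 _ _ h2 h1

theorem exists_kernelPoly_eq_isoTangent (D : lieAlg R K) :
    ∃ t, isoTangent φ α t = kernelPoly κ (tangentPoint D) := by
  obtain ⟨t, ht⟩ := exists_tangent φ ((kernelPoly κ (tangentPoint D)).comp fun i => (α i).symm.hom)
    (by
      have h : (kernelPoly κ (tangentPoint D)).baseChange (frobHom p (dualBase R)) = 1 :=
        (κ.equiv _ (tangentPoint D)).2
      change ((kernelPoly κ (tangentPoint D)).baseChange (frobHom p (dualBase R))).comp _ = 1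
      rw [h]
      rfl)
    (by
      change ((kernelPoly κ (tangentPoint D)).baseChange (dualFst R)).comp _ = 1
      rw [← kernelPoly_map, tangentPoint_map_dualFst]
      have h : kernelPoly κ (1 : (specGrp R K).obj (CommAlgCat.of R R)) = 1 :=
        congrArg Subtype.val (map_one (κ.equiv _))
      rw [h]
      rfl)
  exact ⟨t, by rw [isoTangent, ht, PolyAddOver.comp_comp_of_id _ _ fun i => (α i).hom_symm_hom]⟩

theorem exists_tangentPoint_of_isoTangent (t : PiTensorProduct R P) :
    ∃ D, kernelPoly κ (tangentPoint D) = isoTangent φ α t := by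
  have h1 : (isoTangent φ α t).baseChange (frobHom p (dualBase R)) = 1 := by
    change ((tangent φ t).baseChange (frobHom p (dualBase R))).comp _ = 1
    rw [tangent_baseChange_frobHom]
    rfl
  obtain ⟨x, hx⟩ := (κ.equiv (dualBase R)).surjective ⟨isoTangent φ α t, h1⟩
  have hx' : kernelPoly κ x = isoTangent φ α t := congrArg Subtype.val hx
  obtain ⟨D, rfl⟩ := exists_tangentPoint x (by
    apply kernelPoly_injective κ
    rw [kernelPoly_map, hx']
    change ((tangent φ t).baseChange (dualFst R)).comp _ = _
    rw [tangent_baseChange_dualFst]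
    exact (congrArg Subtype.val (map_one (κ.equiv (CommAlgCat.of R R)))).symm)
  exact ⟨D, hx'⟩

/-- The restricted Lie algebra of the Frobenius kernel of the functor of poly-additive maps on
functors isomorphic to `A_{P_i,φ_i}`. -/
theorem exists_lieAlg_equiv : ∃ e : lieAlg R K ≃ₗ[R] PiTensorProduct R P,
    (∀ D, e (pOperation R K p D) = tensorPLinear φ (e D)) ∧
      ∀ (D : lieAlg R K) (S : CommAlgCat.{u} R) (a : ∀ i, (A i).obj S),
        polyAddDifferential (κ.equiv _ (tangentPoint D)).1 S a = isoEval φ α a (e D) := by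
  choose e he using exists_kernelPoly_eq_isoTangent κ φ α
  -- The value of e D at a is that of an algebra homomorphism at D. Its linearity makes e linear,
  -- and its multiplicativity turns D ^ p into a p-th power.
  have hd : ∀ (D : lieAlg R K) (S : CommAlgCat.{u} R) (a : ∀ i, (A i).obj S),
      isoEval φ α a (e D) = (evalChar κ a).pairingHom D.1 := by
    intro D S a
    rw [← polyAddDifferential_isoTangent, he]
    exact polyAddDifferential_tangentPoint κ D S a
  let l : lieAlg R K →ₗ[R] PiTensorProduct R P :=
    { toFun := e
      map_add' := fun D D' => isoTangent_congr φ α fun S a => by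
        rw [map_add, hd, hd, hd]
        exact map_add _ _ _
      map_smul' := fun r D => isoTangent_congr φ α fun S a => by
        rw [map_smul, hd, hd]
        exact map_smul _ _ _ }
  have hl : Function.Bijective l := by
    refine ⟨fun D D' h => ?_, fun t => ?_⟩
    · apply tangentPoint_injective
      apply kernelPoly_injective κ
      rw [← he, ← he]
      exact congrArg _ h
    · obtain ⟨D, hD⟩ := exists_tangentPoint_of_isoTangent κ φ α t
      exact ⟨D, isoTangent_injective φ α ((he D).trans hD)⟩
  refine ⟨LinearEquiv.ofBijective l hl, fun D => isoTangent_congr φ α fun S a => ?_,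
    fun D S a => ?_⟩
  · refine (hd _ S a).trans ?_
    refine Eq.trans ?_ (tensorEval_tensorPLinear φ (fun i => (α i).equiv S (a i)) (e D)).symm
    refine Eq.trans (map_pow (evalChar κ a).pairingHom D.1 p) ?_
    rw [← hd]
    rfl
  · exact (polyAddDifferential_tangentPoint κ D S a).trans (hd D S a).symm

end LieKernel

/-! ### Bases away from an element -/

section Away

variable {R : Type*} [CommRing R] {M : Type*} [AddCommGroup M] [Module R M] (f : R)

/-- The elements which lie in `N` up to a power of `f`. -/
def awaySat (N : Submodule R M) : Submodule R M where
  carrier := {x | ∃ k : ℕ, f ^ k • x ∈ N}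
  zero_mem' := ⟨0, by simp⟩
  add_mem' := by
    rintro x y ⟨k, hk⟩ ⟨l, hl⟩
    refine ⟨k + l, ?_⟩
    rw [smul_add]
    refine N.add_mem ?_ ?_
    · rw [add_comm, pow_add, mul_smul]
      exact N.smul_mem _ hk
    · rw [pow_add, mul_smul]
      exact N.smul_mem _ hl
  smul_mem' := by
    rintro r x ⟨k, hk⟩
    refine ⟨k, ?_⟩
    rw [smul_comm]
    exact N.smul_mem _ hk

variable {f}

theorem le_awaySat (N : Submodule R M) : N ≤ awaySat f N := fun x hx => ⟨0, by simpa using hx⟩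

theorem awaySat_le {N N' : Submodule R M} (h : N ≤ awaySat f N') : awaySat f N ≤ awaySat f N' := by
  rintro x ⟨k, hk⟩
  obtain ⟨l, hl⟩ := h hk
  exact ⟨l + k, by rwa [pow_add, mul_smul]⟩

theorem mem_awaySat_of_smul {N : Submodule R M} {x : M} (k : ℕ) (h : f ^ k • x ∈ awaySat f N) :
    x ∈ awaySat f N := by
  obtain ⟨l, hl⟩ := h
  exact ⟨l + k, by rwa [pow_add, mul_smul]⟩

theorem exists_pow_smul_eq_zero_of_finite {ι : Type*} [Finite ι] {x : ι → M}
    (h : ∀ i, ∃ k : ℕ, f ^ k • x i = 0) : ∃ k : ℕ, ∀ i, f ^ k • x i = 0 := by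
  classical
  have := Fintype.ofFinite ι
  choose k hk using h
  refine ⟨∑ i, k i, fun i => ?_⟩
  rw [← Finset.sum_erase_add _ _ (Finset.mem_univ i), pow_add, mul_smul, hk, smul_zero]

/-- A linear map on a finite module which is pointwise `f`-torsion is `f`-torsion. -/
theorem LinearMap.exists_pow_smul_eq_zero [Module.Finite R M] {N : Type*} [AddCommGroup N]
    [Module R N] (l : M →ₗ[R] N) (h : ∀ m, ∃ k : ℕ, f ^ k • l m = 0) : ∃ k : ℕ, f ^ k • l = 0 := by
  obtain ⟨n, g, hg⟩ := Module.Finite.exists_fin' R M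
  obtain ⟨k, hk⟩ := exists_pow_smul_eq_zero_of_finite (f := f)
    (x := fun i : Fin n => l (g (Pi.single i 1))) fun i => h _
  refine ⟨k, ?_⟩
  have : (f ^ k • l) ∘ₗ g = 0 := by
    apply LinearMap.pi_ext'
    intro i
    ext
    simpa using hk i
  ext m
  obtain ⟨y, rfl⟩ := hg m
  exact LinearMap.congr_fun this y

variable (f) in
/-- A finite family which becomes a basis when `f` is inverted. -/
structure IsBasisAway {σ : Type*} [Fintype σ] (b : σ → M) : Prop where
  span : ∀ x, x ∈ awaySat f (Submodule.span R (Set.range b))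
  indep : ∀ a : σ → R, ∑ j, a j • b j = 0 → ∃ k : ℕ, ∀ j, f ^ k * a j = 0

theorem IsBasisAway.exists_sum {σ : Type*} [Fintype σ] {b : σ → M} (hb : IsBasisAway f b) (x : M) :
    ∃ (k : ℕ) (a : σ → R), f ^ k • x = ∑ j, a j • b j := by
  obtain ⟨k, hk⟩ := hb.span x
  obtain ⟨a, ha⟩ := (Submodule.mem_span_range_iff_exists_fun R).1 hk
  exact ⟨k, a, ha.symm⟩

theorem exists_pow_mul_eq_zero_dvd {g : R} (h : f ∣ g) {r : R} {k : ℕ} (hk : f ^ k * r = 0) :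
    g ^ k * r = 0 := by
  obtain ⟨c, rfl⟩ := h
  rw [mul_pow, mul_assoc, mul_left_comm, hk, mul_zero]

theorem IsBasisAway.of_dvd {σ : Type*} [Fintype σ] {b : σ → M} (hb : IsBasisAway f b) {g : R}
    (h : f ∣ g) : IsBasisAway g b where
  span x := by
    obtain ⟨k, hk⟩ := hb.span x
    obtain ⟨c, rfl⟩ := h
    exact ⟨k, by rw [mul_pow, mul_comm, mul_smul]; exact Submodule.smul_mem _ _ hk⟩
  indep a ha := by
    obtain ⟨k, hk⟩ := hb.indep a ha
    exact ⟨k, fun j => exists_pow_mul_eq_zero_dvd h (hk j)⟩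

/-- A linear map which is `f`-torsion on a basis away from `f` is `f`-torsion. -/
theorem IsBasisAway.exists_pow_smul_eq_zero [Module.Finite R M] {N : Type*} [AddCommGroup N]
    [Module R N] {σ : Type*} [Fintype σ] {b : σ → M} (hb : IsBasisAway f b) (l : M →ₗ[R] N)
    (h : ∀ j, ∃ k : ℕ, f ^ k • l (b j) = 0) : ∃ k : ℕ, f ^ k • l = 0 := by
  refine l.exists_pow_smul_eq_zero fun m => ?_
  obtain ⟨k, a, hk⟩ := hb.exists_sum m
  obtain ⟨k', hk'⟩ := exists_pow_smul_eq_zero_of_finite h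
  refine ⟨k' + k, ?_⟩
  rw [pow_add, mul_smul, ← map_smul, hk, map_sum, Finset.smul_sum]
  refine Finset.sum_eq_zero fun j _ => ?_
  rw [map_smul, smul_comm, hk', smul_zero]

theorem exists_dual_basis (R M : Type*) [CommRing R] [AddCommGroup M] [Module R M]
    [Module.Finite R M] [Module.Projective R M] :
    ∃ (n : ℕ) (c : Fin n → M) (l : Fin n → (M →ₗ[R] R)), ∀ x, ∑ k, l k x • c k = x := by
  obtain ⟨n, v, hv⟩ := Module.Finite.exists_fin' R M
  obtain ⟨u, hu⟩ := Module.projective_lifting_property v LinearMap.id hv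
  refine ⟨n, fun k => v fun j => if k = j then 1 else 0, fun k => LinearMap.proj k ∘ₗ u,
    fun x => ?_⟩
  exact (LinearMap.pi_apply_eq_sum_univ v (u x)).symm.trans (LinearMap.congr_fun hu x)

/-- Dual functionals to a basis away from `f`. -/
theorem IsBasisAway.exists_dual [Module.Finite R M] [Module.Projective R M] {σ : Type*} [Fintype σ]
    [DecidableEq σ] {b : σ → M} (hb : IsBasisAway f b) :
    ∃ (N : ℕ) (l : σ → (M →ₗ[R] R)), ∀ i j, l j (b i) = if i = j then f ^ N else 0 := by
  obtain ⟨n, c, m, hc⟩ := exists_dual_basis R M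
  choose k r hk using fun i => hb.exists_sum (c i)
  let K := ∑ i, k i
  -- The exponent K is a common denominator for all the generators c i.
  have hr : ∀ i, ∃ r' : σ → R, f ^ K • c i = ∑ j, r' j • b j := by
    intro i
    refine ⟨fun j => f ^ (∑ i' ∈ Finset.univ.erase i, k i') * r i j, ?_⟩
    simp only [K, mul_smul]
    rw [← Finset.smul_sum, ← hk, ← mul_smul, ← pow_add, Finset.sum_erase_add _ _ (Finset.mem_univ i)]
  choose r' hr' using hr
  let l : σ → (M →ₗ[R] R) := fun j => ∑ i, r' i j • m i
  have hl : ∀ x, ∑ j, l j x • b j = f ^ K • x := by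
    intro x
    conv_rhs => rw [← hc x, Finset.smul_sum]
    simp only [l, LinearMap.sum_apply, Finset.sum_smul, LinearMap.smul_apply, smul_eq_mul]
    rw [Finset.sum_comm]
    refine Finset.sum_congr rfl fun i _ => ?_
    rw [smul_comm, hr', Finset.smul_sum]
    exact Finset.sum_congr rfl fun j _ => by rw [mul_comm, mul_smul]
  -- Since Σ_j l_j(b_i) b_j = f ^ K b_i, independence away from f gives l_j(b_i) = f ^ K δ_ij up to
  -- f-torsion, which a further power of f removes.
  have ht : ∀ i, ∃ k : ℕ, ∀ j, f ^ k * (l j (b i) - if i = j then f ^ K else 0) = 0 := by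
    intro i
    refine hb.indep _ ?_
    simp only [sub_smul, Finset.sum_sub_distrib, hl, ite_smul, zero_smul, Finset.sum_ite_eq,
      Finset.mem_univ, if_true, sub_self]
  obtain ⟨L, hL⟩ := exists_pow_smul_eq_zero_of_finite (f := f)
    (x := fun i j => l j (b i) - if i = j then f ^ K else 0) (fun i => by
      obtain ⟨k, hk⟩ := ht i
      exact ⟨k, funext hk⟩)
  refine ⟨L + K, fun j => f ^ L • l j, fun i j => ?_⟩
  have h1 : f ^ L * (l j (b i) - if i = j then f ^ K else 0) = 0 := congrFun (hL i) j
  rw [mul_sub, sub_eq_zero] at h1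
  rw [LinearMap.smul_apply, smul_eq_mul, h1, pow_add]
  split_ifs <;> simp

end Away

/-! ### Bases away from f compared with bases over the localization -/

section AwayLocalization

variable {R : Type u} [CommRing R] {M : Type u} [AddCommGroup M] [Module R M] {f : R}

theorem exists_one_tmul (x : Localization.Away f ⊗[R] M) : ∃ (k : ℕ) (m : M),
    algebraMap R (Localization.Away f) f ^ k • x = 1 ⊗ₜ m := by
  obtain ⟨⟨m, ⟨_, k, rfl⟩⟩, h⟩ := IsLocalizedModule.surj (Submonoid.powers f)
    (TensorProduct.mk R (Localization.Away f) M 1) x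
  refine ⟨k, m, ?_⟩
  rw [← map_pow, algebraMap_smul]
  exact h

theorem one_tmul_eq_zero_iff (m : M) : (1 : Localization.Away f) ⊗ₜ[R] m = 0 ↔
    ∃ k : ℕ, f ^ k • m = 0 := by
  rw [← TensorProduct.mk_apply, IsLocalizedModule.eq_zero_iff (Submonoid.powers f)]
  constructor
  · rintro ⟨⟨_, k, rfl⟩, h⟩
    exact ⟨k, h⟩
  · rintro ⟨k, h⟩
    exact ⟨⟨f ^ k, k, rfl⟩, h⟩

theorem isUnit_algebraMap_away : IsUnit (algebraMap R (Localization.Away f) f) :=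
  IsLocalization.Away.algebraMap_isUnit f

theorem exists_algebraMap_eq (a : Localization.Away f) : ∃ (k : ℕ) (r : R),
    algebraMap R (Localization.Away f) f ^ k * a = algebraMap R _ r := by
  obtain ⟨⟨r, ⟨_, k, rfl⟩⟩, h⟩ := IsLocalization.surj (Submonoid.powers f) a
  refine ⟨k, r, ?_⟩
  rw [← map_pow, mul_comm]
  exact h

theorem algebraMap_eq_zero_away_iff (r : R) : algebraMap R (Localization.Away f) r = 0 ↔
    ∃ k : ℕ, f ^ k * r = 0 := by
  rw [IsLocalization.map_eq_zero_iff (Submonoid.powers f)]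
  constructor
  · rintro ⟨⟨_, k, rfl⟩, h⟩
    exact ⟨k, h⟩
  · rintro ⟨k, h⟩
    exact ⟨⟨f ^ k, k, rfl⟩, h⟩

theorem exists_algebraMap_eq_of_finite {σ : Type*} [Fintype σ] (a : σ → Localization.Away f) :
    ∃ (k : ℕ) (r : σ → R), ∀ j, algebraMap R (Localization.Away f) f ^ k * a j =
      algebraMap R _ (r j) := by
  classical
  choose k r hk using fun j => exists_algebraMap_eq (a j)
  refine ⟨∑ j, k j, fun j => f ^ (∑ i ∈ Finset.univ.erase j, k i) * r j, fun j => ?_⟩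
  rw [map_mul, ← hk, ← mul_assoc, map_pow, ← pow_add, Finset.sum_erase_add _ _ (Finset.mem_univ j)]

theorem sum_tmul_eq {σ : Type*} [Fintype σ] (r : σ → R) (b : σ → M) :
    ∑ j, algebraMap R (Localization.Away f) (r j) • ((1 : Localization.Away f) ⊗ₜ[R] b j) =
      1 ⊗ₜ ∑ j, r j • b j := by
  rw [TensorProduct.tmul_sum]
  refine Finset.sum_congr rfl fun j _ => ?_
  rw [algebraMap_smul, TensorProduct.tmul_smul]

/-- A basis of the localization which comes from the module. -/
theorem IsBasisAway.of_basis {σ : Type*} [Fintype σ]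
    (B : Module.Basis σ (Localization.Away f) (Localization.Away f ⊗[R] M)) (b : σ → M)
    (hB : ∀ j, B j = 1 ⊗ₜ b j) : IsBasisAway f b where
  span x := by
    obtain ⟨k, r, hr⟩ := exists_algebraMap_eq_of_finite fun j => B.repr (1 ⊗ₜ x) j
    have h1 : (1 : Localization.Away f) ⊗ₜ[R] (f ^ k • x) = 1 ⊗ₜ ∑ j, r j • b j := by
      rw [← sum_tmul_eq]
      simp only [← hr, mul_smul, ← hB]
      rw [← Finset.smul_sum, B.sum_repr, ← map_pow, algebraMap_smul, TensorProduct.tmul_smul]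
    rw [← sub_eq_zero, ← TensorProduct.tmul_sub, one_tmul_eq_zero_iff] at h1
    obtain ⟨l, hl⟩ := h1
    refine ⟨l + k, ?_⟩
    rw [smul_sub, sub_eq_zero, ← mul_smul, ← pow_add] at hl
    rw [hl]
    exact Submodule.smul_mem _ _ (Submodule.sum_mem _ fun j _ =>
      Submodule.smul_mem _ _ (Submodule.subset_span ⟨j, rfl⟩))
  indep a ha := by
    have h1 : ∑ j, algebraMap R (Localization.Away f) (a j) • B j = 0 := by
      simp only [hB]
      rw [sum_tmul_eq, ha, TensorProduct.tmul_zero]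
    have h2 := Fintype.linearIndependent_iff.1 B.linearIndependent _ h1
    exact exists_pow_smul_eq_zero_of_finite (f := f) (x := a) fun j => (algebraMap_eq_zero_away_iff _).1 (h2 j)

theorem IsBasisAway.nonempty_basis {σ : Type*} [Fintype σ] {b : σ → M} (hb : IsBasisAway f b) :
    Nonempty (Module.Basis σ (Localization.Away f) (Localization.Away f ⊗[R] M)) := by
  have hu : ∀ k : ℕ, IsUnit (algebraMap R (Localization.Away f) f ^ k) := fun k =>
    isUnit_algebraMap_away.pow k
  refine ⟨Module.Basis.mk (v := fun j => (1 : Localization.Away f) ⊗ₜ[R] b j) ?_ ?_⟩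
  · rw [Fintype.linearIndependent_iff]
    intro a ha j
    obtain ⟨k, r, hr⟩ := exists_algebraMap_eq_of_finite a
    have h1 : (1 : Localization.Away f) ⊗ₜ[R] ∑ j, r j • b j = 0 := by
      rw [← sum_tmul_eq]
      simp only [← hr, mul_smul]
      rw [← Finset.smul_sum, ha, smul_zero]
    obtain ⟨l, hl⟩ := (one_tmul_eq_zero_iff _).1 h1
    rw [Finset.smul_sum] at hl
    simp only [← mul_smul] at hl
    obtain ⟨l', hl'⟩ := hb.indep _ hl
    have h2 : algebraMap R (Localization.Away f) (r j) = 0 :=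
      (algebraMap_eq_zero_away_iff _).2 ⟨l' + l, by rw [pow_add, mul_assoc, hl']⟩
    rw [← hr] at h2
    exact (hu k).mul_right_eq_zero.1 h2
  · intro x _
    obtain ⟨k, m, hm⟩ := exists_one_tmul x
    obtain ⟨l, a, hl⟩ := hb.exists_sum m
    rw [← Submodule.smul_mem_iff_of_isUnit _ (hu (l + k)), pow_add, mul_smul, hm, ← map_pow,
      algebraMap_smul, ← TensorProduct.tmul_smul, hl, ← sum_tmul_eq]
    exact Submodule.sum_mem _ fun j _ => Submodule.smul_mem _ _ (Submodule.subset_span ⟨j, rfl⟩)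

theorem span_eq_top_of_forall_prime {s : Set R}
    (h : ∀ 𝔭 : PrimeSpectrum R, ∃ f ∈ s, f ∉ 𝔭.asIdeal) : Ideal.span s = ⊤ := by
  by_contra hs
  obtain ⟨m, hm, hsm⟩ := Ideal.exists_le_maximal _ hs
  obtain ⟨f, hf, hfm⟩ := h ⟨m, hm.isPrime⟩
  exact hfm (hsm (Ideal.subset_span hf))

/-- A module which has bases Zariski-locally is finitely generated and projective. -/
theorem finite_and_projective_of_isBasisAway
    (h : ∀ 𝔭 : PrimeSpectrum R, ∃ f ∉ 𝔭.asIdeal, ∃ (n : ℕ) (b : Fin n → M), IsBasisAway f b) :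
    Module.Finite R M ∧ Module.Projective R M := by
  -- Finite presentation and flatness are checked on the cover given by s, and a finitely presented
  -- flat module is projective.
  let s : Set R := {f | ∃ (n : ℕ) (b : Fin n → M), IsBasisAway f b}
  have hs : Ideal.span s = ⊤ := span_eq_top_of_forall_prime fun 𝔭 => by
    obtain ⟨f, hf, hb⟩ := h 𝔭
    exact ⟨f, hb, hf⟩
  have hfree : ∀ g : s, ∃ n : ℕ, Nonempty (Module.Basis (Fin n) (Localization.Away g.1)
      (Localization.Away g.1 ⊗[R] M)) := by
    rintro ⟨g, n, b, hb⟩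
    exact ⟨n, hb.nonempty_basis⟩
  have hfp : Module.FinitePresentation R M :=
    Module.FinitePresentation.of_localizationSpan' s hs
      (Rₚ := fun g => Localization.Away g.1) (fun g => TensorProduct.mk R (Localization.Away g.1) M 1)
      fun g => by
        obtain ⟨n, ⟨B⟩⟩ := hfree g
        have := Module.Finite.of_basis B
        have := Module.Free.of_basis B
        exact Module.finitePresentation_of_projective _ _
  have hflat : Module.Flat R M := by
    refine Module.flat_of_isLocalized_span R M s hs (fun g => Localization.Away g.1 ⊗[R] M)
      (fun g => TensorProduct.mk R (Localization.Away g.1) M 1) fun g => ?_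
    obtain ⟨n, ⟨B⟩⟩ := hfree g
    have := Module.Free.of_basis B
    exact (Module.flat_iff_of_isLocalization (Localization.Away g.1) (Submonoid.powers g.1) _).1
      inferInstance
  exact ⟨inferInstance, Module.Flat.projective_of_finitePresentation⟩

end AwayLocalization

/-! ### Local coordinates on a 1-smooth group scheme -/

section LocalCoord

variable {p : ℕ} [hp : Fact p.Prime]

/-- The exponent vectors with entries less than `p`, as finitely supported functions. -/
noncomputable def finExp {r : ℕ} (b : Fin r → Fin p) : Fin r →₀ ℕ := Finsupp.equivFunOnFinite.symm fun j => b j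

@[simp] theorem finExp_apply {r : ℕ} (b : Fin r → Fin p) (j : Fin r) : finExp b j = b j := rfl

theorem finExp_injective {r : ℕ} : Function.Injective (finExp (p := p) (r := r)) := by
  intro b b' h
  funext j
  exact Fin.ext (DFunLike.congr_fun h j)

theorem exists_finExp_eq {r : ℕ} {e : Fin r →₀ ℕ} (h : ∀ j, e j < p) :
    ∃ b : Fin r → Fin p, finExp b = e :=
  ⟨fun j => ⟨e j, h j⟩, by ext j; rfl⟩

theorem monomial_finExp {A : Type*} [CommRing A] {r : ℕ} (b : Fin r → Fin p) :
    MvPolynomial.monomial (finExp b) (1 : A) = ∏ j, MvPolynomial.X j ^ (b j : ℕ) := by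
  rw [MvPolynomial.monomial_eq, Finsupp.prod_fintype _ _ (by simp)]
  simp

theorem span_truncIdeal {A : Type u} [CommRing A] {r : ℕ} :
    Ideal.span (Set.range fun i : Fin r => (MvPolynomial.X i : MvPolynomial (Fin r) A) ^ p ^ 1) =
      FrobRel.relIdeal p (0 : Fin r → Fin r → A) := by
  rw [FrobRel.relIdeal]
  congr 2
  funext i
  simp [FrobRel.rel]

theorem prod_truncX {A : Type u} [CommRing A] {r : ℕ} (b : Fin r → Fin p) :
    ∏ j, truncX p A j ^ (b j : ℕ) = Ideal.Quotient.mk _ (MvPolynomial.monomial (finExp b) 1) := by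
  rw [monomial_finExp, map_prod]
  simp only [map_pow]
  rfl

theorem sum_smul_prod_truncX {A : Type u} [CommRing A] {r : ℕ} (a : (Fin r → Fin p) → A) :
    ∑ b, a b • ∏ j, truncX p A j ^ (b j : ℕ) =
      Ideal.Quotient.mk _ (∑ b, MvPolynomial.monomial (finExp b) (a b)) := by
  rw [map_sum]
  refine Finset.sum_congr rfl fun b _ => ?_
  rw [prod_truncX]
  have : MvPolynomial.monomial (finExp b) (a b) = a b • MvPolynomial.monomial (finExp b) (1 : A) := by
    rw [MvPolynomial.smul_monomial, smul_eq_mul, mul_one]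
  rw [this]
  rfl

/-- The monomial basis of the truncated polynomial ring. -/
noncomputable def truncBasis (p : ℕ) [hp : Fact p.Prime] (r : ℕ) (A : Type u) [CommRing A] :
    Module.Basis (Fin r → Fin p) A (TruncPoly p 1 r A) :=
  Module.Basis.mk (v := fun b => ∏ j, truncX p A j ^ (b j : ℕ))
    (by
      classical
      rw [Fintype.linearIndependent_iff]
      intro a ha b
      rw [sum_smul_prod_truncX, Ideal.Quotient.eq_zero_iff_mem, span_truncIdeal] at ha
      have hred : ∑ b, MvPolynomial.monomial (finExp b) (a b) ∈ FrobRel.reduced p (Fin r) A := by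
        refine Submodule.sum_mem _ fun b _ e i he => ?_
        rw [MvPolynomial.coeff_monomial, if_neg]
        rintro rfl
        exact absurd (b i).2 (not_lt.2 he)
      have h0 := FrobRel.eq_zero_of_reduced_of_mem hp.out.one_lt _ hred ha
      have h1 := congrArg (MvPolynomial.coeff (finExp b)) h0
      rw [MvPolynomial.coeff_sum, MvPolynomial.coeff_zero, Finset.sum_eq_single b] at h1
      · simpa using h1
      · intro b' _ hb'
        rw [MvPolynomial.coeff_monomial, if_neg fun h => hb' (finExp_injective h)]
      · simp)
    (by
      classical
      intro z _
      obtain ⟨F, rfl⟩ := Ideal.Quotient.mk_surjective z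
      obtain ⟨G, hG, hFG⟩ := FrobRel.exists_reduced hp.out.one_lt (0 : Fin r → Fin r → A) F
      rw [← span_truncIdeal] at hFG
      rw [Ideal.Quotient.eq.2 hFG, MvPolynomial.as_sum G, map_sum]
      refine Submodule.sum_mem _ fun e he => ?_
      obtain ⟨b, rfl⟩ := exists_finExp_eq (p := p) (e := e) fun j => by
        by_contra h
        exact MvPolynomial.mem_support_iff.1 he (hG e j (not_lt.1 h))
      have : (Ideal.Quotient.mk (Ideal.span (Set.range fun i : Fin r =>
          (MvPolynomial.X i : MvPolynomial (Fin r) A) ^ p ^ 1)))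
          (MvPolynomial.monomial (finExp b) (G.coeff (finExp b))) =
          G.coeff (finExp b) • ∏ j, truncX p A j ^ (b j : ℕ) := by
        rw [prod_truncX]
        have : MvPolynomial.monomial (finExp b) (G.coeff (finExp b)) =
            G.coeff (finExp b) • MvPolynomial.monomial (finExp b) (1 : A) := by
          rw [MvPolynomial.smul_monomial, smul_eq_mul, mul_one]
        rw [this]
        rfl
      rw [this]
      exact Submodule.smul_mem _ _ (Submodule.subset_span ⟨b, rfl⟩))

theorem truncBasis_apply (r : ℕ) (A : Type u) [CommRing A] (b : Fin r → Fin p) :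
    truncBasis p r A b = ∏ j, truncX p A j ^ (b j : ℕ) := Module.Basis.mk_apply _ _ _

variable {R : Type u} [CommRing R] {C : Type u} [CommRing C] [HopfAlgebra R C]

/-- Functions on `Spec C` vanishing at the unit section, which become coordinates when `f` is
inverted. -/
structure IsLocalCoord (p : ℕ) (f : R) {r : ℕ} (x : Fin r → C) : Prop where
  counit : ∀ j, Coalgebra.counit (R := R) (x j) = 0
  pow : ∀ j, x j ^ p = 0
  basis : IsBasisAway f fun b : Fin r → Fin p => ∏ j, x j ^ (b j : ℕ)

/-- A power of f times the local coordinate e⁻¹(x_j) comes from C. Further powers of f kill the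
torsion, so the vanishing of the counit and of the p-th power holds in C itself. -/
theorem IsSmoothOfRank.exists_isLocalCoord {r : PrimeSpectrum R → ℕ} (h : IsSmoothOfRank p 1 C r)
    (𝔭 : PrimeSpectrum R) : ∃ f ∉ 𝔭.asIdeal, ∃ x : Fin (r 𝔭) → C, IsLocalCoord p f x := by
  obtain ⟨f, hf, e, he⟩ := h 𝔭
  refine ⟨f, hf, ?_⟩
  let A := Localization.Away f
  let t : A := algebraMap R A f
  have ht : IsUnit t := isUnit_algebraMap_away
  have h1 : ∀ j, ∃ (m : ℕ) (x : C), Coalgebra.counit (R := R) x = 0 ∧ x ^ p = 0 ∧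
      (1 : A) ⊗ₜ[R] x = t ^ m • e.symm (truncX p A j) := by
    intro j
    obtain ⟨k, c, hc⟩ := exists_one_tmul (e.symm (truncX p A j))
    have h2 : algebraMap R A (Coalgebra.counit (R := R) c) = 0 := by
      rw [← he, ← hc, map_smul, AlgEquiv.apply_symm_apply, map_smul, truncAug_truncX, smul_zero]
    have h3 : (1 : A) ⊗ₜ[R] (c ^ p) = 0 := by
      have : (1 : A) ⊗ₜ[R] (c ^ p) = (1 ⊗ₜ c) ^ p := by
        rw [Algebra.TensorProduct.tmul_pow, one_pow]
      rw [this, ← hc, smul_pow, ← map_pow e.symm, truncX_pow, map_zero, smul_zero]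
    obtain ⟨l, hl⟩ := (algebraMap_eq_zero_away_iff _).1 h2
    obtain ⟨l', hl'⟩ := (one_tmul_eq_zero_iff _).1 h3
    -- The factor f ^ l makes the counit vanish, and f ^ l' the p-th power.
    refine ⟨l + l' + k, f ^ (l + l') • c, ?_, ?_, ?_⟩
    · rw [map_smul, smul_eq_mul, add_comm, pow_add, mul_assoc, hl, mul_zero]
    · have h4 : (f ^ (l + l')) ^ p = (f ^ ((l + l') * (p - 1)) * f ^ l) * f ^ l' := by
        rw [mul_assoc, ← pow_add, ← pow_add, ← pow_mul]
        congr 1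
        have : p = p - 1 + 1 := (Nat.succ_pred_eq_of_pos hp.out.pos).symm
        conv_lhs => rw [this]
        ring
      rw [smul_pow, h4, mul_smul, hl', smul_zero]
    · rw [TensorProduct.tmul_smul, ← hc, pow_add t, mul_smul]
      refine (algebraMap_smul A (f ^ (l + l')) _).symm.trans ?_
      rw [map_pow]
  choose m x hx0 hxp hx using h1
  refine ⟨x, hx0, hxp, ?_⟩
  -- Rescaling the coordinate x_j by f ^ m_j rescales the monomial basis by units of the
  -- localization.
  let B := ((truncBasis p (r 𝔭) A).map e.symm.toLinearEquiv).unitsSMul fun b =>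
    ∏ j, (ht.unit ^ m j) ^ (b j : ℕ)
  refine IsBasisAway.of_basis B _ fun b => ?_
  rw [Module.Basis.unitsSMul_apply, Module.Basis.map_apply, truncBasis_apply]
  have h5 : (1 : A) ⊗ₜ[R] ∏ j, x j ^ (b j : ℕ) = ∏ j, ((1 : A) ⊗ₜ[R] x j) ^ (b j : ℕ) := by
    let i : C →ₐ[R] A ⊗[R] C := Algebra.TensorProduct.includeRight
    exact (map_prod i _ _).trans (Finset.prod_congr rfl fun j _ => map_pow i _ _)
  rw [h5]
  simp only [hx, smul_pow]
  rw [Units.smul_def, Units.coe_prod, Finset.prod_smul]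
  congr 1
  exact (map_prod e.symm _ _).trans (Finset.prod_congr rfl fun j _ => map_pow e.symm _ _)

theorem IsSmoothOfRank.finite_and_projective {r : PrimeSpectrum R → ℕ}
    (h : IsSmoothOfRank p 1 C r) : Module.Finite R C ∧ Module.Projective R C :=
  finite_and_projective_of_isBasisAway fun 𝔭 => by
    obtain ⟨f, hf, x, hx⟩ := h.exists_isLocalCoord 𝔭
    let e := Fintype.equivFin (Fin (r 𝔭) → Fin p)
    refine ⟨f, hf, _, fun n => ∏ j, x j ^ (e.symm n j : ℕ), ?_, ?_⟩
    · intro c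
      have := hx.basis.span c
      have h2 : Set.range (fun n => ∏ j, x j ^ (e.symm n j : ℕ)) =
        Set.range fun b : Fin (r 𝔭) → Fin p => ∏ j, x j ^ (b j : ℕ) :=
          e.symm.surjective.range_comp fun b : Fin (r 𝔭) → Fin p => ∏ j, x j ^ (b j : ℕ)
      rwa [h2]
    · intro a ha
      obtain ⟨k, hk⟩ := hx.basis.indep (fun b => a (e b)) (by
        rw [← ha]
        refine Fintype.sum_equiv e _ _ fun b => ?_
        rw [Equiv.symm_apply_apply])
      exact ⟨k, fun n => by simpa using hk (e.symm n)⟩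

end LocalCoord

/-! ### Monomials in a finite family -/

section Mono

variable {R : Type*} [CommRing R] {W : Type*} [CommRing W] [Algebra R W] {r : ℕ} (t : Fin r → W)

/-- The monomial `∏ t_j ^ a_j`. -/
noncomputable def mono (a : Fin r →₀ ℕ) : W := ∏ j, t j ^ a j

theorem mono_zero : mono t 0 = 1 := by simp [mono]

theorem mono_add (a b : Fin r →₀ ℕ) : mono t (a + b) = mono t a * mono t b := by
  simp [mono, pow_add, Finset.prod_mul_distrib]

theorem mono_single (j : Fin r) (n : ℕ) : mono t (Finsupp.single j n) = t j ^ n := by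
  classical
  rw [mono, Finset.prod_eq_single j]
  · simp
  · intro i _ hi
    rw [Finsupp.single_eq_of_ne hi, pow_zero]
  · simp

theorem aeval_monomial_eq_smul_mono (a : Fin r →₀ ℕ) (s : R) :
    MvPolynomial.aeval t (MvPolynomial.monomial a s) = s • mono t a := by
  rw [MvPolynomial.aeval_monomial, Finsupp.prod_fintype _ _ (by simp), Algebra.smul_def, mono]

theorem mono_mem_pow {I : Ideal W} (h : ∀ j, t j ∈ I) (a : Fin r →₀ ℕ) :
    mono t a ∈ I ^ a.degree := by
  rw [mono, Finsupp.degree_eq_sum, ← Finset.prod_pow_eq_pow_sum]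
  exact Ideal.prod_mem_prod fun j _ => Ideal.pow_mem_pow (h j) _

theorem exists_eq_add_single {a : Fin r →₀ ℕ} {n : ℕ} (h : a.degree = n + 1) :
    ∃ j a', a = a' + Finsupp.single j 1 ∧ a'.degree = n := by
  obtain ⟨j, hj⟩ : ∃ j, a j ≠ 0 := by
    by_contra! hc
    rw [Finsupp.ext (g := 0) hc] at h
    simp at h
  have h1 : a = (a - Finsupp.single j 1) + Finsupp.single j 1 :=
    (tsub_add_cancel_of_le (Finsupp.single_le_iff.2 (Nat.one_le_iff_ne_zero.2 hj))).symm
  refine ⟨j, _, h1, ?_⟩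
  rw [h1] at h
  simpa using h

/-- If the `p`-th powers of the `t_j` are linear combinations of the `t_j` up to powers of `f`,
then the monomials with exponents less than `p` span `R[t]` up to powers of `f`. -/
theorem mem_awaySat_of_mem_adjoin {p : ℕ} [hp : Fact p.Prime] {f : R}
    (h : ∀ j, t j ^ p ∈ awaySat f (Submodule.span R (Set.range t))) {z : W}
    (hz : z ∈ Algebra.adjoin R (Set.range t)) :
    z ∈ awaySat f (Submodule.span R (Set.range fun b : Fin r → Fin p => mono t (finExp b))) := by
  set N := Submodule.span R (Set.range fun b : Fin r → Fin p => mono t (finExp b))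
  have key : ∀ (n : ℕ) (a : Fin r →₀ ℕ), a.degree = n → mono t a ∈ awaySat f N := by
    intro n
    induction n using Nat.strong_induction_on with
    | _ n ih =>
    intro a ha
    by_cases hr : ∀ j, a j < p
    · obtain ⟨b, rfl⟩ := exists_finExp_eq hr
      exact le_awaySat _ (Submodule.subset_span ⟨b, rfl⟩)
    · push Not at hr
      obtain ⟨j, hj⟩ := hr
      -- Replacing t_j ^ p by a linear combination of the t_i lowers the degree by p - 1 > 0, at the
      -- cost of a power of f.
      have h1 : a = (a - Finsupp.single j p) + Finsupp.single j p :=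
        (tsub_add_cancel_of_le (Finsupp.single_le_iff.2 hj)).symm
      set a' := a - Finsupp.single j p
      obtain ⟨k, hk⟩ := h j
      obtain ⟨c, hc⟩ := (Submodule.mem_span_range_iff_exists_fun R).1 hk
      refine mem_awaySat_of_smul k ?_
      have h2 : f ^ k • mono t a = ∑ i, c i • mono t (a' + Finsupp.single i 1) := by
        rw [h1, mono_add, mono_single, ← mul_smul_comm, ← hc, Finset.mul_sum]
        refine Finset.sum_congr rfl fun i _ => ?_
        rw [mono_add, mono_single, pow_one, mul_smul_comm]
      rw [h2]
      refine Submodule.sum_mem _ fun i _ => Submodule.smul_mem _ _ (ih _ ?_ _ rfl)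
      have h3 : a.degree = a'.degree + p := by
        conv_lhs => rw [h1]
        simp
      simp only [map_add, Finsupp.degree_single]
      have := hp.out.one_lt
      lia
  obtain ⟨F, rfl⟩ : z ∈ (MvPolynomial.aeval (R := R) t).range := by
    rwa [← Algebra.adjoin_range_eq_range_aeval]
  rw [AlgHom.toRingHom_eq_coe, RingHom.coe_coe, MvPolynomial.as_sum F, map_sum]
  refine Submodule.sum_mem _ fun a _ => ?_
  rw [aeval_monomial_eq_smul_mono]
  exact Submodule.smul_mem _ _ (key _ _ rfl)

theorem derivation_aeval (d : Derivation R W W) (F : MvPolynomial (Fin r) R) :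
    d (MvPolynomial.aeval t F) =
      ∑ i, MvPolynomial.aeval t (MvPolynomial.pderiv i F) * d (t i) := by
  induction F using MvPolynomial.induction_on with
  | C c => simp
  | add F G hF hG => simp [hF, hG, add_mul, Finset.sum_add_distrib]
  | mul_X F n hF =>
    classical
    simp only [map_mul, MvPolynomial.aeval_X, Derivation.leibniz, hF, smul_eq_mul, map_add,
      add_mul, Finset.sum_add_distrib, MvPolynomial.pderiv_X, Finset.mul_sum]
    congr 1
    · rw [Finset.sum_eq_single n]
      · simp
      · intro i _ hi
        simp [hi.symm]
      · simp
    · exact Finset.sum_congr rfl fun i _ => by ring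

theorem derivation_mono (d : Derivation R W W) (b : Fin r →₀ ℕ) :
    d (mono t b) = ∑ i, (b i : W) * mono t (b - Finsupp.single i 1) * d (t i) := by
  have h := derivation_aeval t d (MvPolynomial.monomial b 1)
  rw [aeval_monomial_eq_smul_mono, one_smul] at h
  rw [h]
  refine Finset.sum_congr rfl fun i _ => ?_
  rw [MvPolynomial.pderiv_monomial, aeval_monomial_eq_smul_mono, one_mul, Algebra.smul_def,
    map_natCast]

theorem derivation_mem_pow {I : Ideal W} (d : Derivation R W W) {n : ℕ} {c : W}
    (hc : c ∈ I ^ (n + 1)) : d c ∈ I ^ n := by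
  induction n generalizing c with
  | zero => simp
  | succ n ih =>
    rw [pow_succ] at hc
    induction hc using Submodule.mul_induction_on' with
    | mem_mul_mem a ha b hb =>
      rw [Derivation.leibniz, smul_eq_mul, smul_eq_mul]
      refine Ideal.add_mem _ (Ideal.mul_mem_right _ _ ha) ?_
      rw [pow_succ, mul_comm b]
      exact Ideal.mul_mem_mul (ih ha) hb
    | add a _ b _ ha hb => rw [map_add]; exact Ideal.add_mem _ ha hb

/-- A derivation with `d t_j ≡ s`, `d t_i ≡ 0` acts on monomials like `s` times a partial
derivative, to leading order. -/
theorem derivation_mono_sub_mem {I : Ideal W} (ht : ∀ j, t j ∈ I) (d : Derivation R W W) (s : W)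
    (j : Fin r) (h : ∀ i, d (t i) - (if i = j then s else 0) ∈ I) {b : Fin r →₀ ℕ} {n : ℕ}
    (hb : b.degree = n + 1) :
    d (mono t b) - (b j : W) * mono t (b - Finsupp.single j 1) * s ∈ I ^ (n + 1) := by
  have h1 : (b j : W) * mono t (b - Finsupp.single j 1) * s =
      ∑ i, (b i : W) * mono t (b - Finsupp.single i 1) * (if i = j then s else 0) := by
    simp
  rw [h1, derivation_mono, ← Finset.sum_sub_distrib]
  refine Ideal.sum_mem _ fun i _ => ?_
  rw [← mul_sub]
  by_cases hi : b i = 0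
  · simp [hi]
  · have h2 : (b - Finsupp.single i 1).degree = n := by
      have h3 : b = (b - Finsupp.single i 1) + Finsupp.single i 1 :=
        (tsub_add_cancel_of_le (Finsupp.single_le_iff.2 (Nat.one_le_iff_ne_zero.2 hi))).symm
      rw [h3] at hb
      simpa using hb
    rw [pow_succ]
    refine Ideal.mul_mem_mul (Ideal.mul_mem_left _ _ ?_) (h i)
    rw [← h2]
    exact mono_mem_pow t ht _

end Mono

/-! ### The dual algebra of a 1-smooth group scheme -/

section DualAlgebra

variable {R : Type u} [CommRing R] {C : Type u} [CommRing C] [HopfAlgebra R C]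

/-- The translation operator `c ↦ (1 ⊗ l)(Δ c)` of a functional. -/
noncomputable def convOp (l : WithConv (C →ₗ[R] R)) : C →ₗ[R] C :=
  (coeffMap C l.ofConv).comp Coalgebra.comul

/-- Convolution by m is transposed to an operator on C, so a monomial in tangent vectors can be
evaluated by applying one invariant derivation at a time. -/
theorem mul_apply_eq_convOp (l m : WithConv (C →ₗ[R] R)) (c : C) :
    (l * m) c = l (convOp m c) := by
  change LinearMap.mul' R R (TensorProduct.map l.ofConv m.ofConv (Coalgebra.comul c)) =
    l.ofConv (coeffMap C m.ofConv (Coalgebra.comul c))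
  generalize (Coalgebra.comul (R := R) c : C ⊗[R] C) = z
  induction z with
  | zero => simp
  | add a b ha hb => rw [map_add, map_add, map_add, map_add, ha, hb]
  | tmul a b => simp [mul_comm]

theorem convOp_one (c : C) : convOp (1 : WithConv (C →ₗ[R] R)) c = c := by
  have h := congrArg (TensorProduct.rid R C) (Coalgebra.lTensor_counit_comul (R := R) c)
  rw [TensorProduct.rid_tmul, one_smul] at h
  refine Eq.trans ?_ h
  change coeffMap C _ (Coalgebra.comul c) = _
  generalize (Coalgebra.comul (R := R) c : C ⊗[R] C) = z
  induction z with
  | zero => simp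
  | add a b ha hb => rw [map_add, map_add, map_add, ha, hb]
  | tmul a b => simp

theorem counit_convOp (l : WithConv (C →ₗ[R] R)) (c : C) :
    Coalgebra.counit (R := R) (convOp l c) = l c :=
  (mul_apply_eq_convOp 1 l c).symm.trans (by rw [one_mul])

/-- The invariant derivation given by a tangent vector. -/
noncomputable def invariantDerivation {D : WithConv (C →ₗ[R] R)} (hD : D ∈ lieAlg R C) :
    Derivation R C C :=
  Derivation.mk' (convOp D) fun a b => by
    have h := coeffMap_mul_of_mem_lieAlg C hD (Coalgebra.comul (R := R) a) (Coalgebra.comul b)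
    have h1 := convOp_one (R := R) a
    have h2 := convOp_one (R := R) b
    change coeffMap C _ (Coalgebra.comul a) = a at h1
    change coeffMap C _ (Coalgebra.comul b) = b at h2
    rw [h1, h2] at h
    change coeffMap C D.ofConv (Coalgebra.comul (a * b)) = _
    rw [Bialgebra.comul_mul, h, mul_comm _ b]
    rfl

/-- The augmentation ideal. -/
noncomputable def augIdeal (R : Type u) [CommRing R] (C : Type u) [CommRing C] [HopfAlgebra R C] :
    Ideal C := RingHom.ker (Bialgebra.counitAlgHom R C)

theorem mem_augIdeal {c : C} : c ∈ augIdeal R C ↔ Coalgebra.counit (R := R) c = 0 := Iff.rfl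

variable [Coalgebra.IsCocomm R C] {r : ℕ} {δ : Fin r → WithConv (C →ₗ[R] R)}

/-- An invariant derivation lowers the order along the augmentation ideal by at most one. After n of
them an element of the (n + 1)-st power still lies in the augmentation ideal, where the counit
vanishes. -/
theorem mono_apply_eq_zero (hδ : ∀ j, δ j ∈ lieAlg R C) {n : ℕ} {a : Fin r →₀ ℕ}
    (ha : a.degree = n) {c : C} (hc : c ∈ augIdeal R C ^ (n + 1)) : mono δ a c = 0 := by
  induction n generalizing a c with
  | zero =>
    rw [Finsupp.degree_eq_zero_iff] at ha
    rw [zero_add, pow_one] at hc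
    rw [ha, mono_zero]
    exact hc
  | succ n ih =>
    obtain ⟨j, a', rfl, ha'⟩ := exists_eq_add_single ha
    rw [mono_add, mono_single, pow_one, mul_apply_eq_convOp]
    exact ih ha' (derivation_mem_pow (invariantDerivation (hδ j)) hc)

variable {x : Fin r → C}

/-- The leading terms of the pairing between monomials in dual bases of tangent vectors and
coordinates. -/
theorem mono_apply_mono (hδ : ∀ j, δ j ∈ lieAlg R C) (hx : ∀ j, x j ∈ augIdeal R C) {s : R}
    (h : ∀ i j, δ j (x i) = if i = j then s else 0) {n : ℕ} {a b : Fin r →₀ ℕ}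
    (ha : a.degree = n) (hb : b.degree = n) :
    mono δ a (mono x b) = if a = b then (∏ j, ((a j).factorial : R)) * s ^ n else 0 := by
  induction n generalizing a b with
  | zero =>
    rw [Finsupp.degree_eq_zero_iff] at ha hb
    subst ha hb
    rw [mono_zero, mono_zero, if_pos rfl]
    simp
  | succ n ih =>
    obtain ⟨j, a', rfl, ha'⟩ := exists_eq_add_single ha
    rw [mono_add, mono_single, pow_one, mul_apply_eq_convOp]
    -- Modulo the augmentation ideal the invariant derivation of δ_j sends x_i to δ_j(x_i), so to
    -- leading order it acts as s ∂/∂x_j.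
    have h1 := derivation_mono_sub_mem x hx (invariantDerivation (hδ j)) (algebraMap R C s) j
      (fun i => by
        rw [mem_augIdeal, map_sub]
        have : Coalgebra.counit (R := R) (convOp (δ j) (x i)) = _ :=
          (counit_convOp (δ j) (x i)).trans (h i j)
        refine (congrArg (· - _) this).trans ?_
        split_ifs <;> simp) hb
    have h2 := mono_apply_eq_zero hδ ha' h1
    have h3 : mono δ a' (convOp (δ j) (mono x b)) =
        mono δ a' ((b j : C) * mono x (b - Finsupp.single j 1) * algebraMap R C s) := by
      rw [← sub_eq_zero]
      exact (map_sub (mono δ a').ofConv _ _).symm.trans h2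
    have h4 : (b j : C) * mono x (b - Finsupp.single j 1) * algebraMap R C s =
        ((b j : R) * s) • mono x (b - Finsupp.single j 1) := by
      rw [Algebra.smul_def, map_mul, map_natCast]
      ring
    rw [h3, h4]
    refine (map_smul (mono δ a').ofConv _ _).trans ?_
    by_cases hbj : b j = 0
    · rw [hbj, if_neg]
      · simp
      · rintro rfl
        simp at hbj
    · obtain ⟨b', rfl⟩ : ∃ b', b = b' + Finsupp.single j 1 :=
        ⟨_, (tsub_add_cancel_of_le
          (Finsupp.single_le_iff.2 (Nat.one_le_iff_ne_zero.2 hbj))).symm⟩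
      have hb' : b'.degree = n := by simpa using hb
      rw [add_tsub_cancel_right]
      refine (congrArg _ (ih ha' hb')).trans ?_
      by_cases hab : a' = b'
      · subst hab
        rw [if_pos rfl, if_pos rfl]
        have h5 : ∏ i, (((a' + Finsupp.single j 1 : Fin r →₀ ℕ) i).factorial : R) =
            (a' j + 1) * ∏ i, ((a' i).factorial : R) := by
          rw [← Finset.mul_prod_erase _ _ (Finset.mem_univ j),
            ← Finset.mul_prod_erase _ (fun i => ((a' i).factorial : R)) (Finset.mem_univ j)]
          rw [Finsupp.add_apply, Finsupp.single_eq_same, Nat.factorial_succ, Nat.cast_mul,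
            mul_assoc]
          congr 1
          · push_cast; rfl
          · congr 1
            refine Finset.prod_congr rfl fun i hi => ?_
            rw [Finsupp.add_apply, Finsupp.single_eq_of_ne (Finset.ne_of_mem_erase hi), add_zero]
        rw [h5, smul_eq_mul, Finsupp.add_apply, Finsupp.single_eq_same, pow_succ]
        push_cast
        ring
      · rw [if_neg hab, if_neg fun h => hab (add_right_cancel h), smul_zero]

variable {p : ℕ} [hp : Fact p.Prime] [Algebra (ZMod p) R] {f : R}

theorem isUnit_natCast_factorial {n : ℕ} (hn : n < p) : IsUnit (n.factorial : R) := by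
  induction n with
  | zero => simp
  | succ n ih =>
    rw [Nat.factorial_succ, Nat.cast_mul]
    exact (isUnit_natCast_of_lt hp.out (natCast_p_eq_zero p R) n.succ_pos hn).mul
      (ih (n.lt_succ_self.trans hn))

/-- Ordered by total degree, the pairing matrix is block triangular. The block of degree n is
diagonal with entries ∏ a_j! times f ^ (N n), and factorials of numbers below p are units. -/
theorem exists_det_eq (hδ : ∀ j, δ j ∈ lieAlg R C) (hx : ∀ j, x j ∈ augIdeal R C) {N : ℕ}
    (h : ∀ i j, δ j (x i) = if i = j then f ^ N else 0) :
    ∃ (u : R) (m : ℕ), IsUnit u ∧ (Matrix.of fun a b : Fin r → Fin p =>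
      mono δ (finExp a) (mono x (finExp b))).det = u * f ^ m := by
  classical
  set M := Matrix.of fun a b : Fin r → Fin p => mono δ (finExp a) (mono x (finExp b))
  let α : (Fin r → Fin p) → ℕᵒᵈ := fun a => OrderDual.toDual (finExp a).degree
  have hM : M.BlockTriangular α := fun a b hab => by
    have hab' : (finExp a).degree < (finExp b).degree := hab
    exact mono_apply_eq_zero hδ rfl (Ideal.pow_le_pow_right hab' (mono_mem_pow x hx _))
  rw [hM.det]
  refine Finset.prod_induction _ (fun s : R => ∃ (u : R) (m : ℕ), IsUnit u ∧ s = u * f ^ m) ?_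
    ⟨1, 0, isUnit_one, by simp⟩ fun k _ => ?_
  · rintro _ _ ⟨u, m, hu, rfl⟩ ⟨u', m', hu', rfl⟩
    exact ⟨u * u', m + m', hu.mul hu', by ring⟩
  · have hd : M.toSquareBlock α k = Matrix.diagonal fun a =>
        (∏ j, ((finExp a.1 j).factorial : R)) * (f ^ N) ^ (OrderDual.ofDual k) := by
      ext a b
      have h1 : (finExp a.1).degree = OrderDual.ofDual k := congrArg OrderDual.ofDual a.2
      have h2 : (finExp b.1).degree = OrderDual.ofDual k := congrArg OrderDual.ofDual b.2
      refine (mono_apply_mono hδ hx h h1 h2).trans ?_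
      rw [Matrix.diagonal_apply]
      refine if_congr ?_ rfl rfl
      rw [Subtype.ext_iff, finExp_injective.eq_iff]
    rw [hd, Matrix.det_diagonal]
    refine ⟨∏ a : { a // α a = k }, ∏ j, ((finExp a.1 j).factorial : R),
      N * (OrderDual.ofDual k) * Fintype.card { a // α a = k }, ?_, ?_⟩
    · rw [IsUnit.prod_univ_iff]
      intro a
      rw [IsUnit.prod_univ_iff]
      exact fun j => isUnit_natCast_factorial (a.1 j).2
    · rw [Finset.prod_mul_distrib, Finset.prod_const, Finset.card_univ, ← pow_mul, ← pow_mul, mul_assoc]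

theorem counit_mono (hx : ∀ j, x j ∈ augIdeal R C) (a : Fin r →₀ ℕ) :
    Coalgebra.counit (R := R) (mono x a) = if a = 0 then 1 else 0 := by
  split_ifs with ha
  · rw [ha, mono_zero, Bialgebra.counit_one]
  · have h1 : a.degree ≠ 0 := fun h => ha ((Finsupp.degree_eq_zero_iff a).1 h)
    have h2 := mono_mem_pow x hx a
    exact Ideal.pow_le_self h1 h2

theorem eq_zero_of_mem_lieAlg {D : WithConv (C →ₗ[R] R)}
    (hD : D ∈ lieAlg R C) (h : ∀ j, D (x j) = 0) (a : Fin r →₀ ℕ) : D (mono x a) = 0 := by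
  induction hn : a.degree generalizing a with
  | zero =>
    rw [Finsupp.degree_eq_zero_iff] at hn
    have h1 := hD 1 1
    simp only [mul_one, Bialgebra.counit_one, one_mul] at h1
    rw [hn, mono_zero]
    linear_combination -h1
  | succ n ih =>
    obtain ⟨j, a', rfl, ha'⟩ := exists_eq_add_single hn
    rw [mono_add, mono_single, pow_one, hD, h j, ih a' ha', mul_zero, zero_mul, add_zero]

variable [Module.Finite R C]

theorem IsLocalCoord.mem_augIdeal (hx : IsLocalCoord p f x) (j : Fin r) : x j ∈ augIdeal R C :=
  hx.counit j

/-- The functional reading off the coefficient of x_j obeys the Leibniz rule on monomials, so its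
defect B is f-torsion. A power of f turns the functional into a genuine tangent vector. -/
theorem IsLocalCoord.exists_dual [Module.Projective R C] (hx : IsLocalCoord p f x) :
    ∃ (N : ℕ) (δ : Fin r → WithConv (C →ₗ[R] R)), (∀ j, δ j ∈ lieAlg R C) ∧
      ∀ i j, δ j (x i) = if i = j then f ^ N else 0 := by
  classical
  obtain ⟨N, l, hl⟩ := hx.basis.exists_dual
  have hle : ∀ i j : Fin r, Finsupp.single j 1 i ≤ 1 := fun i j => by
    rw [Finsupp.single_apply]
    split_ifs <;> simp
  have hs : ∀ j, ∃ e : Fin r → Fin p, finExp e = Finsupp.single j 1 := fun j =>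
    exists_finExp_eq fun i => (hle _ _).trans_lt hp.out.one_lt
  choose e he using hs
  have hmono : ∀ j (a : Fin r →₀ ℕ),
      l (e j) (mono x a) = if a = Finsupp.single j 1 then f ^ N else 0 := by
    intro j a
    by_cases ha : ∀ i, a i < p
    · obtain ⟨b, rfl⟩ := exists_finExp_eq ha
      refine (hl b (e j)).trans (if_congr ?_ rfl rfl)
      rw [← he, finExp_injective.eq_iff]
    · push Not at ha
      obtain ⟨i, hi⟩ := ha
      have h0 : mono x a = 0 := Finset.prod_eq_zero (Finset.mem_univ i) (by
        rw [← Nat.sub_add_cancel hi, pow_add, hx.pow, mul_zero])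
      rw [h0, map_zero, if_neg]
      rintro rfl
      exact absurd (hi.trans (hle _ _)) (not_le.2 hp.out.one_lt)
  have hcounit := counit_mono hx.mem_augIdeal
  have hdef : ∀ j, ∃ K : ℕ, ∀ a b : C, f ^ K * l (e j) (a * b) =
      f ^ K * (Coalgebra.counit (R := R) a * l (e j) b + l (e j) a * Coalgebra.counit (R := R) b) := by
    intro j
    let co : C →ₗ[R] R := Coalgebra.counit
    let B : C →ₗ[R] C →ₗ[R] R := (LinearMap.mul R C).compr₂ (l (e j)) -
      (LinearMap.mul R R).compl₁₂ co (l (e j)) - (LinearMap.mul R R).compl₁₂ (l (e j)) co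
    have hB : ∀ a b, B a b = l (e j) (a * b) - co a * l (e j) b - l (e j) a * co b :=
      fun _ _ => rfl
    have hBm : ∀ a b, B (mono x a) (mono x b) = 0 := by
      intro a b
      have h1 : (0 : Fin r →₀ ℕ) ≠ Finsupp.single j 1 := by
        intro h
        have := DFunLike.congr_fun h j
        simp at this
      rw [hB, ← mono_add, hmono, hmono, hmono]
      change _ - Coalgebra.counit (R := R) (mono x a) * _ -
        _ * Coalgebra.counit (R := R) (mono x b) = 0
      rw [hcounit, hcounit]
      by_cases ha : a = 0
      · subst ha
        simp [h1]
      by_cases hb : b = 0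
      · subst hb
        simp [h1]
      rw [if_neg ha, if_neg hb, if_neg]
      · simp
      · intro h
        have h2 := congrArg Finsupp.degree h
        rw [map_add, Finsupp.degree_single] at h2
        have h3 : a.degree ≠ 0 := fun h => ha ((Finsupp.degree_eq_zero_iff a).1 h)
        have h4 : b.degree ≠ 0 := fun h => hb ((Finsupp.degree_eq_zero_iff b).1 h)
        lia
    obtain ⟨K, hK⟩ := hx.basis.exists_pow_smul_eq_zero B fun b =>
      hx.basis.exists_pow_smul_eq_zero _ fun c => ⟨0, by
        rw [pow_zero, one_smul]
        exact hBm (finExp b) (finExp c)⟩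
    refine ⟨K, fun a b => ?_⟩
    have h1 : f ^ K * B a b = 0 := DFunLike.congr_fun (DFunLike.congr_fun hK a) b
    rw [hB] at h1
    linear_combination h1
  choose K hK using hdef
  refine ⟨∑ j, K j + N, fun j => toConv (f ^ (∑ j, K j) • l (e j)), fun j a b => ?_, fun i j => ?_⟩
  · change f ^ (∑ j, K j) * l (e j) (a * b) =
      _ * (f ^ (∑ j, K j) * l (e j) b) + (f ^ (∑ j, K j) * l (e j) a) * _
    have h1 := hK j a b
    rw [← Finset.sum_erase_add _ _ (Finset.mem_univ j), pow_add]
    linear_combination (f ^ ∑ i ∈ Finset.univ.erase j, K i) * h1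
  · change f ^ (∑ j, K j) * l (e j) (x i) = _
    have h1 := hmono j (Finsupp.single i 1)
    rw [mono_single, pow_one] at h1
    rw [h1, pow_add, mul_ite, mul_zero]
    refine if_congr ?_ rfl rfl
    rw [Finsupp.single_left_inj one_ne_zero]

/-- The Lie algebra of a 1-smooth group scheme is locally free, and the monomials with exponents
less than `p` in a local basis of it are a local basis of the dual algebra. -/
theorem IsLocalCoord.exists_tangent_basis [Module.Projective R C] (hx : IsLocalCoord p f x) :
    ∃ δ : Fin r → lieAlg R C, IsBasisAway f δ ∧
      IsBasisAway f fun a : Fin r → Fin p => mono (fun j => (δ j).1) (finExp a) := by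
  classical
  obtain ⟨N, δ, hδ, h⟩ := hx.exists_dual
  have hxI := hx.mem_augIdeal
  have hzero : ∀ D : WithConv (C →ₗ[R] R), (∀ b : Fin r → Fin p, D (mono x (finExp b)) = 0) →
      ∃ k : ℕ, f ^ k • D = 0 := by
    intro D hD
    obtain ⟨k, hk⟩ := hx.basis.exists_pow_smul_eq_zero D.ofConv fun b => ⟨0, by
      rw [pow_zero, one_smul]
      exact hD b⟩
    exact ⟨k, congrArg toConv hk⟩
  refine ⟨fun j => ⟨δ j, hδ j⟩, ⟨fun D => ?_, fun a ha => ⟨N, fun i => ?_⟩⟩,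
    ⟨fun D => ?_, fun a ha => ?_⟩⟩
  -- E vanishes on all coordinates; being a derivation at the unit section it vanishes on all
  -- monomials, hence is f-torsion.
  · let E : lieAlg R C := f ^ N • D - ∑ j, D.1 (x j) • ⟨δ j, hδ j⟩
    have hE : ∀ c, E.1 c = f ^ N * D.1 c - ∑ j, D.1 (x j) * δ j c := by
      intro c
      simp [E, WithConv.ofConv_sum]
    obtain ⟨k, hk⟩ := hzero E.1 fun b => eq_zero_of_mem_lieAlg E.2 (fun i => by
      rw [hE]
      simp [h, mul_comm]) _
    refine ⟨k + N, ?_⟩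
    have h1 : f ^ k • E = 0 := Subtype.ext hk
    have h2 : f ^ (k + N) • D = f ^ k • ∑ j, D.1 (x j) • (⟨δ j, hδ j⟩ : lieAlg R C) := by
      rw [pow_add, mul_smul, ← sub_eq_zero]
      exact (smul_sub (f ^ k) (f ^ N • D) _).symm.trans h1
    rw [h2]
    exact Submodule.smul_mem _ _ (Submodule.sum_mem _ fun j _ => Submodule.smul_mem _ _
      (Submodule.subset_span ⟨j, rfl⟩))
  · have h1 : (∑ j, a j • (⟨δ j, hδ j⟩ : lieAlg R C)).1 (x i) = 0 := by
      rw [ha]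
      rfl
    simp [WithConv.ofConv_sum, h] at h1
    rw [mul_comm]
    exact h1
  · obtain ⟨u, m, hu, hdet⟩ := exists_det_eq (p := p) hδ hxI h
    set M := Matrix.of fun a b : Fin r → Fin p => mono δ (finExp a) (mono x (finExp b))
    -- Cramer's rule: the adjugate gives the coefficients of det M times D in the monomials of
    -- tangent vectors, and det M is a unit times a power of f.
    let c := Matrix.vecMul (fun b => D (mono x (finExp b))) M.adjugate
    have hc : ∀ b, ∑ a, c a * M a b = u * f ^ m * D (mono x (finExp b)) := by
      intro b
      have h1 : Matrix.vecMul c M = M.det • fun b => D (mono x (finExp b)) := by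
        rw [Matrix.vecMul_vecMul, Matrix.adjugate_mul, Matrix.vecMul_smul, Matrix.vecMul_one]
      have h2 := congrFun h1 b
      rw [hdet] at h2
      exact h2
    obtain ⟨k, hk⟩ := hzero ((u * f ^ m) • D - ∑ a, c a • mono δ (finExp a)) fun b => by
      have h1 := hc b
      simp only [WithConv.ofConv_sub, WithConv.ofConv_sum, WithConv.ofConv_smul,
        LinearMap.sub_apply, LinearMap.sum_apply, LinearMap.smul_apply, smul_eq_mul]
      rw [← h1]
      exact sub_self _
    refine ⟨k + m, ?_⟩
    rw [smul_sub, sub_eq_zero] at hk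
    have h2 : u • f ^ (k + m) • D = f ^ k • ∑ a, c a • mono δ (finExp a) := by
      rw [← hk, smul_smul, smul_smul]
      congr 1
      ring
    obtain ⟨u, rfl⟩ := hu
    have h3 : f ^ (k + m) • D = (u⁻¹ : Rˣ) • f ^ k • ∑ a, c a • mono δ (finExp a) := by
      rw [← h2, ← Units.smul_def u, inv_smul_smul]
    rw [h3, Units.smul_def]
    exact Submodule.smul_mem _ _ (Submodule.smul_mem _ _ (Submodule.sum_mem _ fun a _ =>
      Submodule.smul_mem _ _ (Submodule.subset_span ⟨a, rfl⟩)))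
  · obtain ⟨u, m, hu, hdet⟩ := exists_det_eq (p := p) hδ hxI h
    set M := Matrix.of fun a b : Fin r → Fin p => mono δ (finExp a) (mono x (finExp b))
    refine ⟨m, fun j => ?_⟩
    have h1 : Matrix.vecMul a M = 0 := by
      funext b
      have h2 : (∑ b, a b • mono δ (finExp b)) (mono x (finExp b)) = 0 := by
        rw [ha]
        rfl
      simp only [WithConv.ofConv_sum, WithConv.ofConv_smul,
        LinearMap.sum_apply, LinearMap.smul_apply, smul_eq_mul] at h2
      exact h2
    have h3 : Matrix.vecMul (Matrix.vecMul a M) M.adjugate = M.det • a := by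
      rw [Matrix.vecMul_vecMul, Matrix.mul_adjugate, Matrix.vecMul_smul, Matrix.vecMul_one]
    rw [h1, Matrix.zero_vecMul, hdet] at h3
    have h4 := congrFun h3.symm j
    rw [Pi.smul_apply, smul_eq_mul, mul_assoc, Pi.zero_apply, hu.mul_right_eq_zero] at h4
    exact h4

end DualAlgebra

/-! ### Algebra maps out of the dual algebra -/

section LocalMembership

variable {R : Type*} [CommRing R]

/-- The scalars r with r • x in N form an ideal. For every prime it contains a power of some f
outside that prime, so it is the unit ideal. -/
theorem mem_of_forall_mem_awaySat {M : Type*} [AddCommGroup M] [Module R M] {N : Submodule R M}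
    {x : M} (h : ∀ 𝔭 : PrimeSpectrum R, ∃ f ∉ 𝔭.asIdeal, x ∈ awaySat f N) : x ∈ N := by
  let I : Ideal R := N.comap (LinearMap.toSpanSingleton R M x)
  have hI : Ideal.span (I : Set R) = ⊤ := span_eq_top_of_forall_prime fun 𝔭 => by
    obtain ⟨f, hf, k, hk⟩ := h 𝔭
    exact ⟨f ^ k, hk, fun h => hf (𝔭.2.mem_of_pow_mem k h)⟩
  rw [Ideal.span_eq, Ideal.eq_top_iff_one] at hI
  change (1 : R) • x ∈ N at hI
  rwa [one_smul] at hI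

theorem adjoin_le_awaySat {W : Type*} [CommRing W] [Algebra R W] {f : R} {s : Set W}
    {N : Subalgebra R W} (h : ∀ z ∈ s, z ∈ awaySat f (Subalgebra.toSubmodule N)) {z : W}
    (hz : z ∈ Algebra.adjoin R s) : z ∈ awaySat f (Subalgebra.toSubmodule N) := by
  induction hz using Algebra.adjoin_induction with
  | mem z hz => exact h z hz
  | algebraMap c => exact le_awaySat _ (N.algebraMap_mem c)
  | add a b _ _ ha hb => exact Submodule.add_mem _ ha hb
  | mul a b _ _ ha hb =>
    obtain ⟨k, hk⟩ := ha
    obtain ⟨l, hl⟩ := hb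
    refine ⟨k + l, ?_⟩
    rw [pow_add, ← smul_mul_smul_comm]
    exact N.mul_mem hk hl

end LocalMembership

/-! ### The dual algebra as the restricted enveloping algebra of the Lie algebra -/

section Extension

variable {p : ℕ} [hp : Fact p.Prime] {R : Type u} [CommRing R] [Algebra (ZMod p) R]
  {C : Type u} [CommRing C] [HopfAlgebra R C] [Coalgebra.IsCocomm R C]
  {r : PrimeSpectrum R → ℕ}

theorem IsSmoothOfRank.exists_tangent_basis (h : IsSmoothOfRank p 1 C r) (𝔭 : PrimeSpectrum R) :
    ∃ f ∉ 𝔭.asIdeal, ∃ δ : Fin (r 𝔭) → lieAlg R C, IsBasisAway f δ ∧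
      IsBasisAway f fun a : Fin (r 𝔭) → Fin p => mono (fun j => (δ j).1) (finExp a) := by
  obtain ⟨f, hf, x, hx⟩ := h.exists_isLocalCoord 𝔭
  obtain ⟨h1, h2⟩ := h.finite_and_projective
  exact ⟨f, hf, hx.exists_tangent_basis⟩

theorem IsSmoothOfRank.lieAlg_finite_and_projective (h : IsSmoothOfRank p 1 C r) :
    Module.Finite R (lieAlg R C) ∧ Module.Projective R (lieAlg R C) :=
  finite_and_projective_of_isBasisAway fun 𝔭 => by
    obtain ⟨f, hf, δ, hδ, -⟩ := h.exists_tangent_basis 𝔭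
    exact ⟨f, hf, _, δ, hδ⟩

variable {S : Type u} [CommRing S] [Algebra R S]

/-- Locally the dual algebra is spanned by monomials in tangent vectors, where g and g' agree, and
membership in their equalizer is a local condition. -/
theorem IsSmoothOfRank.algHom_dual_ext (h : IsSmoothOfRank p 1 C r)
    {g g' : WithConv (C →ₗ[R] R) →ₐ[R] S} (hg : ∀ D : lieAlg R C, g D.1 = g' D.1) : g = g' := by
  ext w
  let N := LinearMap.eqLocus g.toLinearMap g'.toLinearMap
  have hw : w ∈ N := mem_of_forall_mem_awaySat fun 𝔭 => by
    obtain ⟨f, hf, δ, -, hδ⟩ := h.exists_tangent_basis 𝔭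
    refine ⟨f, hf, awaySat_le ((Submodule.span_le.2 ?_).trans (le_awaySat N)) (hδ.span w)⟩
    rintro _ ⟨a, rfl⟩
    change g _ = g' _
    simp only [mono, map_prod, map_pow, hg]
  exact hw

/-- The graph of g is built as the subalgebra N of the product generated by the pairs (D, ξ D); the
task is to show that its projection to the dual algebra is bijective. The p-th power of a generator
is again a generator, so up to powers of f the algebra N is spanned by the monomials with exponents
below p in the pairs (δ_j, ξ δ_j). Their first components form a basis away from f, which gives
injectivity locally; surjectivity holds because tangent vectors generate locally. -/
theorem IsSmoothOfRank.exists_algHom_dual (h : IsSmoothOfRank p 1 C r) {ξ : lieAlg R C →ₗ[R] S}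
    (hξ : ξ ∈ frobLinear (pOperation R C p) S) :
    ∃ g : WithConv (C →ₗ[R] R) →ₐ[R] S, ∀ D : lieAlg R C, g D.1 = ξ D := by
  let W := WithConv (C →ₗ[R] R)
  let s : lieAlg R C → W × S := fun D => (D.1, ξ D)
  let N : Subalgebra R (W × S) := Algebra.adjoin R (Set.range s)
  have hsN : ∀ D, s D ∈ N := fun D => Algebra.subset_adjoin ⟨D, rfl⟩
  let sl : lieAlg R C →ₗ[R] W × S := (Submodule.subtype _).prod ξ
  let π : N →ₐ[R] W := (AlgHom.fst R W S).comp N.val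
  -- The only use of the compatibility of ξ with the p-operation.
  have hspow : ∀ D, s D ^ p = s (pOperation R C p D) := fun D =>
    Prod.ext rfl (hξ D).symm
  have hlin : ∀ {f : R} {n : ℕ} {δ : Fin n → lieAlg R C} (_ : IsBasisAway f δ) (D : lieAlg R C),
      s D ∈ awaySat f (Submodule.span R (Set.range fun j => s (δ j))) := by
    intro f n δ hδ D
    obtain ⟨k, a, hk⟩ := hδ.exists_sum D
    refine ⟨k, ?_⟩
    have h1 : f ^ k • sl D = ∑ j, a j • sl (δ j) := by
      rw [← map_smul, hk, map_sum]
      simp only [map_smul]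
    change f ^ k • sl D ∈ _
    rw [h1]
    exact Submodule.sum_mem _ fun j _ => Submodule.smul_mem _ _ (Submodule.subset_span ⟨j, rfl⟩)
  have hπ : Function.Bijective π := by
    constructor
    · rw [injective_iff_map_eq_zero]
      rintro ⟨⟨w, y⟩, hz⟩ h0
      change w = 0 at h0
      subst h0
      have hy : y ∈ (⊥ : Submodule R S) := mem_of_forall_mem_awaySat fun 𝔭 => by
        obtain ⟨f, hf, δ, hδ, hδ'⟩ := h.exists_tangent_basis 𝔭
        refine ⟨f, hf, ?_⟩
        let t : Fin (r 𝔭) → W × S := fun j => s (δ j)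
        have h1 := adjoin_le_awaySat (N := Algebra.adjoin R (Set.range t)) (fun z hz => by
          obtain ⟨D, rfl⟩ := hz
          exact awaySat_le ((Submodule.span_le.2 (fun z hz => Algebra.subset_adjoin hz)).trans
            (le_awaySat _)) (hlin hδ D)) hz
        have h2 := awaySat_le (fun z hz => mem_awaySat_of_mem_adjoin (p := p) t (fun j => by
          rw [hspow]
          exact hlin hδ _) hz) h1
        obtain ⟨k, hk⟩ := h2
        obtain ⟨a, ha⟩ := (Submodule.mem_span_range_iff_exists_fun R).1 hk
        have h3 : ∑ b, a b • mono (fun j => (δ j).1) (finExp b) = 0 := by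
          have h4 := congrArg (LinearMap.fst R W S) ha
          rw [map_sum] at h4
          refine Eq.trans ?_ (h4.trans (smul_zero _))
          refine Finset.sum_congr rfl fun b _ => ?_
          rw [map_smul]
          congr 1
          have h5 : AlgHom.fst R W S (mono t (finExp b)) =
              mono (fun j => AlgHom.fst R W S (t j)) (finExp b) := by
            simp only [mono, map_prod, map_pow]
          exact h5.symm
        obtain ⟨l, hl⟩ := hδ'.indep a h3
        refine ⟨l + k, ?_⟩
        have h5 : f ^ k • y = ∑ b, a b • (mono t (finExp b)).2 := by
          have h4 := congrArg (LinearMap.snd R W S) ha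
          rw [map_sum] at h4
          exact h4.symm
        rw [pow_add, mul_smul, h5, Finset.smul_sum]
        refine Submodule.sum_mem _ fun b _ => ?_
        rw [smul_smul, hl, zero_smul]
        exact Submodule.zero_mem _
      rw [Submodule.mem_bot] at hy
      subst hy
      rfl
    · intro w
      have hw : w ∈ LinearMap.range π.toLinearMap := mem_of_forall_mem_awaySat fun 𝔭 => by
        obtain ⟨f, hf, δ, -, hδ⟩ := h.exists_tangent_basis 𝔭
        refine ⟨f, hf, awaySat_le ((Submodule.span_le.2 ?_).trans (le_awaySat _)) (hδ.span w)⟩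
        rintro _ ⟨a, rfl⟩
        refine ⟨mono (fun j => ⟨s (δ j), hsN _⟩) (finExp a), ?_⟩
        change π _ = _
        simp only [mono, map_prod, map_pow]
        rfl
      exact hw
  let e := AlgEquiv.ofBijective π hπ
  refine ⟨((AlgHom.snd R W S).comp N.val).comp e.symm.toAlgHom, fun D => ?_⟩
  have h1 : e.symm D.1 = ⟨s D, hsN D⟩ := by
    rw [AlgEquiv.symm_apply_eq]
    rfl
  change ((e.symm D.1 : N) : W × S).2 = _
  rw [h1]

end Extension

/-! ### Characters as algebra maps out of the dual of a finite projective Hopf algebra -/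

section Duality

variable {R : Type u} [CommRing R] {C : Type u} [CommRing C] [HopfAlgebra R C]
  [Coalgebra.IsCocomm R C] {S : CommAlgCat.{u} R} [Module.Finite R C] [Module.Projective R C]

/-- A dual basis of C recovers the element of S ⊗ C, and with it the character, from its pairings.
-/
theorem HomOver.ext_of_pairingHom {h h' : HomOver (specGrp R C) (Gm R) S}
    (hh : h.pairingHom = h'.pairingHom) : h = h' := by
  obtain ⟨n, c, l, hc⟩ := exists_dual_basis R C
  have hz : ∀ z : S ⊗[R] C, ∑ k, coeffMap S (l k) z ⊗ₜ c k = z := by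
    intro z
    induction z with
    | zero => simp
    | add a b ha hb =>
      conv_rhs => rw [← ha, ← hb]
      simp only [map_add, TensorProduct.add_tmul, Finset.sum_add_distrib]
    | tmul s x =>
      conv_rhs => rw [← hc x]
      simp only [coeffMap_tmul, TensorProduct.tmul_sum, TensorProduct.smul_tmul]
  have he : h.elt = h'.elt := by
    rw [← hz h.elt, ← hz h'.elt]
    refine Finset.sum_congr rfl fun k _ => ?_
    congr 1
    exact DFunLike.congr_fun hh (toConv (l k))
  ext T x
  apply gmVal_injective
  rw [gmVal_toFun, gmVal_toFun, he]

/-- For a dual basis (c_k, l_k) of C, the character is the one with element Σ g(l_k) ⊗ c_k. It is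
multiplicative because g is, convolution being dual to comultiplication. -/
theorem exists_homOver_pairingHom_eq (g : WithConv (C →ₗ[R] R) →ₐ[R] S) :
    ∃ h : HomOver (specGrp R C) (Gm R) S, h.pairingHom = g := by
  obtain ⟨n, c, l, hc⟩ := exists_dual_basis R C
  have hl : ∀ m : WithConv (C →ₗ[R] R), m = ∑ k, m (c k) • toConv (l k) := by
    intro m
    apply WithConv.ofConv_injective
    ext x
    conv_lhs => rw [← hc x]
    simp [WithConv.ofConv_sum, mul_comm]
  let v : ∀ T : Under S, (specGrp R C).obj T.right → T.right := fun T x =>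
    ∑ k, underHom T (g (toConv (l k))) * specHom x (c k)
  have hgl : ∀ (T : Under S) (m : WithConv (C →ₗ[R] R)),
      underHom T (g m) = ∑ k, algebraMap R T.right (m (c k)) * underHom T (g (toConv (l k))) := by
    intro T m
    conv_lhs => rw [hl m]
    rw [map_sum, map_sum]
    refine Finset.sum_congr rfl fun k _ => ?_
    rw [map_smul, Algebra.smul_def, map_mul]
    congr 1
    exact (show S ⟶ T.right from T.hom).hom.commutes _
  have hv1 : ∀ T, v T 1 = 1 := by
    intro T
    have h1 := hgl T 1
    rw [map_one, map_one] at h1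
    rw [h1]
    exact Finset.sum_congr rfl fun k _ => mul_comm _ _
  have hvm : ∀ T x y, v T (x * y) = v T x * v T y := by
    intro T x y
    let B : C ⊗[R] C →ₐ[R] T.right :=
      Algebra.TensorProduct.lift (specHom x) (specHom y) fun _ _ => Commute.all _ _
    have hB : ∀ c, specHom (x * y) c = B (Coalgebra.comul c) := fun c =>
      AlgHom.convMul_apply (WithConv.toConv (specHom x)) (WithConv.toConv (specHom y)) c
    have hx : ∀ (x : (specGrp R C).obj T.right) (a : C),
        specHom x a = ∑ k, algebraMap R T.right (l k a) * specHom x (c k) := by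
      intro x a
      conv_lhs => rw [← hc a]
      rw [map_sum]
      exact Finset.sum_congr rfl fun k _ => by rw [map_smul, Algebra.smul_def]
    have hBz : ∀ z : C ⊗[R] C, B z = ∑ k, ∑ m, algebraMap R T.right
        (LinearMap.mul' R R (TensorProduct.map (l k) (l m) z)) *
          (specHom x (c k) * specHom y (c m)) := by
      intro z
      induction z with
      | zero => simp
      | add a b ha hb => simp only [map_add, ha, hb, add_mul, Finset.sum_add_distrib]
      | tmul a b =>
        have h1 : B (a ⊗ₜ b) = specHom x a * specHom y b := rfl
        rw [h1, hx x a, hx y b, Finset.sum_mul_sum]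
        refine Finset.sum_congr rfl fun k _ => Finset.sum_congr rfl fun m _ => ?_
        rw [TensorProduct.map_tmul, LinearMap.mul'_apply, map_mul]
        ring
    have h2 : v T x * v T y = ∑ k, ∑ m, underHom T (g (toConv (l k) * toConv (l m))) *
        (specHom x (c k) * specHom y (c m)) := by
      rw [Finset.sum_mul_sum]
      refine Finset.sum_congr rfl fun k _ => Finset.sum_congr rfl fun m _ => ?_
      rw [map_mul, map_mul]
      ring
    have h3 : v T (x * y) = ∑ j, ∑ k, ∑ m, underHom T (g (toConv (l j))) *
        (algebraMap R T.right ((toConv (l k) * toConv (l m)) (c j)) *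
          (specHom x (c k) * specHom y (c m))) := by
      refine Finset.sum_congr rfl fun j _ => ?_
      rw [hB, hBz, Finset.mul_sum]
      refine Finset.sum_congr rfl fun k _ => ?_
      rw [Finset.mul_sum]
      rfl
    rw [h2, h3, Finset.sum_comm]
    refine Finset.sum_congr rfl fun k _ => ?_
    rw [Finset.sum_comm]
    refine Finset.sum_congr rfl fun m _ => ?_
    rw [hgl T (toConv (l k) * toConv (l m)), Finset.sum_mul]
    exact Finset.sum_congr rfl fun j _ => by ring
  let h : HomOver (specGrp R C) (Gm R) S :=
    { toFun := fun T x => gmOf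
        ⟨v T x, v T x⁻¹, by rw [← hvm, mul_inv_cancel, hv1], by rw [← hvm, inv_mul_cancel, hv1]⟩
      naturality := fun {T T'} f x => by
        apply gmVal_injective
        rw [gmVal_map]
        change v T' _ = f.right.hom (v T x)
        rw [map_sum]
        refine Finset.sum_congr rfl fun k _ => ?_
        rw [map_mul, ← underHom_comp]
        rfl
      map_mul := fun T x y => gmVal_injective (hvm T x y) }
  refine ⟨h, ?_⟩
  have he : h.elt = ∑ k, g (toConv (l k)) ⊗ₜ c k := by
    have he0 : h.elt = v (univUnder C S) (specPt (T := CommAlgCat.of R (S ⊗[R] C))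
      Algebra.TensorProduct.includeRight) := rfl
    refine he0.trans (Finset.sum_congr (M := S ⊗[R] C) rfl fun k _ => ?_)
    change (g (toConv (l k)) ⊗ₜ[R] (1 : C)) * ((1 : S) ⊗ₜ[R] c k) = _
    rw [Algebra.TensorProduct.tmul_mul_tmul, one_mul, mul_one]
  ext m
  rw [HomOver.pairingHom_apply, HomOver.pairing, he, map_sum]
  conv_rhs => rw [hl m, map_sum]
  refine Finset.sum_congr rfl fun k _ => ?_
  rw [coeffMap_tmul, map_smul]

end Duality

/-! ### The Cartier dual of a 1-smooth group scheme -/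

section CosmoothRepr

variable {p : ℕ} [hp : Fact p.Prime] {R : Type u} [CommRing R] [Algebra (ZMod p) R]
  {C : Type u} [CommRing C] [HopfAlgebra R C] [Coalgebra.IsCocomm R C]

/-- A character of `Spec C`, restricted to the tangent vectors. -/
noncomputable def HomOver.restrictLie (p : ℕ) [hp : Fact p.Prime] [Algebra (ZMod p) R]
    (S : CommAlgCat.{u} R) :
    HomOver (specGrp R C) (Gm R) S →* (frobLinearGrp (pOperation R C p)).obj S where
  toFun h := Multiplicative.ofAdd ⟨h.pairingHom.toLinearMap ∘ₗ (lieAlg R C).subtype, fun D =>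
    map_pow h.pairingHom D.1 p⟩
  map_one' := by
    apply Subtype.ext
    ext D
    have h1 := (1 : HomOver (specGrp R C) (Gm R) S).pairing_mul_of_mem_lieAlg 1 D.2
    rw [one_mul] at h1
    exact left_eq_add.1 h1
  map_mul' h h' := by
    apply Subtype.ext
    ext D
    exact h.pairing_mul_of_mem_lieAlg h' D.2

/-- Characters correspond to algebra maps out of the dual algebra, and these correspond to their
p-compatible restrictions to the Lie algebra. -/
theorem IsSmoothOfRank.restrictLie_bijective {r : PrimeSpectrum R → ℕ}
    (h : IsSmoothOfRank p 1 C r) (S : CommAlgCat.{u} R) :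
    Function.Bijective (HomOver.restrictLie (C := C) p S) := by
  obtain ⟨h1, h2⟩ := h.finite_and_projective
  refine ⟨fun g g' hg => HomOver.ext_of_pairingHom (h.algHom_dual_ext fun D => ?_), fun ξ => ?_⟩
  · exact DFunLike.congr_fun (congrArg
      (fun ξ : Multiplicative (frobLinear (pOperation R C p) S) => (Multiplicative.toAdd ξ).1) hg) D
  · obtain ⟨g, hg⟩ := h.exists_algHom_dual (Multiplicative.toAdd ξ).2
    obtain ⟨k, hk⟩ := exists_homOver_pairingHom_eq g
    refine ⟨k, Subtype.ext (LinearMap.ext fun D => ?_)⟩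
    exact (DFunLike.congr_fun hk D.1).trans (hg D)

/-- The Cartier dual of a 1-smooth group scheme is given by its restricted Lie algebra. -/
noncomputable def IsSmoothOfRank.dualIso {r : PrimeSpectrum R → ℕ} (h : IsSmoothOfRank p 1 C r) :
    GrpFunctorIso (cartierDual (specGrp R C)) (frobLinearGrp (pOperation R C p)) where
  equiv S := MulEquiv.ofBijective (HomOver.restrictLie p S) (h.restrictLie_bijective S)
  naturality {S T} f g := by
    apply Subtype.ext
    ext D
    exact HomOver.pairing_baseChange (S := S) g f D.1

end CosmoothRepr

/-! ### Cosmooth group schemes -/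

section Cosmooth

variable {p : ℕ} [hp : Fact p.Prime] {R : Type u} [CommRing R] [Algebra (ZMod p) R]

/-- Composition of isomorphisms of group functors. -/
def GrpFunctorIso.trans {A : GrpFunctor.{u, u} R} {A' : GrpFunctor.{u, v} R}
    {A'' : GrpFunctor.{u, w} R} (α : GrpFunctorIso A A') (β : GrpFunctorIso A' A'') :
    GrpFunctorIso A A'' where
  equiv S := (α.equiv S).trans (β.equiv S)
  naturality {S T} f x := by
    rw [MulEquiv.trans_apply, α.naturality, β.naturality, MulEquiv.trans_apply]

/-- P is the Lie algebra of the 1-smooth group scheme whose dual is A, and φ is its p-operation. -/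
theorem IsCosmoothGroup.exists_iso {A : GrpFunctor.{u, u} R} {r : PrimeSpectrum R → ℕ}
    (h : IsCosmoothGroup p 1 A r) :
    ∃ (P : Type u) (_ : AddCommGroup P) (_ : Module R P) (_ : Module.Finite R P)
      (_ : Module.Projective R P) (φ : P →ₛₗ[frob p R] P),
      Nonempty (GrpFunctorIso A (frobLinearGrp φ)) ∧
      ∀ 𝔭 : PrimeSpectrum R, ∃ f ∉ 𝔭.asIdeal, ∃ b : Fin (r 𝔭) → P, IsBasisAway f b := by
  obtain ⟨C, _, _, _, hC, ⟨α⟩⟩ := h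
  obtain ⟨h1, h2⟩ := hC.lieAlg_finite_and_projective
  refine ⟨lieAlg R C, inferInstance, inferInstance, h1, h2, pOperation R C p,
    ⟨α.trans hC.dualIso⟩, fun 𝔭 => ?_⟩
  obtain ⟨f, hf, δ, hδ, -⟩ := hC.exists_tangent_basis 𝔭
  exact ⟨f, hf, δ, hδ⟩

theorem exists_notMem_forall_dvd {m : ℕ} (𝔭 : PrimeSpectrum R) {F : Fin m → R}
    (hF : ∀ i, F i ∉ 𝔭.asIdeal) : ∃ f ∉ 𝔭.asIdeal, ∀ i, F i ∣ f :=
  ⟨∏ i, F i, fun h => by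
    obtain ⟨i, -, hi⟩ := (𝔭.2.prod_mem_iff).1 h
    exact hF i hi, fun i => Finset.dvd_prod_of_mem F (Finset.mem_univ i)⟩

variable {A : GrpFunctor.{u, u} R} {P : Type u} [AddCommGroup P] [Module R P] [Module.Finite R P]
  [Module.Projective R P] (φ : P →ₛₗ[frob p R] P) (α : GrpFunctorIso A (frobLinearGrp φ))

include α in
/-- Every homomorphism `A_{P,φ} → 𝔾_m` is killed by the Frobenius. -/
theorem HomOver.baseChange_frobHom_of_iso {S : CommAlgCat.{u} R} (h : HomOver A (Gm R) S) :
    h.baseChange (frobHom p S) = 1 := by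
  obtain ⟨n, ψ, u, v, hu, hv, hvu⟩ := exists_free_retract φ
  -- h is recovered from its pullback h' to the group of a free module by pulling back along v, so
  -- the case of a free module suffices.
  let h' := (h.comp α.symm.hom).comp (frobLinearMap u hu)
  have h1 : h'.baseChange (frobHom p S) = 1 :=
    (basisChart ψ (Pi.basisFun R (Fin n)) S).hom_baseChange_frobHom h'
  have h2 : h = (h'.comp (frobLinearMap v fun x => hv x)).comp α.hom := by
    ext T a
    change h.toFun T a = h.toFun T _
    congr 1
    refine ((α.equiv T.right).symm_apply_apply a).symm.trans
      (congrArg (α.equiv T.right).symm ?_)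
    refine Subtype.ext (LinearMap.ext fun x => ?_)
    exact (congrArg (Multiplicative.toAdd (α.equiv T.right a)).1 (LinearMap.congr_fun hvu x)).symm
  rw [h2]
  change ((h'.baseChange (frobHom p S)).comp (frobLinearMap v fun x => hv x)).comp α.hom = 1
  rw [h1]
  rfl

/-- The Cartier dual as a Frobenius kernel of poly-additive maps in one variable. -/
noncomputable def dualToKernelPolyAdd {C : Type u} [CommRing C] [HopfAlgebra R C] [Coalgebra.IsCocomm R C]
    (ρ : GrpFunctorIso (specGrp R C) (cartierDual A)) :
    GrpFunctorIso (specGrp R C) (frobKernel p (polyAdd (fun _ : Unit => A) (Gm R))) where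
  equiv S := (ρ.equiv S).trans
    { toFun := fun h => (⟨HomOver.toPoly h,
        congrArg HomOver.toPoly (HomOver.baseChange_frobHom_of_iso φ α h)⟩ :
          frobKernelSubgroup p (polyAdd (fun _ : Unit => A) (Gm R)) S)
      invFun := fun f => HomOver.ofPoly f.1
      left_inv := fun _ => rfl
      right_inv := fun _ => rfl
      map_mul' := fun _ _ => rfl }
  naturality {S T} f x := by
    rw [MulEquiv.trans_apply, ρ.naturality]
    rfl

/-- The one-variable case of `exists_lieAlg_equiv`. Homomorphisms to 𝔾_m are killed by Frobenius, so
the Cartier dual is its own Frobenius kernel, and a tensor product with one factor P is P. -/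
theorem exists_lieAlg_equiv_of_dual {C : Type u} [CommRing C] [HopfAlgebra R C]
    [Coalgebra.IsCocomm R C] (ρ : GrpFunctorIso (specGrp R C) (cartierDual A)) :
    ∃ e : lieAlg R C ≃ₗ[R] P, (∀ D, e (pOperation R C p D) = φ (e D)) ∧
      ∀ (D : lieAlg R C) (S : CommAlgCat.{u} R) (a : A.obj S),
        homDifferential (ρ.equiv _ (tangentPoint D)) S a =
          (Multiplicative.toAdd (α.equiv S a)).1 (e D) := by
  obtain ⟨e, he, he'⟩ := exists_lieAlg_equiv (dualToKernelPolyAdd φ α ρ) (fun _ : Unit => φ)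
    fun _ => α
  let q : PiTensorProduct R (fun _ : Unit => P) ≃ₗ[R] P := PiTensorProduct.subsingletonEquiv ()
  have hq : ∀ x, q.symm x = PiTensorProduct.tprod R fun _ => x := fun x =>
    PiTensorProduct.subsingletonEquiv_symm_apply' () x
  refine ⟨e.trans q, fun D => ?_, fun D S a => ?_⟩
  · rw [LinearEquiv.trans_apply, LinearEquiv.trans_apply, he, ← LinearEquiv.eq_symm_apply, hq]
    obtain ⟨x, hx⟩ := q.symm.surjective (e D)
    rw [← hx, LinearEquiv.apply_symm_apply, hq, tensorPLinear_tprod]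
  · refine (he' D S fun _ => a).trans ?_
    obtain ⟨x, hx⟩ := q.symm.surjective (e D)
    rw [LinearEquiv.trans_apply, ← hx, LinearEquiv.apply_symm_apply, hq]
    have h := tensorEval_tprod (P := fun _ : Unit => P) (fun _ => φ) (fun _ => α.equiv S a) fun _ => x
    exact h.trans (by simp)

end Cosmooth

theorem propositionp {p : ℕ} [Fact p.Prime] {R : Type u} [CommRing R] [Algebra (ZMod p) R]
    {m : ℕ} :
    (∀ (P : Fin m → Type u) [∀ i, AddCommGroup (P i)] [∀ i, Module R (P i)]
        [∀ i, Module.Finite R (P i)] [∀ i, Module.Projective R (P i)]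
        (φ : ∀ i, P i →ₛₗ[frob p R] P i),
      ∃ e : cartierDual (frobLinearGrp (tensorPLinear φ)) ≅
          frobKernel p (polyAdd (fun i => frobLinearGrp (φ i)) (Gm R)),
        e.hom ≫ frobKernelInclusion p (polyAdd (fun i => frobLinearGrp (φ i)) (Gm R)) =
          dualToPolyAdd φ) ∧
    (∀ (A : Fin m → GrpFunctor.{u, u} R) (r : Fin m → PrimeSpectrum R → ℕ),
      (∀ i, IsCosmoothGroup p 1 (A i) (r i)) →
        IsSmoothGroup p 1 (frobKernel p (polyAdd A (Gm R))) (fun 𝔭 => ∏ i, r i 𝔭) ∧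
        ∀ (C : Fin m → Type u) [∀ i, CommRing (C i)] [∀ i, HopfAlgebra R (C i)]
          [∀ i, Coalgebra.IsCocomm R (C i)]
          (ρ : ∀ i, GrpFunctorIso (specGrp R (C i)) (cartierDual (A i)))
          (K : Type u) [CommRing K] [HopfAlgebra R K] [Coalgebra.IsCocomm R K]
          (κ : GrpFunctorIso (specGrp R K) (frobKernel p (polyAdd A (Gm R)))),
          ∃ e : lieAlg R K ≃ₗ[R] PiTensorProduct R (fun i => lieAlg R (C i)),
            (∀ D : lieAlg R K, e (pOperation R K p D) =
              tensorPLinear (fun i => pOperation R (C i) p) (e D)) ∧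
            ∀ (D : ∀ i, lieAlg R (C i)) (S : CommAlgCat.{u} R) (a : ∀ i, (A i).obj S),
              polyAddDifferential
                  (κ.equiv _ (tangentPoint (e.symm (PiTensorProduct.tprod R D)))).1 S a =
                ∏ i, homDifferential ((ρ i).equiv _ (tangentPoint (D i))) S (a i)) := by
  refine ⟨fun P _ _ _ _ φ => (isDualIso_of_projective φ).exists_iso, fun A r hA => ?_⟩
  choose P iP iM iF iPr φ hα hb using fun i => (hA i).exists_iso
  let α : ∀ i, GrpFunctorIso (A i) (frobLinearGrp (φ i)) := fun i => (hα i).some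
  refine ⟨isSmoothGroup_of_iso φ α r fun 𝔭 => ?_, ?_⟩
  · choose F hF b hFb using fun i => hb i 𝔭
    -- The product of the elements F i stays outside 𝔭 and serves all factors at once.
    obtain ⟨f, hf, hdvd⟩ := exists_notMem_forall_dvd 𝔭 hF
    exact ⟨f, hf, fun i => ((hFb i).of_dvd (hdvd i)).nonempty_basis⟩
  · intro C _ _ _ ρ K _ _ _ κ
    choose e he he' using fun i => exists_lieAlg_equiv_of_dual (φ i) (α i) (ρ i)
    obtain ⟨E, hE, hE'⟩ := exists_lieAlg_equiv κ φ α
    -- The comparison goes through ⨂ P_i, identified factor by factor with the tensor product of the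
    -- Lie algebras of the duals.
    refine ⟨E.trans (PiTensorProduct.congr e).symm, fun D => ?_, fun D S a => ?_⟩
    · rw [LinearEquiv.trans_apply, LinearEquiv.trans_apply, hE, LinearEquiv.symm_apply_eq]
      obtain ⟨x, hx⟩ := (PiTensorProduct.congr e).surjective (E D)
      rw [← hx, LinearEquiv.symm_apply_apply]
      exact (map_tensorPLinear (fun i => (e i).toLinearMap) he x).symm
    · rw [hE', LinearEquiv.symm_trans_apply, LinearEquiv.symm_symm, LinearEquiv.apply_symm_apply,
        PiTensorProduct.congr_tprod]
      refine (tensorEval_tprod φ (fun i => (α i).equiv S (a i)) _).trans ?_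
      exact Finset.prod_congr rfl fun i _ => (he' i (D i) S (a i)).symm
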